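/- Let $(M_x)_{x\in\mathcal I}$ be a family of Markov chains, where $M_x$ is a row-stochastic transition matrix on the state space $\{0,1\}^{n}$, $n=n(x)$, reversible with respect to an everywhere positive probability distribution $\pi=\pi_x$, i.e. $\pi_i M_x[i,j]=\pi_j M_x[j,i]$ for all $i,j$ (for an ergodic reversible chain $\pi$ is its limiting distribution). Throughout, a quantum circuit is a sequence of unitary gates, each acting on at most two qubits; its size is its number of qubits (ancillas included) plus its number of gates; and all polynomials are independent of $x$. Assume that the family is strongly samplable, that is: (a) (row computability) for every $0<\varepsilon<1$ and every $x$ there is a quantum circuit (in particular, a classical one qualifies) of size $\mathrm{poly}(n,1/\varepsilon)$ which, given $i\in\{0,1\}^n$ and ancillas in $|0\rangle$, after measurement outputs with probability at least $1-\varepsilon$ a list of pairs $(j,\tilde m_j)$ in which $j$ runs exactly once over each index with $M_x[i,j]\neq 0$, and $|\tilde m_j-M_x[i,j]|\le\varepsilon$; (b) (ratios) for every $0<\varepsilon<1$ and every $x$ there is a quantum circuit of size $\mathrm{poly}(n,1/\varepsilon)$ which, given $i,j\in\{0,1\}^n$, outputs with probability at least $1-\varepsilon$ a number $q$ with $|q-\pi_i/\pi_j|\le\varepsilon\max(1,\pi_i/\pi_j)$.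 Then the matrices $$H_{M_x}=I-\mathrm{Diag}(\sqrt{\pi_i})\,M_x\,\mathrm{Diag}(1/\sqrt{\pi_j})$$ form a family of simulatable Hamiltonians: each $H_{M_x}$ is Hermitian, and for all $x$, all real $t>0$ and all $0<\alpha<1$ there is a quantum circuit $C$ of size $\mathrm{poly}(n,t,1/\alpha)$, on $n$ qubits and some number $a$ of ancillas, such that $$\bigl\|\,C\,(|\psi\rangle\otimes|0^a\rangle)-(e^{-itH_{M_x}}|\psi\rangle)\otimes|0^a\rangle\,\bigr\|\le\alpha\,\|\psi\|\qquad\text{for every }|\psi\rangle\in(\mathbb C^{2})^{\otimes n}.$$ -/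

import Mathlib

noncomputable section

namespace QMarkov

/-! ### Quantum circuits -/

/-- Computational basis states of a register whose qubits are labelled by `W`.
The states of `n` qubits are indexed by `Bits (Fin n)`. -/
abbrev Bits (W : Type) : Type := W → Bool

/-- An elementary gate on a register with qubits `W`: an arbitrary unitary acting on at most two
distinct qubits. -/
structure Gate (W : Type) where
  arity : ℕ
  arity_le : arity ≤ 2
  wires : Fin arity ↪ W
  unitary : Matrix.unitaryGroup (Bits (Fin arity)) ℂ

open Classical in
/-- The unitary of a gate on the whole register: the gate's matrix on its own wires, tensored with
the identity on all other wires. -/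
def Gate.toMatrix {W : Type} (g : Gate W) : Matrix (Bits W) (Bits W) ℂ :=
  fun x y =>
    if ∀ v, v ∉ Set.range g.wires → x v = y v then
      (g.unitary : Matrix (Bits (Fin g.arity)) (Bits (Fin g.arity)) ℂ) (x ∘ g.wires) (y ∘ g.wires)
    else 0

/-- A quantum circuit: a finite sequence of gates, the head of the list being applied first. -/
abbrev Circuit (W : Type) : Type := List (Gate W)

/-- The unitary implemented by a circuit. -/
def Circuit.toMatrix {W : Type} [Fintype W] [DecidableEq W] : Circuit W → Matrix (Bits W) (Bits W) ℂ
  | [] => 1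
  | g :: C => Circuit.toMatrix C * g.toMatrix

/-- Size of a circuit: number of qubits plus number of gates. -/
def Circuit.size {W : Type} [Fintype W] (C : Circuit W) : ℕ := Fintype.card W + C.length

/-! ### Simulatable Hamiltonians -/

/-- `|ψ⟩ ⊗ |0…0⟩`, with `a` ancilla qubits in state `|0⟩`. -/
def withAncillas {W : Type} (a : ℕ) (ψ : Bits W → ℂ) : Bits (W ⊕ Fin a) → ℂ :=
  fun z => if ∀ k, z (Sum.inr k) = false then ψ (fun w => z (Sum.inl w)) else 0

/-- The circuit `C`, on `n` qubits and `a` ancillas, implements the operator `U` on `n` qubits to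
within accuracy `α` in operator norm, started with the ancillas in `|0…0⟩` and returning them to
`|0…0⟩`: `‖C (|ψ⟩ ⊗ |0⟩) - (U |ψ⟩) ⊗ |0⟩‖ ≤ α ‖ψ‖` for every vector `ψ`, with Euclidean norms. -/
def Approximates {n a : ℕ} (C : Circuit (Fin n ⊕ Fin a))
    (U : Matrix (Bits (Fin n)) (Bits (Fin n)) ℂ) (α : ℝ) : Prop :=
  ∀ ψ : Bits (Fin n) → ℂ,
    ‖WithLp.toLp 2
        (Matrix.mulVec C.toMatrix (withAncillas a ψ) - withAncillas a (Matrix.mulVec U ψ))‖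
      ≤ α * ‖WithLp.toLp 2 ψ‖

/-- A family of operators `H x` on `n x` qubits is a family of simulatable Hamiltonians: each `H x`
is Hermitian and, for all `t > 0` and `0 < α < 1`, the unitary `exp (-i t (H x))` is implemented to
within accuracy `α` by a quantum circuit of size `poly(n, t, 1/α)`; the polynomial depends neither
on `x` nor on `t` and `α`. -/
def Simulatable {ι : Type*} (n : ι → ℕ)
    (H : ∀ x, Matrix (Bits (Fin (n x))) (Bits (Fin (n x))) ℂ) : Prop :=
  (∀ x, (H x).IsHermitian) ∧
  ∃ c : ℕ, ∀ x, ∀ t : ℝ, 0 < t → ∀ α : ℝ, 0 < α → α < 1 →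
    ∃ (a : ℕ) (C : Circuit (Fin (n x) ⊕ Fin a)),
      (C.size : ℝ) ≤ c * ((n x : ℝ) + t + 1 / α) ^ c ∧
      Approximates C (NormedSpace.exp ((-Complex.I * (t : ℂ)) • H x)) α

/-! ### Quantum algorithms with classical input and output -/

/-- A quantum program with input bits `I` and output bits `O`: a circuit on the input qubits and
`ancillas` further qubits, together with pairwise distinct output qubits. Classical (reversible,
deterministic or randomized) circuits are special cases. -/
structure Program (I O : Type) where
  ancillas : ℕ
  circuit : Circuit (I ⊕ Fin ancillas)
  out : O ↪ I ⊕ Fin ancillas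

/-- Number of qubits plus number of gates. -/
def Program.size {I O : Type} [Fintype I] (P : Program I O) : ℕ := P.circuit.size

open Classical in
/-- The probability that, when the program is run on the basis state `|i⟩ ⊗ |0…0⟩` and all qubits
are measured in the computational basis, the string on the output qubits satisfies `good`. -/
def Program.prob {I O : Type} [Fintype I] [DecidableEq I] (P : Program I O) (i : Bits I)
    (good : Bits O → Prop) : ℝ :=
  ∑ z : Bits (I ⊕ Fin P.ancillas),
    if good (fun o => z (P.out o)) then
      ‖P.circuit.toMatrix z (Sum.elim i (fun _ => false))‖ ^ 2
    else 0

/-! ### Row computability -/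

/-- Bits of a list of at most `D` entries (index, value) with `n`-bit indices and `w`-bit values.
The first bit of each slot tells whether the slot is in use. -/
abbrev ListBits (D n w : ℕ) : Type := Fin D × (Unit ⊕ Fin n ⊕ Fin w)

/-- Slot `s` is in use. -/
def slotUsed {D n w : ℕ} (y : Bits (ListBits D n w)) (s : Fin D) : Prop :=
  y (s, Sum.inl ()) = true

/-- The index stored in slot `s`. -/
def slotIndex {D n w : ℕ} (y : Bits (ListBits D n w)) (s : Fin D) : Bits (Fin n) :=
  fun k => y (s, Sum.inr (Sum.inl k))

/-- The value stored in slot `s`: a binary fixed-point number with `b` fractional bits. -/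
def slotValue {D n w : ℕ} (b : ℕ) (y : Bits (ListBits D n w)) (s : Fin D) : ℝ :=
  (Nat.ofBits (fun k => y (s, Sum.inr (Sum.inr k))) : ℝ) / 2 ^ b

/-- The list `y` runs over the nonzero entries of the vector `r`, each listed once, with values
correct to within `ε`. -/
def ListsRow {D n w : ℕ} (b : ℕ) (r : Bits (Fin n) → ℝ) (ε : ℝ)
    (y : Bits (ListBits D n w)) : Prop :=
  (∀ s s', slotUsed y s → slotUsed y s' → slotIndex y s = slotIndex y s' → s = s') ∧
  (∀ j, r j ≠ 0 ↔ ∃ s, slotUsed y s ∧ slotIndex y s = j) ∧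
  (∀ s, slotUsed y s → |slotValue b y s - r (slotIndex y s)| ≤ ε)

/-- A family of entrywise nonnegative matrices `A x`, indexed by `n x`-bit strings, is row
computable: there is an efficient quantum algorithm (size `poly(n, 1/ε)`) that, given a row index
`i`, outputs with probability at least `1 - ε` a list of the pairs `(j, A i j)` running over the
nonzero entries of row `i`, the values being given to within `ε`. -/
def RowComputable {ι : Type*} (n : ι → ℕ)
    (A : ∀ x, Matrix (Bits (Fin (n x))) (Bits (Fin (n x))) ℝ) : Prop :=
  ∃ c : ℕ, ∀ x, ∀ ε : ℝ, 0 < ε → ε < 1 →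
    ∃ (D w b : ℕ) (P : Program (Fin (n x)) (ListBits D (n x) w)),
      (P.size : ℝ) ≤ c * ((n x : ℝ) + 1 / ε) ^ c ∧
      ∀ i, 1 - ε ≤ P.prob i (ListsRow b (A x i) ε)

/-! ### Reversible and strongly samplable Markov chains -/

/-- `M` is the (row-stochastic) transition matrix of a Markov chain that is reversible with respect
to the everywhere positive probability distribution `π`. -/
structure IsReversible {Ω : Type*} [Fintype Ω] [DecidableEq Ω] (M : Matrix Ω Ω ℝ) (π : Ω → ℝ) :
    Prop where
  stochastic : M ∈ Matrix.rowStochastic ℝ Ω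
  pos : ∀ i, 0 < π i
  sum_eq_one : ∑ i, π i = 1
  detailed_balance : ∀ i j, M i j * π i = M j i * π j

/-- The value of a nonnegative binary floating-point number with mantissa of `w` bits, exponent of
`v` bits and exponent bias `b`. With `v = 0` this is a fixed-point number. -/
def floatValue {w v : ℕ} (b : ℕ) (y : Bits (Fin w ⊕ Fin v)) : ℝ :=
  (Nat.ofBits (fun k => y (Sum.inl k)) : ℝ) * 2 ^ Nat.ofBits (fun k => y (Sum.inr k)) / 2 ^ b

/-- The ratios `π i / π j` are efficiently approximable: there is an efficient quantum algorithm
(size `poly(n, 1/ε)`) that, given `i` and `j`, outputs with probability at least `1 - ε` a number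
`q` with `|q - r| ≤ ε max(1, r)`, where `r = π i / π j`. Both an approximation within additive error
`ε` and an approximation within relative error `ε` qualify. -/
def RatioApproximable {ι : Type*} (n : ι → ℕ) (π : ∀ x, Bits (Fin (n x)) → ℝ) : Prop :=
  ∃ c : ℕ, ∀ x, ∀ ε : ℝ, 0 < ε → ε < 1 →
    ∃ (w v b : ℕ) (P : Program (Fin (n x) ⊕ Fin (n x)) (Fin w ⊕ Fin v)),
      (P.size : ℝ) ≤ c * ((n x : ℝ) + 1 / ε) ^ c ∧
      ∀ i j, 1 - ε ≤ P.prob (Sum.elim i j)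
        (fun y => |floatValue b y - π x i / π x j| ≤ ε * max 1 (π x i / π x j))

/-- A family of Markov chains `M x` on `n x`-bit strings, reversible with respect to `π x`, is
strongly samplable. -/
structure StronglySamplable {ι : Type*} (n : ι → ℕ)
    (M : ∀ x, Matrix (Bits (Fin (n x))) (Bits (Fin (n x))) ℝ)
    (π : ∀ x, Bits (Fin (n x)) → ℝ) : Prop where
  reversible : ∀ x, IsReversible (M x) (π x)
  rowComputable : RowComputable n M
  ratioApproximable : RatioApproximable n π

/-- The Hamiltonian `I - Diag(√π) M Diag(1/√π)` corresponding to a reversible Markov chain. -/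
def chainHamiltonian {Ω : Type*} [Fintype Ω] [DecidableEq Ω] (M : Matrix Ω Ω ℝ) (π : Ω → ℝ) :
    Matrix Ω Ω ℂ :=
  (1 - Matrix.diagonal (fun i => √(π i)) * M * Matrix.diagonal (fun i => 1 / √(π i))).map
    ((↑) : ℝ → ℂ)

end QMarkov

end

/-!
# Simulating the Hamiltonian of a reversible Markov chain

By detailed balance, `√(π i) M i j / √(π j) = √(M i j M j i)`, so `H = 1 - S` with `S` the entrywise
geometric mean of `M` and its transpose (`chainHamiltonian_eq`), and up to the phase `exp (-i t)` it
remains to simulate `exp (i t S)`. The row program alone suffices for this.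

*Encoding.* `rowPrep` runs the row program on a copy of the row index, writes a superposition of the
listed entries into a column register, and runs the program backwards. The part of the result with a
flag set is close to `|i⟩ ↦ η ∑ j, √(M i j) |i, j⟩` (`norm_flagProj_mul_rowPrep_sub_le`). Each entry
is written by a small rotation with sine about `η √(M i j)`; the sines are rounded to one of `L`
levels, so that the rotations are products of gates controlled by thresholds
(`implementable_level`), and the amplitude lost from the initial state by the earlier rotations is of
second order in `η`. Uniformity over superpositions of rows is automatic, since the row index is never
changed and the columns of the error matrix are orthogonal. A coin in an equal superposition then
controls an exchange of row and column index. The operator that projects onto the set flag and flips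
the coin compares `|i, j⟩` with `|j, i⟩`, and its compression to the states with zero ancillas is
close to `η² S` (`rowTarget_conjTranspose_mul`, `norm_compression_sub_le`).

*Walk.* Let `κ` be that operator conjugated by the preparation, `J` the addition of zero ancillas and
`R = 1 - 2 J Jᴴ`. With `g = exp (i τ κ)`, a product of gates, the operator `g R g R` acts on the range
of `J` as `1 + 2 i τ Jᴴ κ J` up to `O(τ²)`: to first order, the reflection cancels what leaks out of
the range (`norm_walk_step_sub_le`). Hence `r` such steps simulate the time `2 r τ η²`
(`norm_walk_pow_sub_le`).

*Size.* `Implementable s M` says that a circuit with at most `s` ancillas and gates implements `M`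
exactly; it is closed under products, adjoints and enlarging the register. Rows have polynomially many
nonzero entries because a program of polynomial size can list them, so `1 / η`, `1 / τ`, `L`, `r` and
the inverse of the error allowed to the row program can all be chosen polynomial in `n + t + 1 / α`
(`exists_circuit_chainHamiltonian`).
-/

noncomputable section

namespace QMarkov

open Matrix

set_option linter.unusedSectionVars false

/-! ### Local operators and circuits -/

section Local

variable {U V W : Type}

open Classical in
/-- The operator `M` on the qubits `W`, acting on a larger register `V` through the embedding `e`
and as the identity on the other qubits. A gate acts as `lift` of its unitary along its wires. -/
def lift (e : W ↪ V) (M : Matrix (Bits W) (Bits W) ℂ) : Matrix (Bits V) (Bits V) ℂ :=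
  fun x y => if ∀ v, v ∉ Set.range e → x v = y v then M (x ∘ e) (y ∘ e) else 0

theorem Gate.toMatrix_eq_lift (g : Gate V) :
    g.toMatrix = lift g.wires (g.unitary : Matrix (Bits (Fin g.arity)) (Bits (Fin g.arity)) ℂ) := by
  ext x y
  simp only [Gate.toMatrix, lift]

theorem extend_comp_embedding (e : W ↪ V) (b : Bits W) (x : Bits V) :
    Function.extend e b x ∘ e = b := by
  ext w
  simp [e.injective.extend_apply]

theorem extend_of_notMem_range (e : W ↪ V) (b : Bits W) (x : Bits V) {v : V}
    (hv : v ∉ Set.range e) : Function.extend e b x v = x v :=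
  Function.extend_apply' _ _ _ (by simpa using hv)

theorem extend_comp_self (e : W ↪ V) {x y : Bits V} (h : ∀ v, v ∉ Set.range e → x v = y v) :
    Function.extend e (y ∘ e) x = y := by
  ext v
  by_cases hv : v ∈ Set.range e
  · obtain ⟨w, rfl⟩ := hv
    simp [e.injective.extend_apply]
  · rw [extend_of_notMem_range _ _ _ hv, h v hv]

variable [Fintype U] [DecidableEq U] [Fintype V] [DecidableEq V] [Fintype W] [DecidableEq W]

open Classical in
theorem sum_agree_off_range (e : W ↪ V) (x : Bits V) (f : Bits V → ℂ) :
    ∑ y, (if ∀ v, v ∉ Set.range e → x v = y v then f y else 0)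
      = ∑ b : Bits W, f (Function.extend e b x) := by
  rw [← Finset.sum_filter]
  refine Finset.sum_nbij' (fun y => y ∘ e) (fun b => Function.extend e b x) ?_ ?_ ?_ ?_ ?_
  · simp
  · intro b _
    simp only [Finset.mem_filter, Finset.mem_univ, true_and]
    exact fun v hv => (extend_of_notMem_range e b x hv).symm
  · intro y hy
    exact extend_comp_self e (by simpa using hy)
  · intro b _
    exact extend_comp_embedding e b x
  · intro y hy
    rw [extend_comp_self e (by simpa using hy)]

theorem lift_mul_apply {κ : Type*} (e : W ↪ V) (M : Matrix (Bits W) (Bits W) ℂ)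
    (N : Matrix (Bits V) κ ℂ) (x : Bits V) (k : κ) :
    (lift e M * N) x k = ∑ b : Bits W, M (x ∘ e) b * N (Function.extend e b x) k := by
  classical
  rw [Matrix.mul_apply]
  simp only [lift, ite_mul, zero_mul]
  rw [sum_agree_off_range e x (fun y => M (x ∘ e) (y ∘ e) * N y k)]
  simp only [extend_comp_embedding]

theorem lift_mul (e : W ↪ V) (M N : Matrix (Bits W) (Bits W) ℂ) :
    lift e (M * N) = lift e M * lift e N := by
  classical
  ext x y
  rw [lift_mul_apply]
  have : ∀ b : Bits W, lift e N (Function.extend e b x) y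
      = if ∀ v, v ∉ Set.range e → x v = y v then N b (y ∘ e) else 0 := by
    intro b
    simp only [lift, extend_comp_embedding]
    congr 1
    apply propext
    exact forall₂_congr fun v hv => by rw [extend_of_notMem_range _ _ _ hv]
  simp only [this]
  by_cases h : ∀ v, v ∉ Set.range e → x v = y v
  · simp only [lift, if_pos h, Matrix.mul_apply]
  · simp only [lift, if_neg h, mul_zero, Finset.sum_const_zero]

theorem lift_one (e : W ↪ V) :
    lift e (1 : Matrix (Bits W) (Bits W) ℂ) = 1 := by
  classical
  ext x y
  simp only [lift, Matrix.one_apply]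
  by_cases h : x = y
  · subst h; simp
  · rw [if_neg h]
    by_cases h' : ∀ v, v ∉ Set.range e → x v = y v
    · rw [if_pos h', if_neg]
      intro h2
      apply h
      rw [← extend_comp_self e h', ← h2]
      exact (extend_comp_self e (x := x) (y := x) fun _ _ => rfl).symm
    · rw [if_neg h']

theorem lift_conjTranspose (e : W ↪ V) (M : Matrix (Bits W) (Bits W) ℂ) :
    (lift e M)ᴴ = lift e Mᴴ := by
  classical
  ext x y
  simp only [conjTranspose_apply, lift]
  by_cases h : ∀ v, v ∉ Set.range e → y v = x v
  · rw [if_pos h, if_pos fun v hv => (h v hv).symm]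
  · rw [if_neg h, if_neg fun h' => h fun v hv => (h' v hv).symm, star_zero]

theorem lift_lift (e' : U ↪ W) (e : W ↪ V) (M : Matrix (Bits U) (Bits U) ℂ) :
    lift e (lift e' M) = lift (e'.trans e) M := by
  classical
  ext x y
  have key : (∀ v, v ∉ Set.range (e'.trans e) → x v = y v) ↔
      (∀ v, v ∉ Set.range e → x v = y v) ∧
        ∀ w, w ∉ Set.range e' → (x ∘ e) w = (y ∘ e) w := by
    constructor
    · intro h
      refine ⟨fun v hv => h v ?_, fun w hw => h (e w) ?_⟩
      · rintro ⟨u, rfl⟩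
        exact hv ⟨e' u, rfl⟩
      · rintro ⟨u, hu⟩
        exact hw ⟨u, e.injective hu⟩
    · rintro ⟨h1, h2⟩ v hv
      by_cases hv' : v ∈ Set.range e
      · obtain ⟨w, rfl⟩ := hv'
        refine h2 w ?_
        rintro ⟨u, rfl⟩
        exact hv ⟨u, rfl⟩
      · exact h1 v hv'
  simp only [lift, key]
  by_cases h1 : ∀ v, v ∉ Set.range e → x v = y v
  · rw [if_pos h1]
    by_cases h2 : ∀ w, w ∉ Set.range e' → (x ∘ e) w = (y ∘ e) w
    · rw [if_pos h2, if_pos ⟨h1, h2⟩]; rfl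
    · rw [if_neg h2, if_neg fun h => h2 h.2]
  · rw [if_neg h1, if_neg fun h => h1 h.1]

/-- The same gate on a larger register. -/
def Gate.map (e : W ↪ V) (g : Gate W) : Gate V :=
  { g with wires := g.wires.trans e }

/-- The inverse gate. -/
def Gate.inv (g : Gate V) : Gate V :=
  { g with unitary := star g.unitary }

theorem Gate.map_toMatrix (e : W ↪ V) (g : Gate W) : (g.map e).toMatrix = lift e g.toMatrix := by
  rw [Gate.toMatrix_eq_lift, Gate.toMatrix_eq_lift, lift_lift]
  rfl

theorem Gate.inv_toMatrix (g : Gate V) : g.inv.toMatrix = g.toMatrixᴴ := by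
  rw [Gate.toMatrix_eq_lift, Gate.toMatrix_eq_lift, lift_conjTranspose]
  rfl

theorem Gate.conjTranspose_mul_self (g : Gate V) : g.toMatrixᴴ * g.toMatrix = 1 := by
  rw [Gate.toMatrix_eq_lift, lift_conjTranspose, ← lift_mul, ← lift_one g.wires]
  congr 1
  exact (Matrix.mem_unitaryGroup_iff').mp g.unitary.2

theorem Circuit.toMatrix_append (C C' : Circuit V) :
    Circuit.toMatrix (C ++ C') = C'.toMatrix * C.toMatrix := by
  induction C with
  | nil => simp [Circuit.toMatrix]
  | cons g C ih => rw [List.cons_append, Circuit.toMatrix, ih, Circuit.toMatrix, Matrix.mul_assoc]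

/-- The circuit `C`, run on a larger register. -/
def Circuit.lift (e : W ↪ V) (C : Circuit W) : Circuit V :=
  List.map (Gate.map e) C

theorem Circuit.lift_toMatrix (e : W ↪ V) (C : Circuit W) :
    (C.lift e).toMatrix = QMarkov.lift e C.toMatrix := by
  induction C with
  | nil => simp [Circuit.lift, Circuit.toMatrix, lift_one]
  | cons g C ih =>
    rw [Circuit.toMatrix, lift_mul, ← ih, ← Gate.map_toMatrix]
    rfl

/-- The inverse circuit. -/
def Circuit.inv (C : Circuit V) : Circuit V :=
  (List.map Gate.inv C).reverse

theorem Circuit.inv_toMatrix (C : Circuit V) : C.inv.toMatrix = C.toMatrixᴴ := by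
  induction C with
  | nil => simp [Circuit.inv, Circuit.toMatrix]
  | cons g C ih =>
    have : Circuit.inv (g :: C) = Circuit.inv C ++ [g.inv] := by simp [Circuit.inv]
    rw [this, Circuit.toMatrix_append, ih]
    simp [Circuit.toMatrix, Gate.inv_toMatrix, conjTranspose_mul]

theorem Circuit.conjTranspose_mul_self (C : Circuit V) : C.toMatrixᴴ * C.toMatrix = 1 := by
  induction C with
  | nil => simp [Circuit.toMatrix]
  | cons g C ih =>
    rw [Circuit.toMatrix, conjTranspose_mul, Matrix.mul_assoc,
      ← Matrix.mul_assoc _ (Circuit.toMatrix C), ih, Matrix.one_mul, g.conjTranspose_mul_self]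

end Local

/-! ### Operators implemented exactly, with clean ancillas -/

section Implementable

variable {V W A B : Type}

/-- The isometry `ψ ↦ ψ ⊗ |0…0⟩` adding ancillas labelled by `A`. -/
def zeroExt (W A : Type) [DecidableEq (Bits (W ⊕ A))] : Matrix (Bits (W ⊕ A)) (Bits W) ℂ :=
  fun z x => if z = Sum.elim x (fun _ => false) then 1 else 0

variable [Fintype V] [DecidableEq V] [Fintype W] [DecidableEq W] [Fintype A] [DecidableEq A]
  [Fintype B] [DecidableEq B]

theorem mul_zeroExt_apply {κ : Type*} (N : Matrix κ (Bits (W ⊕ A)) ℂ) (k : κ) (x : Bits W) :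
    (N * zeroExt W A) k x = N k (Sum.elim x fun _ => false) := by
  simp [Matrix.mul_apply, zeroExt]

theorem zeroExt_mul_apply {κ : Type*} (N : Matrix (Bits W) κ ℂ) (z : Bits (W ⊕ A)) (k : κ) :
    (zeroExt W A * N) z k = if ∀ a, z (Sum.inr a) = false then N (z ∘ Sum.inl) k else 0 := by
  rw [Matrix.mul_apply]
  have : ∀ x : Bits W, z = Sum.elim x (fun _ => false) ↔
      x = z ∘ Sum.inl ∧ ∀ a, z (Sum.inr a) = false := by
    intro x
    constructor
    · rintro rfl
      simp
    · rintro ⟨rfl, h⟩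
      ext v
      cases v <;> simp [h]
  simp only [zeroExt, this, ite_mul, one_mul, zero_mul]
  by_cases h : ∀ a, z (Sum.inr a) = false <;> simp [h]

theorem zeroExt_conjTranspose_mul_self : (zeroExt W A)ᴴ * zeroExt W A = 1 := by
  ext x y
  rw [mul_zeroExt_apply, conjTranspose_apply, zeroExt, Matrix.one_apply]
  have : (Sum.elim y fun _ => false : Bits (W ⊕ A)) = Sum.elim x (fun _ => false) ↔ x = y := by
    constructor
    · intro h
      ext w
      exact (congrFun h (Sum.inl w)).symm
    · rintro rfl; rfl
  by_cases h : x = y <;> simp [this, h]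

/-- `M` is implemented exactly by a circuit with at most `s` ancillas and gates in total; the
ancillas start in `|0…0⟩` and return to `|0…0⟩`. -/
def Implementable (s : ℕ) (M : Matrix (Bits W) (Bits W) ℂ) : Prop :=
  ∃ (a : ℕ) (C : Circuit (W ⊕ Fin a)), a + C.length ≤ s ∧
    C.toMatrix * zeroExt W (Fin a) = zeroExt W (Fin a) * M

/-- Adding qubits and ancillas to the register of a circuit. -/
theorem lift_mul_zeroExt (e : W ↪ V) (e' : A ↪ B) {N : Matrix (Bits (W ⊕ A)) (Bits (W ⊕ A)) ℂ}
    {M : Matrix (Bits W) (Bits W) ℂ} (h : N * zeroExt W A = zeroExt W A * M) :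
    lift (e.sumMap e') N * zeroExt V B = zeroExt V B * lift e M := by
  classical
  ext z x
  rw [mul_zeroExt_apply, zeroExt_mul_apply]
  have h' := congrFun (congrFun h (z ∘ e.sumMap e')) (x ∘ e)
  rw [mul_zeroExt_apply, zeroExt_mul_apply] at h'
  have e1 : (Sum.elim x (fun _ => false) : Bits (V ⊕ B)) ∘ e.sumMap e'
      = Sum.elim (x ∘ e) fun _ => false := by
    ext v
    cases v <;> simp
  have e2 : (z ∘ e.sumMap e') ∘ Sum.inl = (z ∘ Sum.inl) ∘ e := by
    ext v
    simp
  have e3 : (∀ v, v ∉ Set.range (e.sumMap e') →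
      z v = (Sum.elim x (fun _ => false) : Bits (V ⊕ B)) v) ↔
      (∀ v, v ∉ Set.range e → (z ∘ Sum.inl) v = x v) ∧
        ∀ b, b ∉ Set.range e' → z (Sum.inr b) = false := by
    constructor
    · intro H
      refine ⟨fun v hv => H (Sum.inl v) ?_, fun v hv => H (Sum.inr v) ?_⟩
      · rintro ⟨u | u, hu⟩ <;> simp at hu
        exact hv ⟨u, hu⟩
      · rintro ⟨u | u, hu⟩ <;> simp at hu
        exact hv ⟨u, hu⟩
    · rintro ⟨H1, H2⟩ (v | v) hv
      · refine H1 v ?_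
        rintro ⟨u, rfl⟩
        exact hv ⟨Sum.inl u, rfl⟩
      · refine H2 v ?_
        rintro ⟨u, rfl⟩
        exact hv ⟨Sum.inr u, rfl⟩
  rw [e2] at h'
  simp only [lift, e1, e3, h']
  by_cases hx : ∀ v, v ∉ Set.range e → (z ∘ Sum.inl) v = x v
  · by_cases hz : ∀ b, z (Sum.inr b) = false
    · have : ∀ a, (z ∘ e.sumMap e') (Sum.inr a) = false := fun a => hz (e' a)
      rw [if_pos ⟨hx, fun b _ => hz b⟩, if_pos this, if_pos hz, if_pos hx]
    · rw [if_neg hz]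
      by_cases hz' : ∀ b, b ∉ Set.range e' → z (Sum.inr b) = false
      · rw [if_pos ⟨hx, hz'⟩, if_neg]
        intro H
        apply hz
        intro b
        by_cases hb : b ∈ Set.range e'
        · obtain ⟨a, rfl⟩ := hb
          exact H a
        · exact hz' b hb
      · rw [if_neg fun H => hz' H.2]
  · rw [if_neg fun H => hx H.1]
    rw [if_neg hx, ite_self]

theorem lift_refl (M : Matrix (Bits W) (Bits W) ℂ) : lift (Function.Embedding.refl W) M = M := by
  ext x y
  simp [lift]
  rfl

theorem Implementable.of_circuit {M : Matrix (Bits W) (Bits W) ℂ} (C : Circuit (W ⊕ A))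
    (h : C.toMatrix * zeroExt W A = zeroExt W A * M) :
    Implementable (Fintype.card A + C.length) M := by
  have := lift_mul_zeroExt (Function.Embedding.refl W) (Fintype.equivFin A).toEmbedding h
  rw [lift_refl, ← Circuit.lift_toMatrix] at this
  exact ⟨_, _, by simp [Circuit.lift], this⟩

theorem Implementable.mono {s s' : ℕ} {M : Matrix (Bits W) (Bits W) ℂ} (h : Implementable s M)
    (hs : s ≤ s') : Implementable s' M := by
  obtain ⟨a, C, hC, h⟩ := h
  exact ⟨a, C, hC.trans hs, h⟩

theorem Implementable.of_le_of_eq {s s' : ℕ} {M M' : Matrix (Bits W) (Bits W) ℂ}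
    (h : Implementable s M) (hs : s ≤ s') (hM : M = M') : Implementable s' M' :=
  hM ▸ h.mono hs

theorem Implementable.gate (g : Gate W) : Implementable 1 g.toMatrix := by
  refine ⟨0, [g.map ⟨Sum.inl, Sum.inl_injective⟩], by simp, ?_⟩
  ext z x
  rw [mul_zeroExt_apply, zeroExt_mul_apply]
  simp only [Circuit.toMatrix, Matrix.one_mul, Gate.map_toMatrix, lift]
  rw [if_pos, if_pos]
  · rfl
  · exact fun a => a.elim0
  · rintro (v | v) hv
    · exact absurd ⟨v, rfl⟩ hv
    · exact v.elim0

theorem Implementable.one : Implementable 0 (1 : Matrix (Bits W) (Bits W) ℂ) :=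
  ⟨0, [], by simp, by simp [Circuit.toMatrix]⟩

theorem Implementable.mul {s t : ℕ} {M N : Matrix (Bits W) (Bits W) ℂ} (hM : Implementable s M)
    (hN : Implementable t N) : Implementable (s + t) (M * N) := by
  obtain ⟨a, C, hC, h⟩ := hM
  obtain ⟨b, D, hD, h'⟩ := hN
  let ea : Fin a ↪ Fin a ⊕ Fin b := ⟨Sum.inl, Sum.inl_injective⟩
  let eb : Fin b ↪ Fin a ⊕ Fin b := ⟨Sum.inr, Sum.inr_injective⟩
  have h1 := lift_mul_zeroExt (Function.Embedding.refl W) ea h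
  have h2 := lift_mul_zeroExt (Function.Embedding.refl W) eb h'
  rw [lift_refl, ← Circuit.lift_toMatrix] at h1 h2
  refine (Implementable.of_circuit (M := M * N)
    (D.lift ((Function.Embedding.refl W).sumMap eb) ++
      C.lift ((Function.Embedding.refl W).sumMap ea)) ?_).mono ?_
  · rw [Circuit.toMatrix_append, Matrix.mul_assoc, h2, ← Matrix.mul_assoc, h1, Matrix.mul_assoc]
  · simp [Circuit.lift]
    omega

theorem Implementable.pow {s : ℕ} {M : Matrix (Bits W) (Bits W) ℂ} (hM : Implementable s M)
    (r : ℕ) : Implementable (r * s) (M ^ r) := by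
  induction r with
  | zero => simpa using Implementable.one
  | succ r ih => rw [pow_succ]; exact (ih.mul hM).mono (by ring_nf; rfl)

theorem Implementable.conjTranspose_mul_self {s : ℕ} {M : Matrix (Bits W) (Bits W) ℂ}
    (hM : Implementable s M) : Mᴴ * M = 1 := by
  obtain ⟨a, C, -, h⟩ := hM
  have : (zeroExt W (Fin a) * M)ᴴ * (zeroExt W (Fin a) * M) = 1 := by
    rw [← h, conjTranspose_mul, Matrix.mul_assoc, ← Matrix.mul_assoc _ C.toMatrix,
      C.conjTranspose_mul_self, Matrix.one_mul, zeroExt_conjTranspose_mul_self]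
  rwa [conjTranspose_mul, Matrix.mul_assoc, ← Matrix.mul_assoc _ (zeroExt W (Fin a)),
    zeroExt_conjTranspose_mul_self, Matrix.one_mul] at this

theorem Implementable.mul_conjTranspose_self {s : ℕ} {M : Matrix (Bits W) (Bits W) ℂ}
    (hM : Implementable s M) : M * Mᴴ = 1 :=
  mul_eq_one_comm.mp hM.conjTranspose_mul_self

theorem Implementable.conjTranspose {s : ℕ} {M : Matrix (Bits W) (Bits W) ℂ}
    (hM : Implementable s M) : Implementable s Mᴴ := by
  have hu := hM.mul_conjTranspose_self
  obtain ⟨a, C, hC, h⟩ := hM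
  refine ⟨a, C.inv, by simpa [Circuit.inv] using hC, ?_⟩
  have : zeroExt W (Fin a) = C.toMatrix * zeroExt W (Fin a) * Mᴴ := by
    rw [h, Matrix.mul_assoc, hu, Matrix.mul_one]
  rw [Circuit.inv_toMatrix]
  conv_lhs => rw [this]
  rw [Matrix.mul_assoc, ← Matrix.mul_assoc, C.conjTranspose_mul_self, Matrix.one_mul]

theorem Implementable.lift {s : ℕ} {M : Matrix (Bits W) (Bits W) ℂ} (hM : Implementable s M)
    (e : W ↪ V) : Implementable s (QMarkov.lift e M) := by
  obtain ⟨a, C, hC, h⟩ := hM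
  have := lift_mul_zeroExt e (Function.Embedding.refl (Fin a)) h
  rw [← Circuit.lift_toMatrix] at this
  exact ⟨a, _, by simpa [Circuit.lift] using hC, this⟩

theorem Implementable.of_circuit_self (C : Circuit W) : Implementable C.length C.toMatrix := by
  induction C with
  | nil => exact Implementable.one
  | cons g C ih => exact ih.mul (Implementable.gate g)

/-- Regrouping ancillas: a circuit on `(W ⊕ A) ⊕ B` with ancillas `B`, restricted to states whose
qubits in `A` are `|0…0⟩`. -/
theorem lift_sumAssoc_mul_zeroExt (N : Matrix (Bits ((W ⊕ A) ⊕ B)) (Bits ((W ⊕ A) ⊕ B)) ℂ)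
    (z : Bits (W ⊕ (A ⊕ B))) (x : Bits W) :
    (lift (Equiv.sumAssoc W A B).toEmbedding N * zeroExt W (A ⊕ B)) z x
      = (N * (zeroExt (W ⊕ A) B * zeroExt W A)) (z ∘ Equiv.sumAssoc W A B) x := by
  rw [← Matrix.mul_assoc, mul_zeroExt_apply, mul_zeroExt_apply, mul_zeroExt_apply, lift, if_pos]
  · congr 1
    ext v
    rcases v with (v | v) | v <;> simp
  · intro v hv
    exact absurd ⟨(Equiv.sumAssoc W A B).symm v, by simp⟩ hv

theorem zeroExt_mul_zeroExt_mul_apply {κ : Type*} (N : Matrix (Bits W) κ ℂ)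
    (z : Bits (W ⊕ (A ⊕ B))) (k : κ) :
    (zeroExt W (A ⊕ B) * N) z k
      = (zeroExt (W ⊕ A) B * (zeroExt W A * N)) (z ∘ Equiv.sumAssoc W A B) k := by
  simp only [zeroExt_mul_apply, Sum.forall, Function.comp_def, Equiv.sumAssoc_apply_inl_inl,
    Equiv.sumAssoc_apply_inl_inr, Equiv.sumAssoc_apply_inr]
  by_cases h1 : ∀ a, z (Sum.inr (Sum.inl a)) = false <;>
    by_cases h2 : ∀ b, z (Sum.inr (Sum.inr b)) = false <;> simp [h1, h2]

/-- An operator on `W ⊕ A` that maps `ψ ⊗ |0…0⟩` to `M ψ ⊗ |0…0⟩` implements `M`. -/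
theorem Implementable.of_ancilla {s : ℕ} {N : Matrix (Bits (W ⊕ A)) (Bits (W ⊕ A)) ℂ}
    {M : Matrix (Bits W) (Bits W) ℂ} (hN : Implementable s N)
    (h : N * zeroExt W A = zeroExt W A * M) : Implementable (s + Fintype.card A) M := by
  obtain ⟨b, C, hC, hb⟩ := hN
  refine (Implementable.of_circuit (C.lift (Equiv.sumAssoc W A (Fin b)).toEmbedding) ?_).mono ?_
  · ext z x
    rw [Circuit.lift_toMatrix, lift_sumAssoc_mul_zeroExt, zeroExt_mul_zeroExt_mul_apply,
      ← Matrix.mul_assoc, hb, Matrix.mul_assoc, h]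
  · simp [Circuit.lift]
    omega

end Implementable

/-! ### Uniformly controlled one-qubit gates and basis permutations -/

section OneQubit

variable {V W A : Type} [Fintype V] [DecidableEq V] [Fintype W] [DecidableEq W]
  [Fintype A] [DecidableEq A]

/-- `F` does not depend on the qubit `t`. -/
def IndepOf {β : Type*} (t : V) (F : Bits V → β) : Prop :=
  ∀ x b, F (Function.update x t b) = F x

/-- The uniformly controlled gate applying the one-qubit operator `F x` to the qubit `t`, where `x`
is the state of the register. It is meant for `F` that does not depend on `t`. -/
def ucg (t : V) (F : Bits V → Matrix Bool Bool ℂ) : Matrix (Bits V) (Bits V) ℂ :=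
  fun x y => if ∀ v, v ≠ t → x v = y v then F x (x t) (y t) else 0

/-- The operator with matrix entries `⟨x| · |y⟩ = [f x = y]`. For an involution `f`, this is the
basis permutation `|x⟩ ↦ |f x⟩`. -/
def permOp (f : Bits V → Bits V) : Matrix (Bits V) (Bits V) ℂ :=
  fun x y => if f x = y then 1 else 0

theorem permOp_mul_apply {κ : Type*} (f : Bits V → Bits V) (N : Matrix (Bits V) κ ℂ) (x : Bits V)
    (k : κ) : (permOp f * N) x k = N (f x) k := by
  simp [Matrix.mul_apply, permOp]

theorem permOp_mul_permOp (f g : Bits V → Bits V) : permOp f * permOp g = permOp (g ∘ f) := by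
  ext x y
  rw [permOp_mul_apply]
  rfl

theorem permOp_id : permOp (id : Bits V → Bits V) = 1 := by
  ext x y
  simp [permOp, Matrix.one_apply]

theorem eq_update_iff (t : V) (x y : Bits V) (b : Bool) :
    y = Function.update x t b ↔ (∀ v, v ≠ t → x v = y v) ∧ b = y t := by
  rw [Function.eq_update_iff]
  exact ⟨fun h => ⟨fun v hv => (h.2 v hv).symm, h.1.symm⟩,
    fun h => ⟨h.2.symm, fun v hv => (h.1 v hv).symm⟩⟩

theorem ucg_mul_apply {κ : Type*} (t : V) (F : Bits V → Matrix Bool Bool ℂ)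
    (N : Matrix (Bits V) κ ℂ) (x : Bits V) (k : κ) :
    (ucg t F * N) x k = ∑ b, F x (x t) b * N (Function.update x t b) k := by
  rw [Matrix.mul_apply]
  have : ∀ y, ucg t F x y * N y k
      = ∑ b, if y = Function.update x t b then F x (x t) b * N y k else 0 := by
    intro y
    simp only [eq_update_iff, ucg]
    by_cases h : ∀ v, v ≠ t → x v = y v
    · simp only [if_pos h]
      rw [Finset.sum_eq_single (y t)]
      · rw [if_pos ⟨h, rfl⟩]
      · intro b _ hb
        rw [if_neg fun h' => hb h'.2]
      · simp
    · simp only [if_neg h, zero_mul]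
      rw [Finset.sum_eq_zero]
      intro b _
      rw [if_neg fun h' => h h'.1]
  simp only [this]
  rw [Finset.sum_comm]
  simp

theorem ucg_mul_ucg (t : V) (F G : Bits V → Matrix Bool Bool ℂ) (hG : IndepOf t G) :
    ucg t F * ucg t G = ucg t (fun x => F x * G x) := by
  ext x y
  rw [ucg_mul_apply]
  have : ∀ b, (∀ v, v ≠ t → Function.update x t b v = y v) ↔ ∀ v, v ≠ t → x v = y v :=
    fun b => forall₂_congr fun v hv => by rw [Function.update_of_ne hv]
  simp only [ucg, this, hG x, Function.update_self]
  by_cases h : ∀ v, v ≠ t → x v = y v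
  · simp only [if_pos h, Matrix.mul_apply]
  · simp [if_neg h]

theorem ucg_one (t : V) : ucg t (fun _ => 1) = 1 := by
  ext x y
  simp only [ucg, Matrix.one_apply]
  by_cases h : x = y
  · subst h; simp
  · rw [if_neg h]
    by_cases h' : ∀ v, v ≠ t → x v = y v
    · rw [if_pos h', if_neg]
      intro ht
      apply h
      ext v
      by_cases hv : v = t
      · rw [hv, ht]
      · rw [h' v hv]
    · rw [if_neg h']

theorem ucg_conjTranspose (t : V) (F : Bits V → Matrix Bool Bool ℂ) (hF : IndepOf t F) :
    (ucg t F)ᴴ = ucg t (fun x => (F x)ᴴ) := by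
  ext x y
  simp only [conjTranspose_apply, ucg]
  by_cases h : ∀ v, v ≠ t → x v = y v
  · rw [if_pos h, if_pos fun v hv => (h v hv).symm]
    have : y = Function.update x t (y t) := (eq_update_iff t x y _).mpr ⟨h, rfl⟩
    conv_lhs => rw [this, hF x]
    simp
  · rw [if_neg h, if_neg fun h' => h fun v hv => (h' v hv).symm, star_zero]

theorem lift_ucg (e : W ↪ V) (t : W) (F : Bits W → Matrix Bool Bool ℂ) :
    lift e (ucg t F) = ucg (e t) (fun x => F (x ∘ e)) := by
  classical
  ext x y
  have key : ((∀ v, v ∉ Set.range e → x v = y v) ∧ ∀ w, w ≠ t → (x ∘ e) w = (y ∘ e) w) ↔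
      ∀ v, v ≠ e t → x v = y v := by
    constructor
    · rintro ⟨h1, h2⟩ v hv
      by_cases hv' : v ∈ Set.range e
      · obtain ⟨w, rfl⟩ := hv'
        exact h2 w fun h => hv (by rw [h])
      · exact h1 v hv'
    · intro h
      exact ⟨fun v hv => h v fun h' => hv ⟨t, h'.symm⟩,
        fun w hw => h _ fun h' => hw (e.injective h')⟩
  simp only [lift, ucg, ← key]
  by_cases h1 : ∀ v, v ∉ Set.range e → x v = y v
  · rw [if_pos h1]
    by_cases h2 : ∀ w, w ≠ t → (x ∘ e) w = (y ∘ e) w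
    · rw [if_pos h2, if_pos ⟨h1, h2⟩]; rfl
    · rw [if_neg h2, if_neg fun h => h2 h.2]
  · rw [if_neg h1, if_neg fun h => h1 h.1]

/-- Conjugation by a basis permutation that commutes with changes of the target permutes the
controls. -/
theorem permOp_mul_ucg_mul_permOp (t : V) (F : Bits V → Matrix Bool Bool ℂ) {f : Bits V → Bits V}
    (hf : Function.Involutive f) (hft : ∀ x, f x t = x t)
    (hfu : ∀ x b, f (Function.update x t b) = Function.update (f x) t b) :
    permOp f * ucg t F * permOp f = ucg t (F ∘ f) := by
  rw [← Matrix.mul_one (ucg t (F ∘ f))]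
  ext x y
  rw [Matrix.mul_assoc, permOp_mul_apply, ucg_mul_apply, ucg_mul_apply]
  simp [← hfu, permOp, hf _, hft, Matrix.one_apply]

/-- A controlled gate whose controls, for zero ancillas, reduce to controls on the register. -/
theorem ucg_mul_zeroExt (t : W) (G : Bits (W ⊕ A) → Matrix Bool Bool ℂ)
    (F : Bits W → Matrix Bool Bool ℂ) (h : ∀ x, G (Sum.elim x fun _ => false) = F x) :
    ucg (Sum.inl t) G * zeroExt W A = zeroExt W A * ucg t F := by
  ext z x
  rw [mul_zeroExt_apply, zeroExt_mul_apply]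
  simp only [ucg, Sum.forall, Sum.elim_inl, Sum.elim_inr, ne_eq, Sum.inl.injEq, reduceCtorEq,
    not_false_eq_true, forall_const, Function.comp_apply]
  by_cases hz : ∀ a, z (Sum.inr a) = false
  · have : z = Sum.elim (z ∘ Sum.inl) fun _ => false := by
      ext v
      cases v <;> simp [hz]
    rw [if_pos hz, ← h, ← this]
    simp [hz]
  · rw [if_neg hz, if_neg fun h => hz h.2]

end OneQubit

/-! ### Multiply controlled gates -/

section Controlled

/-- The gate applying `u` to the qubit `t` if `p` holds. -/
def ctrl {V : Type} [Fintype V] [DecidableEq V] (t : V) (p : Bits V → Bool)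
    (u : Matrix Bool Bool ℂ) : Matrix (Bits V) (Bits V) ℂ :=
  ucg t (fun x => if p x then u else 1)

/-- The Pauli matrix `X`, flipping a qubit. -/
def flipGate : Matrix Bool Bool ℂ := fun a b => if a = b then 0 else 1

/-- A square root of the bit flip. -/
def sqrtFlip : Matrix Bool Bool ℂ :=
  fun a b => if a = b then (1 + Complex.I) / 2 else (1 - Complex.I) / 2

theorem flipGate_mem : flipGate ∈ unitaryGroup Bool ℂ := by
  rw [mem_unitaryGroup_iff]
  ext a b
  cases a <;> cases b <;> simp [Matrix.mul_apply, flipGate, Matrix.star_apply]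

theorem sqrtFlip_mul_self : sqrtFlip * sqrtFlip = flipGate := by
  ext a b
  cases a <;> cases b <;> simp [Matrix.mul_apply, flipGate, sqrtFlip] <;> ring_nf <;>
    simp [Complex.I_sq] <;> norm_num

theorem sqrtFlip_mem : sqrtFlip ∈ unitaryGroup Bool ℂ := by
  rw [mem_unitaryGroup_iff]
  ext a b
  cases a <;> cases b <;>
    simp [Matrix.mul_apply, sqrtFlip, Matrix.star_apply, Complex.conj_ofNat] <;>
    ring_nf <;> simp [Complex.I_sq] <;> norm_num

variable {V : Type} [Fintype V] [DecidableEq V]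

theorem indepOf_ite {t : V} {p : Bits V → Bool} (hp : IndepOf t p) (u v : Matrix Bool Bool ℂ) :
    IndepOf t (fun x => if p x then u else v) := by
  intro x b
  simp only [hp x b]

theorem ucg_two_qubit_mem (G : Bool → Matrix Bool Bool ℂ) (hG : ∀ b, G b ∈ unitaryGroup Bool ℂ) :
    ucg (1 : Fin 2) (fun x => G (x 0)) ∈ unitaryGroup (Bits (Fin 2)) ℂ := by
  have hind : IndepOf (1 : Fin 2) (fun x : Bits (Fin 2) => G (x 0)) := by
    intro x b
    simp
  rw [mem_unitaryGroup_iff', star_eq_conjTranspose, ucg_conjTranspose _ _ hind,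
    ucg_mul_ucg _ _ _ hind, ← ucg_one (1 : Fin 2)]
  congr 1
  ext1 x
  exact mem_unitaryGroup_iff'.mp (hG _)

theorem implementable_two_qubit {c t : V} (hct : c ≠ t) (G : Bool → Matrix Bool Bool ℂ)
    (hG : ∀ b, G b ∈ unitaryGroup Bool ℂ) : Implementable 1 (ucg t (fun x => G (x c))) := by
  have e : Function.Injective ![c, t] := by
    intro a b
    fin_cases a <;> fin_cases b <;> simp [hct, hct.symm]
  have := Implementable.gate (W := V) ⟨2, le_rfl, ⟨![c, t], e⟩, _, ucg_two_qubit_mem G hG⟩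
  rw [Gate.toMatrix_eq_lift] at this
  rw [lift_ucg] at this
  exact this

theorem implementable_one_qubit (t : V) {u : Matrix Bool Bool ℂ} (hu : u ∈ unitaryGroup Bool ℂ) :
    Implementable 1 (ucg t (fun _ => u)) := by
  have hmem : ucg (0 : Fin 1) (fun _ => u) ∈ unitaryGroup (Bits (Fin 1)) ℂ := by
    have hind : IndepOf (0 : Fin 1) (fun _ : Bits (Fin 1) => u) := fun _ _ => rfl
    rw [mem_unitaryGroup_iff', star_eq_conjTranspose, ucg_conjTranspose _ _ hind,
      ucg_mul_ucg _ _ _ hind, ← ucg_one (0 : Fin 1)]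
    congr 1
    ext1 x
    exact mem_unitaryGroup_iff'.mp hu
  have := Implementable.gate (W := V)
    ⟨1, by norm_num, ⟨fun _ => t, fun a b _ => Subsingleton.elim a b⟩, _, hmem⟩
  rw [Gate.toMatrix_eq_lift] at this
  rw [lift_ucg] at this
  exact this

theorem implementable_phase {c : ℂ} (hc : ‖c‖ = 1) :
    Implementable 1 (c • (1 : Matrix (Bits V) (Bits V) ℂ)) := by
  have hmem : c • (1 : Matrix (Bits (Fin 0)) (Bits (Fin 0)) ℂ) ∈ unitaryGroup (Bits (Fin 0)) ℂ := by
    rw [mem_unitaryGroup_iff', star_smul, star_one, smul_mul_smul_comm, one_mul, Complex.star_def,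
      mul_comm, Complex.mul_conj, Complex.normSq_eq_norm_sq, hc]
    simp
  have e : Fin 0 ↪ V := ⟨Fin.elim0, fun a => a.elim0⟩
  have := Implementable.gate (W := V) ⟨0, by norm_num, e, _, hmem⟩
  rw [Gate.toMatrix_eq_lift] at this
  have h1 : lift e (c • (1 : Matrix (Bits (Fin 0)) (Bits (Fin 0)) ℂ))
      = c • lift e (1 : Matrix (Bits (Fin 0)) (Bits (Fin 0)) ℂ) := by
    ext x y
    simp only [lift, Matrix.smul_apply]
    split_ifs <;> simp
  rwa [h1, lift_one] at this

theorem ctrl_flip_eq_permOp {t : V} {p : Bits V → Bool} :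
    ctrl t p flipGate = permOp (fun x => Function.update x t (x t ^^ p x)) := by
  rw [← Matrix.mul_one (ctrl t p flipGate)]
  ext x y
  rw [ctrl, ucg_mul_apply]
  cases h : p x <;> cases h' : x t <;> simp [flipGate, permOp, Matrix.one_apply, h, h']

theorem involutive_update_xor {t : V} {p : Bits V → Bool} (hp : IndepOf t p) :
    Function.Involutive (fun x : Bits V => Function.update x t (x t ^^ p x)) := by
  intro x
  simp [hp x]

/-- The Toffoli gate, with literals as controls, from two-qubit gates: two controlled square roots
of the bit flip cancel or add up, according to the parity of the controls. -/
theorem implementable_toffoli {a b t : V} (ha : a ≠ t) (hb : b ≠ t) (α β : Bool) :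
    Implementable 5 (ctrl t (fun x => x a == α && x b == β) flipGate) := by
  have one_mem : (1 : Matrix Bool Bool ℂ) ∈ unitaryGroup Bool ℂ := one_mem _
  by_cases hab : a = b
  · subst hab
    refine (implementable_two_qubit ha (fun c => if c == α && c == β then flipGate else 1) ?_).mono
      (by norm_num)
    intro c
    split_ifs
    exacts [flipGate_mem, one_mem]
  have hs : sqrtFlipᴴ ∈ unitaryGroup Bool ℂ := Unitary.star_mem sqrtFlip_mem
  have i1 : Implementable 1 (ctrl t (fun x => x b == β) sqrtFlip) :=
    implementable_two_qubit hb (fun c => if c == β then sqrtFlip else 1) fun c => by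
      split_ifs
      exacts [sqrtFlip_mem, one_mem]
  have i2 : Implementable 1 (ctrl t (fun x => x b == β) sqrtFlipᴴ) :=
    implementable_two_qubit hb (fun c => if c == β then sqrtFlipᴴ else 1) fun c => by
      split_ifs
      exacts [hs, one_mem]
  have i3 : Implementable 1 (ctrl t (fun x => x a == α) sqrtFlip) :=
    implementable_two_qubit ha (fun c => if c == α then sqrtFlip else 1) fun c => by
      split_ifs
      exacts [sqrtFlip_mem, one_mem]
  have i4 : Implementable 1 (ctrl b (fun x => x a == α) flipGate) :=
    implementable_two_qubit hab (fun c => if c == α then flipGate else 1) fun c => by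
      split_ifs
      exacts [flipGate_mem, one_mem]
  have key : ctrl t (fun x => x a == α && x b == β) flipGate
      = ctrl t (fun x => x b == β) sqrtFlip * (ctrl b (fun x => x a == α) flipGate *
        ctrl t (fun x => x b == β) sqrtFlipᴴ * ctrl b (fun x => x a == α) flipGate) *
        ctrl t (fun x => x a == α) sqrtFlip := by
    have ind : IndepOf b (fun x : Bits V => x a == α) := by
      intro x c
      simp [Function.update_of_ne hab]
    rw [ctrl_flip_eq_permOp (t := b), ctrl, ctrl, ctrl, ctrl,
      permOp_mul_ucg_mul_permOp _ _ (involutive_update_xor ind), ucg_mul_ucg, ucg_mul_ucg]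
    · congr 1
      ext1 x
      have h1 : sqrtFlip * sqrtFlipᴴ = 1 := mem_unitaryGroup_iff.mp sqrtFlip_mem
      have h2 : sqrtFlipᴴ * sqrtFlip = 1 := mem_unitaryGroup_iff'.mp sqrtFlip_mem
      cases ha : x a <;> cases hb : x b <;> cases α <;> cases β <;>
        simp [ha, hb, sqrtFlip_mul_self, h1, h2]
    · intro x c
      simp [Function.update_of_ne ha]
    · intro x c
      simp [Function.update_of_ne ha, Function.update_of_ne hb]
    · intro x
      simp [Function.update_of_ne hb.symm]
    · intro x c
      simp only [Function.update_of_ne ha, Function.update_of_ne hb]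
      rw [Function.update_comm hb]
  rw [key]
  exact ((i1.mul ((i4.mul i2).mul i4)).mul i3).mono (by norm_num)

theorem implementable_cnot {c t : V} (hct : c ≠ t) :
    Implementable 1 (ctrl t (fun x => x c) flipGate) :=
  implementable_two_qubit hct (fun b => if b then flipGate else 1) fun b => by
    split_ifs
    exacts [flipGate_mem, one_mem _]

/-- All literals of the list, given by a qubit and its value, hold. -/
def literalsHold (l : List (V × Bool)) (x : Bits V) : Bool :=
  l.all fun a => x a.1 == a.2

theorem indepOf_literalsHold {l : List (V × Bool)} {t : V} (ht : ∀ a ∈ l, a.1 ≠ t) :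
    IndepOf t (literalsHold l) := by
  intro x b
  rw [Bool.eq_iff_iff]
  simp only [literalsHold, List.all_eq_true]
  exact forall₂_congr fun a ha => by rw [Function.update_of_ne (ht a ha)]

/-- Multiply controlled one-qubit gates: the conjunction of two controls is computed into a fresh
ancilla, which replaces them, and is uncomputed afterwards. -/
theorem implementable_ctrl_literals (k : ℕ) : ∀ {V : Type} [Fintype V] [DecidableEq V]
    (l : List (V × Bool)), l.length = k → ∀ (t : V), (∀ a ∈ l, a.1 ≠ t) →
    ∀ u ∈ unitaryGroup Bool ℂ, Implementable (11 * k + 1) (ctrl t (literalsHold l) u) := by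
  induction k with
  | zero =>
    intro V _ _ l hl t _ u hu
    obtain rfl := List.length_eq_zero_iff.mp hl
    simpa [ctrl, literalsHold] using implementable_one_qubit t hu
  | succ k ih =>
    intro V _ _ l hl t ht u hu
    match l, hl, ht with
    | [a], _, ht =>
      refine (implementable_two_qubit (ht a (by simp))
        (fun c => if c == a.2 then u else 1) ?_).of_le_of_eq (by omega) ?_
      · intro c
        split_ifs
        exacts [hu, one_mem _]
      · simp [ctrl, literalsHold]
    | a :: b :: l, hl, ht =>
      let emb : V × Bool → (V ⊕ Fin 1) × Bool := fun c => (Sum.inl c.1, c.2)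
      let anc : V ⊕ Fin 1 := Sum.inr 0
      let p : Bits (V ⊕ Fin 1) → Bool := fun x => x (Sum.inl a.1) == a.2 && x (Sum.inl b.1) == b.2
      have hp : IndepOf anc p := by
        intro x c
        simp [p, anc]
      have tof : Implementable 5 (ctrl anc p flipGate) :=
        implementable_toffoli (by simp [anc]) (by simp [anc]) _ _
      have hlen : ((anc, true) :: l.map emb).length = k := by
        simp at hl ⊢
        omega
      have main := ih ((anc, true) :: l.map emb) hlen (Sum.inl t) (by
        simp only [List.mem_cons, List.mem_map]
        rintro c (rfl | ⟨d, hd, rfl⟩)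
        · simp [anc]
        · simpa [emb] using ht d (by simp [hd])) u hu
      refine ((tof.mul main).mul tof).of_ancilla (M := ctrl t (literalsHold (a :: b :: l)) u) ?_
        |>.mono (by simp; omega)
      rw [ctrl_flip_eq_permOp, ctrl,
        permOp_mul_ucg_mul_permOp _ _ (involutive_update_xor hp) (by simp [anc])]
      · refine ucg_mul_zeroExt _ _ _ fun x => ?_
        simp [literalsHold, anc, p, emb, Function.comp_def, and_assoc]
      · intro x c
        have h1 : p (Function.update x (Sum.inl t) c) = p x := by
          have ha := ht a (by simp)
          have hb := ht b (by simp)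
          simp [p, ha, hb]
        rw [h1, Function.update_comm (by simp [anc])]
        simp [anc]

theorem ctrl_mul_ctrl {t : V} {p q : Bits V → Bool} (hq : IndepOf t q) (u v : Matrix Bool Bool ℂ) :
    ctrl t p u * ctrl t q v
      = ucg t (fun x => (if p x then u else 1) * (if q x then v else 1)) :=
  ucg_mul_ucg _ _ _ (indepOf_ite hq _ _)

theorem ofBits_succ_last {w : ℕ} (f : Fin (w + 1) → Bool) :
    Nat.ofBits f = Nat.ofBits (f ∘ Fin.castSucc) + 2 ^ w * (f (Fin.last w)).toNat := by
  induction w with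
  | zero => simp [Nat.ofBits_succ]
  | succ w ih =>
    rw [Nat.ofBits_succ, ih, Nat.ofBits_succ (f ∘ Fin.castSucc)]
    simp only [Function.comp_def, Fin.succ_last, Fin.castSucc_zero, Fin.succ_castSucc, pow_succ]
    ring

/-- Gates controlled by the comparison of a binary number with a constant: the highest bit either
decides the comparison or reduces it to the remaining bits. -/
theorem implementable_ctrl_threshold {t : V} {u : Matrix Bool Bool ℂ} (hu : u ∈ unitaryGroup Bool ℂ)
    (w : ℕ) : ∀ (val : Fin w → V) (N : ℕ) (l : List (V × Bool)), (∀ k, val k ≠ t) →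
    (∀ a ∈ l, a.1 ≠ t) → Implementable ((w + 1) * (11 * (l.length + w) + 1))
      (ctrl t (fun x => literalsHold l x && decide (N ≤ Nat.ofBits fun k => x (val k))) u) := by
  induction w with
  | zero =>
    intro val N l _ hl
    by_cases hN : N = 0
    · refine (implementable_ctrl_literals _ l rfl t hl u hu).of_le_of_eq (by simp) ?_
      simp [hN]
    · refine (Implementable.one (W := V)).of_le_of_eq (Nat.zero_le _) ?_
      simp [hN, ctrl, ucg_one]
  | succ w ih =>
    intro val N l hval hl
    have hr : ∀ x : Bits V, (Nat.ofBits fun k => x (val (Fin.castSucc k))) < 2 ^ w :=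
      fun x => Nat.ofBits_lt_two_pow _
    have hsplit : ∀ x : Bits V, (Nat.ofBits fun k => x (val k))
        = (Nat.ofBits fun k => x (val (Fin.castSucc k))) + 2 ^ w * (x (val (Fin.last w))).toNat :=
      fun x => ofBits_succ_last _
    have hl' : ∀ c, ∀ a ∈ (val (Fin.last w), c) :: l, a.1 ≠ t := by
      intro c a ha
      rcases List.mem_cons.mp ha with rfl | ha
      exacts [hval _, hl a ha]
    have hcost : (11 * (l.length + 1) + 1) + (w + 1) * (11 * (l.length + 1 + w) + 1)
        ≤ (w + 1 + 1) * (11 * (l.length + (w + 1)) + 1) := by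
      nlinarith [Nat.zero_le w]
    -- If `N ≤ 2 ^ w`, a set highest bit is sufficient; otherwise it is necessary.
    by_cases hN : N ≤ 2 ^ w
    · have i1 := implementable_ctrl_literals _ ((val (Fin.last w), true) :: l) rfl t (hl' _) u hu
      have i2 := ih (val ∘ Fin.castSucc) N ((val (Fin.last w), false) :: l)
        (fun k => hval _) (hl' _)
      refine (i1.mul i2).of_le_of_eq (by simpa using hcost) ?_
      rw [ctrl_mul_ctrl, ctrl]
      · congr 1
        ext1 x
        have key : ∀ (c q : Bool) (r : ℕ), (if (c == true && q) = true then u else 1) *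
            (if (c == false && q && decide (N ≤ r)) = true then u else 1)
              = if (q && decide (N ≤ r + 2 ^ w * c.toNat)) = true then u else 1 := by
          intro c q r
          have h1 : N ≤ r + 2 ^ w := by omega
          cases c <;> cases q <;> simp [h1]
        rw [hsplit x]
        exact key _ _ _
      · intro x c
        simp only [indepOf_literalsHold (hl' _) x c]
        simp [hval]
    · have i2 := ih (val ∘ Fin.castSucc) (N - 2 ^ w) ((val (Fin.last w), true) :: l)
        (fun k => hval _) (hl' _)
      refine i2.of_le_of_eq (by simpa using (Nat.le_add_left _ _).trans hcost) ?_
      refine congrArg (fun p => ctrl t p u) (funext fun x => ?_)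
      have key : ∀ (c q : Bool) (r : ℕ), r < 2 ^ w → (c == true && q && decide (N - 2 ^ w ≤ r))
          = (q && decide (N ≤ r + 2 ^ w * c.toNat)) := by
        intro c q r hr
        have h1 : ¬ N ≤ r := by omega
        cases c <;> cases q <;> simp [h1]
      rw [hsplit x, ← key _ _ _ (hr x)]
      rfl

/-- Adding, modulo two, a bit to each qubit of a set `S`; the bits do not depend on `S`. -/
theorem implementable_xor {s : ℕ} (S : Finset V) : ∀ (g : V → Bits V → Bool),
    (∀ v, v ∉ S → g v = fun _ => false) → (∀ v ∈ S, ∀ t ∈ S, IndepOf t (g v)) →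
    (∀ v ∈ S, Implementable s (ctrl v (g v) flipGate)) →
    Implementable (S.card * s) (permOp fun x v => x v ^^ g v x) := by
  induction S using Finset.induction_on with
  | empty =>
    intro g hg _ _
    have : (fun (x : Bits V) v => x v ^^ g v x) = id := by
      ext x v
      simp [hg v]
    rw [this, permOp_id]
    simpa using Implementable.one
  | insert a S ha ih =>
    intro g hg hind himp
    let g' : V → Bits V → Bool := fun v => if v = a then fun _ => false else g v
    have i1 := ih g' (by
      intro v hv
      by_cases h : v = a
      · simp [g', h]
      · simp only [g', if_neg h]
        exact hg v (by simp [h, hv])) (by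
      intro v hv t ht
      have h : v ≠ a := fun h => ha (h ▸ hv)
      simp only [g', if_neg h]
      exact hind v (by simp [hv]) t (by simp [ht])) (by
      intro v hv
      have h : v ≠ a := fun h => ha (h ▸ hv)
      simp only [g', if_neg h]
      exact himp v (by simp [hv]))
    have i2 := himp a (by simp)
    rw [ctrl_flip_eq_permOp] at i2
    refine (i2.mul i1).of_le_of_eq
      (by rw [Finset.card_insert_of_notMem ha]; ring_nf; rfl) ?_
    rw [permOp_mul_permOp]
    congr 1
    ext x v
    by_cases h : v = a
    · subst h
      simp [g']
    · simp only [g', Function.comp_apply, if_neg h, Function.update_of_ne h]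
      by_cases hv : v ∈ S
      · rw [hind v (by simp [hv]) a (by simp)]
      · rw [hg v (by simp [h, hv])]

/-- `implementable_xor` for the targets `e 0, …, e (k - 1)`. -/
theorem implementable_xor_embedding {s k : ℕ} (e : Fin k ↪ V) {g : V → Bits V → Bool}
    (p : Fin k → Bits V → Bool) (hg : ∀ i, g (e i) = p i)
    (h0 : ∀ v, v ∉ Set.range e → g v = fun _ => false) (hind : ∀ i j, IndepOf (e j) (p i))
    (himp : ∀ i, Implementable s (ctrl (e i) (p i) flipGate)) :
    Implementable (k * s) (permOp fun x v => x v ^^ g v x) := by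
  refine (implementable_xor (s := s) (Finset.univ.map e) g ?_ ?_ ?_).mono (by simp)
  · intro v hv
    exact h0 v (by simpa using hv)
  · intro v hv t ht
    obtain ⟨i, -, rfl⟩ := Finset.mem_map.mp hv
    obtain ⟨j, -, rfl⟩ := Finset.mem_map.mp ht
    rw [hg]
    exact hind i j
  · intro v hv
    obtain ⟨i, -, rfl⟩ := Finset.mem_map.mp hv
    rw [hg]
    exact himp i

end Controlled

/-! ### The registers and the gates of the simulation -/

/-- Ancillas of the simulation: a column index, a flag telling whether a column index has been
written, a coin controlling the exchange of row and column index, and the workspace of the program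
for the rows, consisting of a copy of the row index and of the program's own ancillas. -/
inductive Anc (n m : ℕ)
  | tgt (k : Fin n)
  | flag
  | coin
  | work (v : Fin n ⊕ Fin m)
  deriving DecidableEq, Fintype

/-- The whole register: the row index, on which the Hamiltonian acts, and the ancillas. -/
abbrev Reg (n m : ℕ) : Type := Fin n ⊕ Anc n m

section Registers

variable {n m : ℕ}

theorem card_anc : Fintype.card (Anc n m) = 2 * n + m + 2 := by
  let e : Anc n m ≃ Fin n ⊕ Unit ⊕ Unit ⊕ (Fin n ⊕ Fin m) :=
    { toFun := fun
        | .tgt k => .inl k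
        | .flag => .inr (.inl ())
        | .coin => .inr (.inr (.inl ()))
        | .work v => .inr (.inr (.inr v))
      invFun := fun
        | .inl k => .tgt k
        | .inr (.inl ()) => .flag
        | .inr (.inr (.inl ())) => .coin
        | .inr (.inr (.inr v)) => .work v
      left_inv := by rintro (k | _) <;> rfl
      right_inv := by rintro (k | _ | _ | _) <;> rfl }
  rw [Fintype.card_congr e]
  simp
  ring

/-- The basis state of the register with row index `i`, column index `j`, flag `f`, coin `c` and
workspace `z`. -/
def mkReg (i j : Bits (Fin n)) (f c : Bool) (z : Bits (Fin n ⊕ Fin m)) : Bits (Reg n m)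
  | .inl k => i k
  | .inr (.tgt k) => j k
  | .inr .flag => f
  | .inr .coin => c
  | .inr (.work v) => z v

/-- Basis states of the register are tuples of their five components. -/
def regEquiv : (Bits (Fin n) × Bits (Fin n) × Bool × Bool × Bits (Fin n ⊕ Fin m)) ≃
    Bits (Reg n m) where
  toFun p := mkReg p.1 p.2.1 p.2.2.1 p.2.2.2.1 p.2.2.2.2
  invFun x := (fun k => x (.inl k), fun k => x (.inr (.tgt k)), x (.inr .flag), x (.inr .coin),
    fun v => x (.inr (.work v)))
  left_inv _ := rfl
  right_inv x := by ext (k | (k | _)) <;> rfl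

theorem exists_eq_mkReg (x : Bits (Reg n m)) : ∃ i j f c z, x = mkReg i j f c z :=
  ⟨_, _, _, _, _, (regEquiv.apply_symm_apply x).symm⟩

theorem sum_reg {β : Type*} [AddCommMonoid β] (F : Bits (Reg n m) → β) :
    ∑ x, F x = ∑ i, ∑ j, ∑ f, ∑ c, ∑ z, F (mkReg i j f c z) := by
  rw [← regEquiv.sum_comp]
  simp only [Fintype.sum_prod_type]
  rfl

theorem mkReg_inj {i i' j j' : Bits (Fin n)} {f f' c c' : Bool} {z z' : Bits (Fin n ⊕ Fin m)} :
    mkReg i j f c z = mkReg i' j' f' c' z' ↔ i = i' ∧ j = j' ∧ f = f' ∧ c = c' ∧ z = z' := by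
  refine (regEquiv.injective.eq_iff (a := (i, j, f, c, z)) (b := (i', j', f', c', z'))).trans ?_
  simp only [Prod.mk.injEq]

/-- The embedding of the workspace into the register. -/
def workEmb : Fin n ⊕ Fin m ↪ Reg n m :=
  ⟨fun v => .inr (.work v), fun a b h => by simpa using h⟩

@[simp]
theorem workEmb_apply (v : Fin n ⊕ Fin m) : workEmb v = (.inr (.work v) : Reg n m) := rfl

theorem extend_workEmb (i j : Bits (Fin n)) (f c : Bool) (z b : Bits (Fin n ⊕ Fin m)) :
    Function.extend workEmb b (mkReg i j f c z) = mkReg i j f c b := by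
  have hn : ∀ v : Reg n m, (∀ u, v ≠ .inr (.work u)) →
      v ∉ Set.range (workEmb (n := n) (m := m)) := by
    rintro v hv ⟨u, rfl⟩
    exact hv u rfl
  ext (k | (k | _ | _ | v))
  · rw [extend_of_notMem_range _ _ _ (hn _ (by simp))]; rfl
  · rw [extend_of_notMem_range _ _ _ (hn _ (by simp))]; rfl
  · rw [extend_of_notMem_range _ _ _ (hn _ (by simp))]; rfl
  · rw [extend_of_notMem_range _ _ _ (hn _ (by simp))]; rfl
  · exact workEmb.injective.extend_apply _ _ v

theorem lift_workEmb_mul_apply {κ : Type*}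
    (Q : Matrix (Bits (Fin n ⊕ Fin m)) (Bits (Fin n ⊕ Fin m)) ℂ)
    (N : Matrix (Bits (Reg n m)) κ ℂ) (i j : Bits (Fin n)) (f c : Bool)
    (z : Bits (Fin n ⊕ Fin m)) (k : κ) :
    (lift workEmb Q * N) (mkReg i j f c z) k = ∑ b, Q z b * N (mkReg i j f c b) k := by
  rw [lift_mul_apply]
  simp only [extend_workEmb]
  rfl

/-- The qubits of the column index. -/
def tgtEmb (n m : ℕ) : Fin n ↪ Reg n m :=
  ⟨fun k => .inr (.tgt k), fun a b h => by simpa using h⟩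

@[simp]
theorem tgtEmb_apply (k : Fin n) : tgtEmb n m k = .inr (.tgt k) := rfl

theorem update_flag (i j : Bits (Fin n)) (f c b : Bool) (z : Bits (Fin n ⊕ Fin m)) :
    Function.update (mkReg i j f c z) (.inr .flag) b = mkReg i j b c z := by
  ext (k | (k | _ | _ | v)) <;> simp [mkReg]

theorem update_coin (i j : Bits (Fin n)) (f c b : Bool) (z : Bits (Fin n ⊕ Fin m)) :
    Function.update (mkReg i j f c z) (.inr .coin) b = mkReg i j f b z := by
  ext (k | (k | _ | _ | v)) <;> simp [mkReg]

theorem elim_zero_eq_mkReg (i : Bits (Fin n)) :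
    (Sum.elim i fun _ => false : Bits (Reg n m))
      = mkReg i (fun _ => false) false false fun _ => false := by
  ext (k | (k | _ | _ | v)) <;> rfl

/-- Qubitwise addition modulo two. -/
def bxor {W : Type} (a b : Bits W) : Bits W := fun w => a w ^^ b w

theorem bxor_bxor {W : Type} (a b : Bits W) : bxor (bxor a b) b = a := by
  ext w
  simp [bxor]

theorem bxor_eq_zero {W : Type} {a b : Bits W} : bxor a b = (fun _ => false) ↔ a = b := by
  simp [bxor, funext_iff]

/-- Adds the row index to the first part of the workspace. -/
def copyMask : Reg n m → Bits (Reg n m) → Bool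
  | .inr (.work (.inl k)), x => x (.inl k)
  | _, _ => false

/-- Copies the row index to the workspace. -/
def copyOp (n m : ℕ) : Matrix (Bits (Reg n m)) (Bits (Reg n m)) ℂ :=
  permOp fun x v => x v ^^ copyMask v x

theorem copy_mkReg (i j : Bits (Fin n)) (f c : Bool) (z : Bits (Fin n ⊕ Fin m)) :
    (fun v => mkReg i j f c z v ^^ copyMask v (mkReg i j f c z))
      = mkReg i j f c (bxor z (Sum.elim i fun _ => false)) := by
  ext (k | (k | _ | _ | (v | v))) <;> simp [mkReg, copyMask, bxor]

theorem implementable_copyOp : Implementable n (copyOp n m) := by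
  refine (implementable_xor_embedding (s := 1) (g := copyMask)
    ⟨fun k => (.inr (.work (.inl k)) : Reg n m), fun a b h => by simpa using h⟩
    (fun k x => x (.inl k)) (fun _ => rfl) ?_ ?_ ?_).mono (by simp)
  · rintro (k | (k | _ | _ | (v | v))) hv <;> try rfl
    exact absurd ⟨v, rfl⟩ hv
  · intro k k' x b
    simp
  · intro k
    exact implementable_cnot (by simp)

/-- Adds the row index to the column index. -/
def rowToColMask : Reg n m → Bits (Reg n m) → Bool
  | .inr (.tgt k), x => x (.inl k)
  | _, _ => false

/-- Adds the column index to the row index if the coin is set. -/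
def colToRowMask : Reg n m → Bits (Reg n m) → Bool
  | .inl k, x => x (.inr .coin) == true && x (.inr (.tgt k)) == true
  | _, _ => false

/-- Exchanges row and column index if the coin is set. -/
def swapOp (n m : ℕ) : Matrix (Bits (Reg n m)) (Bits (Reg n m)) ℂ :=
  permOp (fun x v => x v ^^ rowToColMask v x) * permOp (fun x v => x v ^^ colToRowMask v x) *
    permOp (fun x v => x v ^^ rowToColMask v x)

theorem swapOp_mul_apply {κ : Type*} (N : Matrix (Bits (Reg n m)) κ ℂ) (i j : Bits (Fin n))
    (f c : Bool) (z : Bits (Fin n ⊕ Fin m)) (k : κ) :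
    (swapOp n m * N) (mkReg i j f c z) k
      = if c then N (mkReg j i f c z) k else N (mkReg i j f c z) k := by
  have h1 : ∀ i j : Bits (Fin n), (fun v => mkReg i j f c z v ^^ rowToColMask v (mkReg i j f c z))
      = mkReg i (bxor j i) f c z := by
    intro i j
    ext (k | (k | _ | _ | v)) <;> simp [mkReg, rowToColMask, bxor]
  have h2 : ∀ i j : Bits (Fin n), (fun v => mkReg i j f c z v ^^ colToRowMask v (mkReg i j f c z))
      = mkReg (if c then bxor i j else i) j f c z := by
    intro i j
    ext (k | (k | _ | _ | v)) <;> cases c <;> simp [mkReg, colToRowMask, bxor]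
  rw [swapOp, Matrix.mul_assoc, Matrix.mul_assoc, permOp_mul_apply, permOp_mul_apply,
    permOp_mul_apply, h1, h2, h1]
  cases c
  · simp [bxor_bxor]
  · have e1 : bxor i (bxor j i) = j := by
      ext k
      simp only [bxor]
      cases i k <;> cases j k <;> rfl
    have e2 : bxor (bxor j i) j = i := by
      ext k
      simp only [bxor]
      cases i k <;> cases j k <;> rfl
    simp [e1, e2]

theorem implementable_swapOp : Implementable (7 * n) (swapOp n m) := by
  have i1 : Implementable (n * 1)
      (permOp fun (x : Bits (Reg n m)) v => x v ^^ rowToColMask v x) := by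
    refine implementable_xor_embedding (tgtEmb n m) (fun k x => x (.inl k)) (fun _ => rfl) ?_ ?_ ?_
    · rintro (k | (k | _ | _ | v)) hv <;> try rfl
      exact absurd ⟨k, rfl⟩ hv
    · intro k k' x b
      simp
    · intro k
      exact implementable_cnot (by simp)
  have i2 : Implementable (n * 5)
      (permOp fun (x : Bits (Reg n m)) v => x v ^^ colToRowMask v x) := by
    refine implementable_xor_embedding
      ⟨fun k => (.inl k : Reg n m), fun a b h => by simpa using h⟩
      (fun k x => x (.inr .coin) == true && x (.inr (.tgt k)) == true) (fun _ => rfl) ?_ ?_ ?_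
    · rintro (k | (k | _ | _ | v)) hv <;> try rfl
      exact absurd ⟨k, rfl⟩ hv
    · intro k k' x b
      simp
    · intro k
      exact implementable_toffoli (by simp) (by simp) true true
  exact ((i1.mul i2).mul i1).mono (by omega)

/-- The rotation by the angle with sine `s`. -/
def rot (s : ℝ) : Matrix Bool Bool ℂ
  | false, false => (√(1 - s ^ 2) : ℝ)
  | false, true => (-s : ℝ)
  | true, false => (s : ℝ)
  | true, true => (√(1 - s ^ 2) : ℝ)

theorem rot_zero : rot 0 = 1 := by
  ext a b
  cases a <;> cases b <;> simp [rot]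

theorem rot_mem {s : ℝ} (hs : s ^ 2 ≤ 1) : rot s ∈ unitaryGroup Bool ℂ := by
  have h : √(1 - s ^ 2) * √(1 - s ^ 2) = 1 - s ^ 2 := Real.mul_self_sqrt (by linarith)
  rw [mem_unitaryGroup_iff]
  ext a b
  cases a <;> cases b <;>
    simp only [Matrix.mul_apply, Matrix.star_apply, Fintype.sum_bool, rot, Complex.star_def,
      Complex.conj_ofReal, ← Complex.ofReal_mul, ← Complex.ofReal_add, Matrix.one_apply, h] <;>
    norm_num <;> ring_nf

/-- Applying one of the gates `u 0 = 1, …, u K`, chosen by the binary number `x` as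
`min K (L x / 2 ^ b)`: the gates `u (k + 1) (u k)ᴴ`, controlled by thresholds, telescope. -/
theorem implementable_level {V : Type} [Fintype V] [DecidableEq V] {t : V}
    {u : ℕ → Matrix Bool Bool ℂ} (hu : ∀ k, u k ∈ unitaryGroup Bool ℂ) (hu0 : u 0 = 1) {L : ℕ}
    (hL : 0 < L) (b w : ℕ) (val : Fin w → V) (l : List (V × Bool)) (hval : ∀ k, val k ≠ t)
    (hl : ∀ a ∈ l, a.1 ≠ t) (K : ℕ) :
    Implementable (K * ((w + 1) * (11 * (l.length + w) + 1)))
      (ucg t fun x => if literalsHold l x then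
        u (min K (L * (Nat.ofBits fun k => x (val k)) / 2 ^ b)) else 1) := by
  induction K with
  | zero =>
    refine (Implementable.one (W := V)).of_le_of_eq (Nat.zero_le _) ?_
    simp [hu0, ucg_one]
  | succ K ih =>
    have hmem : u (K + 1) * (u K)ᴴ ∈ unitaryGroup Bool ℂ := mul_mem (hu _) (Unitary.star_mem (hu _))
    have i1 := implementable_ctrl_threshold hmem w val ((K + 1) * 2 ^ b ⌈/⌉ L) l hval hl
    refine (i1.mul ih).of_le_of_eq (by ring_nf; rfl) ?_
    rw [ctrl, ucg_mul_ucg]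
    · refine congrArg (ucg t) (funext fun x => ?_)
      have hiff : ∀ N : ℕ, (K + 1) * 2 ^ b ⌈/⌉ L ≤ N ↔ K + 1 ≤ L * N / 2 ^ b := by
        intro N
        rw [ceilDiv_le_iff_le_mul hL, Nat.le_div_iff_mul_le (by positivity)]
      have key : ∀ (q : Bool) (N : ℕ), (if (q && decide ((K + 1) * 2 ^ b ⌈/⌉ L ≤ N)) = true then
            u (K + 1) * (u K)ᴴ else 1) * (if q = true then u (min K (L * N / 2 ^ b)) else 1)
          = if q = true then u (min (K + 1) (L * N / 2 ^ b)) else 1 := by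
        intro q N
        cases q
        · simp
        · by_cases h : K + 1 ≤ L * N / 2 ^ b
          · have h' : (u K)ᴴ * u K = 1 := mem_unitaryGroup_iff'.mp (hu K)
            simp [hiff, h, Nat.le_of_succ_le h, Matrix.mul_assoc, h']
          · simp [hiff, h, min_eq_right (Nat.le_of_lt_succ (Nat.lt_of_not_le h)),
              min_eq_right (Nat.le_of_lt (Nat.lt_of_not_le h))]
      exact key _ _
    · intro x c
      simp only [indepOf_literalsHold hl x c]
      simp [hval]

end Registers

/-! ### Preparing a row from a list of its entries -/

section Prep

variable {n m D w : ℕ}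

/-- The sine of the rotation by which an entry with value `k / L` is written. -/
def levelSine (η : ℝ) (L k : ℕ) : ℝ := η * √((k : ℝ) / L)

/-- The sine of the rotation by which the slot `s` of the list `y` is written: `η √v`, where `v` is
the value in the slot, truncated to `1` and rounded down to a multiple of `1 / L`. -/
def slotSine (η : ℝ) (L b : ℕ) (y : Bits (ListBits D n w)) (s : Fin D) : ℝ :=
  levelSine η L (min L (L * Nat.ofBits (fun k => y (s, .inr (.inr k))) / 2 ^ b))

variable (out : ListBits D n w → Fin n ⊕ Fin m) (η : ℝ) (L b : ℕ)

/-- The list found in the output qubits of the workspace. -/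
def readout (z : Bits (Fin n ⊕ Fin m)) : Bits (ListBits D n w) := fun o => z (out o)

/-- Adds the index in the slot `s` to the column index if the flag is set. -/
def slotMask (s : Fin D) : Reg n m → Bits (Reg n m) → Bool
  | .inr (.tgt k), x => x (.inr .flag) == true && x (.inr (.work (out (s, .inr (.inl k))))) == true
  | _, _ => false

/-- The slot `s` is in use and the column index is zero. -/
def slotLiterals (s : Fin D) : List (Reg n m × Bool) :=
  (.inr (.work (out (s, .inl ()))), true) ::
    (List.finRange n).map fun k => (.inr (.tgt k), false)

/-- The rotation, for the slot `s` in use, in the plane spanned by `|0…0⟩` with flag unset and by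
the index in the slot with flag set. -/
def slotOp (s : Fin D) : Matrix (Bits (Reg n m)) (Bits (Reg n m)) ℂ :=
  permOp (fun x v => x v ^^ slotMask out s v x) *
    ucg (.inr .flag) (fun x => if literalsHold (slotLiterals out s) x then
      rot (levelSine η L (min L
        (L * Nat.ofBits (fun k => x (.inr (.work (out (s, .inr (.inr k)))))) / 2 ^ b))) else 1) *
    permOp (fun x v => x v ^^ slotMask out s v x)

/-- The rotations for the first `k` slots. -/
def prepOp : ℕ → Matrix (Bits (Reg n m)) (Bits (Reg n m)) ℂ
  | 0 => 1
  | k + 1 => if h : k < D then slotOp out η L b ⟨k, h⟩ * prepOp k else prepOp k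

variable {η L b}

theorem levelSine_sq_le {k : ℕ} (hk : k ≤ L) :
    levelSine η L k ^ 2 ≤ η ^ 2 := by
  have h1 : (k : ℝ) / L ≤ 1 := div_le_one_of_le₀ (by exact_mod_cast hk) (by positivity)
  rw [levelSine, mul_pow, Real.sq_sqrt (by positivity)]
  nlinarith [sq_nonneg η]

theorem implementable_slotOp (hη0 : 0 ≤ η) (hη1 : η ≤ 1) (hL : 0 < L) (s : Fin D) :
    Implementable (10 * n + L * ((w + 1) * (11 * (n + 1 + w) + 1))) (slotOp out η L b s) := by
  have i1 : Implementable (n * 5)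
      (permOp fun (x : Bits (Reg n m)) v => x v ^^ slotMask out s v x) := by
    refine implementable_xor_embedding (tgtEmb n m)
      (fun k x => x (.inr .flag) == true && x (.inr (.work (out (s, .inr (.inl k))))) == true)
      (fun _ => rfl) ?_ ?_ ?_
    · rintro (k | (k | _ | _ | v)) hv <;> try rfl
      exact absurd ⟨k, rfl⟩ hv
    · intro k k' x b
      simp
    · intro k
      exact implementable_toffoli (by simp) (by simp) true true
  -- The truncation at `L` serves only to have unitary gates at all levels.
  have i2 := implementable_level (V := Reg n m) (t := .inr .flag)
    (u := fun k => rot (levelSine η L (min L k)))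
    (fun k => rot_mem ((levelSine_sq_le (min_le_left _ _)).trans (by nlinarith)))
    (by simp [levelSine, rot_zero]) hL b w
    (fun k => .inr (.work (out (s, .inr (.inr k))))) (slotLiterals out s) (by simp)
    (by
      intro a ha
      simp only [slotLiterals, List.mem_cons, List.mem_map, List.mem_finRange, true_and] at ha
      rcases ha with rfl | ⟨k, rfl⟩ <;> simp) L
  simp only [← min_assoc, min_self] at i2
  have hlen : (slotLiterals out s).length = n + 1 := by simp [slotLiterals]
  rw [hlen] at i2
  exact ((i1.mul i2).mul i1).mono (by omega)

theorem implementable_prepOp (hη0 : 0 ≤ η) (hη1 : η ≤ 1) (hL : 0 < L) (k : ℕ) (hk : k ≤ D) :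
    Implementable (k * (10 * n + L * ((w + 1) * (11 * (n + 1 + w) + 1))))
      (prepOp out η L b k) := by
  induction k with
  | zero => exact Implementable.one.mono (Nat.zero_le _)
  | succ k ih =>
    rw [prepOp, dif_pos (Nat.lt_of_succ_le hk)]
    exact ((implementable_slotOp out hη0 hη1 hL _).mul (ih (Nat.le_of_succ_le hk))).mono
      (by ring_nf; rfl)

theorem literalsHold_slotLiterals (s : Fin D) (i j : Bits (Fin n)) (f c : Bool)
    (z : Bits (Fin n ⊕ Fin m)) : literalsHold (slotLiterals out s) (mkReg i j f c z) = true ↔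
      slotUsed (readout out z) s ∧ j = fun _ => false := by
  simp [literalsHold, slotLiterals, mkReg, slotUsed, readout, funext_iff]

theorem slotMask_mkReg (s : Fin D) (i j : Bits (Fin n)) (f c : Bool) (z : Bits (Fin n ⊕ Fin m)) :
    (fun v => mkReg i j f c z v ^^ slotMask out s v (mkReg i j f c z))
      = mkReg i (if f then bxor j (slotIndex (readout out z) s) else j) f c z := by
  ext (k | (k | _ | _ | v)) <;> cases f <;>
    simp [mkReg, slotMask, bxor, slotIndex, readout]

/-- Here `j'` is the column index after the first of the two conditional additions. -/
theorem slotOp_mul_apply {κ : Type*} (s : Fin D) (N : Matrix (Bits (Reg n m)) κ ℂ)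
    (i j : Bits (Fin n)) (f c : Bool) (z : Bits (Fin n ⊕ Fin m)) (k : κ) {j' : Bits (Fin n)}
    (hj' : j' = if f then bxor j (slotIndex (readout out z) s) else j) :
    (slotOp out η L b s * N) (mkReg i j f c z) k
      = ∑ β, (if literalsHold (slotLiterals out s) (mkReg i j' f c z) then
          rot (slotSine η L b (readout out z) s) else 1) f β *
        N (mkReg i (if β then bxor j' (slotIndex (readout out z) s) else j') β c z) k := by
  rw [slotOp, Matrix.mul_assoc, Matrix.mul_assoc, permOp_mul_apply, slotMask_mkReg, ← hj',
    ucg_mul_apply]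
  simp only [update_flag, permOp_mul_apply, slotMask_mkReg]
  rfl

/-- Outside the plane of the rotation, `slotOp` is the identity. -/
theorem slotOp_mul_apply_idle {κ : Type*} (s : Fin D) (N : Matrix (Bits (Reg n m)) κ ℂ)
    (i j : Bits (Fin n)) (f c : Bool) (z : Bits (Fin n ⊕ Fin m)) (k : κ)
    (h : ¬ (slotUsed (readout out z) s ∧
      j = if f then slotIndex (readout out z) s else fun _ => false)) :
    (slotOp out η L b s * N) (mkReg i j f c z) k = N (mkReg i j f c z) k := by
  rw [slotOp_mul_apply out s N i j f c z k rfl, if_neg]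
  · cases f <;> simp [bxor_bxor]
  · rw [literalsHold_slotLiterals]
    rintro ⟨h1, h2⟩
    refine h ⟨h1, ?_⟩
    cases f
    · exact h2
    · exact bxor_eq_zero.mp h2

theorem slotOp_mul_apply_false {κ : Type*} (s : Fin D) (N : Matrix (Bits (Reg n m)) κ ℂ)
    (i : Bits (Fin n)) (c : Bool) (z : Bits (Fin n ⊕ Fin m)) (k : κ)
    (h : slotUsed (readout out z) s) :
    (slotOp out η L b s * N) (mkReg i (fun _ => false) false c z) k
      = (√(1 - slotSine η L b (readout out z) s ^ 2) : ℝ) * N (mkReg i (fun _ => false) false c z) k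
        - (slotSine η L b (readout out z) s : ℝ) *
          N (mkReg i (slotIndex (readout out z) s) true c z) k := by
  rw [slotOp_mul_apply out s N i _ false c z k (j' := fun _ => false) (by simp),
    if_pos ((literalsHold_slotLiterals out s _ _ _ _ _).mpr ⟨h, rfl⟩)]
  have : bxor (fun _ => false) (slotIndex (readout out z) s) = slotIndex (readout out z) s := by
    ext
    simp [bxor]
  simp only [Fintype.sum_bool, rot, this, if_true, Bool.false_eq_true, if_false]
  push_cast
  ring

theorem slotOp_mul_apply_true {κ : Type*} (s : Fin D) (N : Matrix (Bits (Reg n m)) κ ℂ)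
    (i : Bits (Fin n)) (c : Bool) (z : Bits (Fin n ⊕ Fin m)) (k : κ)
    (h : slotUsed (readout out z) s) :
    (slotOp out η L b s * N) (mkReg i (slotIndex (readout out z) s) true c z) k
      = (slotSine η L b (readout out z) s : ℝ) * N (mkReg i (fun _ => false) false c z) k
        + (√(1 - slotSine η L b (readout out z) s ^ 2) : ℝ) *
          N (mkReg i (slotIndex (readout out z) s) true c z) k := by
  have h0 : bxor (slotIndex (readout out z) s) (slotIndex (readout out z) s) = fun _ => false :=
    bxor_eq_zero.mpr rfl
  rw [slotOp_mul_apply out s N i _ true c z k (j' := fun _ => false) (by simp [h0]),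
    if_pos ((literalsHold_slotLiterals out s _ _ _ _ _).mpr ⟨h, rfl⟩)]
  have : bxor (fun _ => false) (slotIndex (readout out z) s) = slotIndex (readout out z) s := by
    ext
    simp [bxor]
  simp only [Fintype.sum_bool, rot, this, if_true, Bool.false_eq_true, if_false]
  ring

variable (η L b)

open Classical in
/-- The amplitude that remains on the initial state after the rotations for the first `k` slots of
the list `y`. -/
def prepRest (y : Bits (ListBits D n w)) : ℕ → ℝ
  | 0 => 1
  | k + 1 => if h : k < D then
      if slotUsed y ⟨k, h⟩ then √(1 - slotSine η L b y ⟨k, h⟩ ^ 2) * prepRest y k else prepRest y k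
    else prepRest y k

open Classical in
/-- The amplitude of the column index `j` after the rotations for the first `k` slots of the list
`y`. -/
def prepAmp (y : Bits (ListBits D n w)) : ℕ → Bits (Fin n) → ℝ
  | 0, _ => 0
  | k + 1, j => if h : k < D then
      if slotUsed y ⟨k, h⟩ ∧ slotIndex y ⟨k, h⟩ = j then
        slotSine η L b y ⟨k, h⟩ * prepRest η L b y k
      else prepAmp y k j
    else prepAmp y k j

variable {η L b}

theorem prepAmp_eq_zero {y : Bits (ListBits D n w)} {k : ℕ} {j : Bits (Fin n)}
    (h : ∀ s : Fin D, s.val < k → slotUsed y s → slotIndex y s ≠ j) : prepAmp η L b y k j = 0 := by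
  induction k with
  | zero => rfl
  | succ k ih =>
    have ih' := ih fun s hs => h s (hs.trans (Nat.lt_succ_self k))
    rw [prepAmp]
    split_ifs with h1 h2
    · exact absurd h2.2 (h ⟨k, h1⟩ (Nat.lt_succ_self k) h2.1)
    · exact ih'
    · exact ih'

theorem prepAmp_eq {y : Bits (ListBits D n w)}
    (hd : ∀ s s', slotUsed y s → slotUsed y s' → slotIndex y s = slotIndex y s' → s = s')
    {s : Fin D} (hs : slotUsed y s) {k : ℕ} (hk : s.val < k) :
    prepAmp η L b y k (slotIndex y s) = slotSine η L b y s * prepRest η L b y s := by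
  induction k with
  | zero => omega
  | succ k ih =>
    rw [prepAmp]
    rcases Nat.lt_succ_iff_lt_or_eq.mp hk with h | h
    · split_ifs with h1 h2
      · have := hd _ _ h2.1 hs h2.2
        subst this
        exact absurd h (lt_irrefl _)
      · exact ih h
      · exact ih h
    · subst h
      rw [dif_pos s.2, if_pos ⟨hs, rfl⟩]

open Classical in
/-- The first `k` rotations, applied to a state with column index zero and flag unset: in a branch
of the workspace whose list has distinct indices, the amplitudes are `prepAmp` and `prepRest`. -/
theorem prepOp_mul_apply {κ : Type*} {N : Matrix (Bits (Reg n m)) κ ℂ} {q : κ}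
    (hN : ∀ i j f c z, N (mkReg i j f c z) q
      = if f = false ∧ j = (fun _ => false) then N (mkReg i (fun _ => false) false c z) q else 0)
    {z : Bits (Fin n ⊕ Fin m)}
    (hd : ∀ s s', slotUsed (readout out z) s → slotUsed (readout out z) s' →
      slotIndex (readout out z) s = slotIndex (readout out z) s' → s = s')
    (k : ℕ) : ∀ (i j : Bits (Fin n)) (f c : Bool),
    (prepOp out η L b k * N) (mkReg i j f c z) q = N (mkReg i (fun _ => false) false c z) q *
      ((if f then prepAmp η L b (readout out z) k j
        else if j = fun _ => false then prepRest η L b (readout out z) k else 0 : ℝ) : ℂ) := by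
  induction k with
  | zero =>
    intro i j f c
    rw [prepOp, Matrix.one_mul, hN]
    cases f <;> by_cases hj : j = fun _ => false <;> simp [hj, prepAmp, prepRest]
  | succ k ih =>
    intro i j f c
    rw [prepOp, prepAmp, prepRest]
    by_cases hk : k < D
    · simp only [dif_pos hk]
      rw [Matrix.mul_assoc]
      -- As the indices are distinct, the index in the slot `k` has not been written before.
      have hzero : slotUsed (readout out z) ⟨k, hk⟩ →
          prepAmp η L b (readout out z) k (slotIndex (readout out z) ⟨k, hk⟩) = 0 := by
        intro hu
        refine prepAmp_eq_zero fun s hs hsu heq => ?_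
        have := hd _ _ hsu hu heq
        subst this
        exact absurd hs (lt_irrefl _)
      by_cases h : slotUsed (readout out z) ⟨k, hk⟩ ∧
          j = if f then slotIndex (readout out z) ⟨k, hk⟩ else fun _ => false
      · obtain ⟨hu, rfl⟩ := h
        cases f
        · simp only [Bool.false_eq_true, if_false, if_true, if_pos hu]
          rw [slotOp_mul_apply_false out _ _ _ _ _ _ hu, ih, ih]
          simp only [Bool.false_eq_true, if_false, if_true, hzero hu]
          push_cast
          ring
        · simp only [if_true, and_true, if_pos hu]
          rw [slotOp_mul_apply_true out _ _ _ _ _ _ hu, ih, ih]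
          simp only [Bool.false_eq_true, if_false, if_true, hzero hu]
          push_cast
          ring
      · rw [slotOp_mul_apply_idle out _ _ _ _ _ _ _ _ h, ih]
        congr 2
        cases f
        · simp only [Bool.false_eq_true, if_false] at h ⊢
          by_cases hj : j = fun _ => false
          · rw [if_pos hj, if_pos hj, if_neg fun hu => h ⟨hu, hj⟩]
          · rw [if_neg hj, if_neg hj]
        · simp only [if_true] at h ⊢
          rw [if_neg fun hu => h ⟨hu.1, hu.2.symm⟩]
    · simp only [dif_neg hk]
      exact ih i j f c

theorem slotSine_sq_le (y : Bits (ListBits D n w)) (s : Fin D) :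
    slotSine η L b y s ^ 2 ≤ η ^ 2 :=
  levelSine_sq_le (min_le_left _ _)

open Classical in
/-- Each slot in use takes at most `η ^ 2` from the amplitude of the initial state. -/
theorem prepRest_bounds (hη0 : 0 ≤ η) (hη1 : η ≤ 1) (y : Bits (ListBits D n w)) (k : ℕ) :
    0 ≤ prepRest η L b y k ∧ prepRest η L b y k ≤ 1 ∧
      1 - η ^ 2 * (Finset.univ.filter fun s : Fin D => slotUsed y s ∧ s.val < k).card
        ≤ prepRest η L b y k := by
  induction k with
  | zero => simp [prepRest]
  | succ k ih =>
    obtain ⟨h0, h1, h2⟩ := ih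
    have hmono : (Finset.univ.filter fun s : Fin D => slotUsed y s ∧ s.val < k).card
        ≤ (Finset.univ.filter fun s : Fin D => slotUsed y s ∧ s.val < k + 1).card := by
      refine Finset.card_le_card fun s hs => ?_
      simp only [Finset.mem_filter, Finset.mem_univ, true_and] at hs ⊢
      exact ⟨hs.1, hs.2.trans (Nat.lt_succ_self k)⟩
    have hmono' : (1 : ℝ) - η ^ 2 * (Finset.univ.filter fun s : Fin D =>
        slotUsed y s ∧ s.val < k + 1).card ≤ prepRest η L b y k := by
      refine le_trans ?_ h2
      have : ((Finset.univ.filter fun s : Fin D => slotUsed y s ∧ s.val < k).card : ℝ)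
        ≤ (Finset.univ.filter fun s : Fin D => slotUsed y s ∧ s.val < k + 1).card := by
        exact_mod_cast hmono
      nlinarith [sq_nonneg η]
    rw [prepRest]
    split_ifs with hk hu
    · have hs := slotSine_sq_le (L := L) (b := b) (η := η) y ⟨k, hk⟩
      set σ := slotSine η L b y ⟨k, hk⟩
      have hη2 : η ^ 2 ≤ 1 := by nlinarith
      have hr0 := Real.sqrt_nonneg (1 - σ ^ 2)
      have hr1 : √(1 - σ ^ 2) ≤ 1 := by
        exact Real.sqrt_le_one.mpr (by nlinarith [sq_nonneg σ])
      have hrsq : √(1 - σ ^ 2) ^ 2 = 1 - σ ^ 2 := Real.sq_sqrt (by linarith)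
      have hr2 : 1 - η ^ 2 ≤ √(1 - σ ^ 2) := by nlinarith
      refine ⟨by positivity, by nlinarith, ?_⟩
      have hcard : (Finset.univ.filter fun s : Fin D => slotUsed y s ∧ s.val < k).card + 1
          ≤ (Finset.univ.filter fun s : Fin D => slotUsed y s ∧ s.val < k + 1).card := by
        rw [Nat.succ_le_iff]
        refine Finset.card_lt_card ⟨fun s hs => ?_, fun h => ?_⟩
        · simp only [Finset.mem_filter, Finset.mem_univ, true_and] at hs ⊢
          exact ⟨hs.1, hs.2.trans (Nat.lt_succ_self k)⟩
        · have := @h ⟨k, hk⟩ (by simp [hu])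
          simp at this
      have hcard' : ((Finset.univ.filter fun s : Fin D => slotUsed y s ∧ s.val < k).card : ℝ) + 1
          ≤ (Finset.univ.filter fun s : Fin D => slotUsed y s ∧ s.val < k + 1).card := by
        exact_mod_cast hcard
      nlinarith [sq_nonneg η]
    · exact ⟨h0, h1, hmono'⟩
    · exact ⟨h0, h1, hmono'⟩

theorem abs_sqrt_sub_sqrt_le {a c : ℝ} (ha : 0 ≤ a) (hc : 0 ≤ c) : |√a - √c| ≤ √|a - c| := by
  apply Real.le_sqrt_of_sq_le
  rw [sq_abs]
  have h1 := Real.sq_sqrt ha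
  have h2 := Real.sq_sqrt hc
  have h3 := Real.sqrt_nonneg a
  have h4 := Real.sqrt_nonneg c
  rcases le_total c a with h | h
  · rw [abs_of_nonneg (by linarith)]
    have := Real.sqrt_le_sqrt h
    nlinarith
  · rw [abs_of_nonpos (by linarith)]
    have := Real.sqrt_le_sqrt h
    nlinarith

/-- Truncating and rounding to a multiple of `1 / L` an approximation of `v ≤ 1`. -/
theorem abs_level_sub_le (hL : 0 < L) (N : ℕ) {v ε : ℝ} (hv : v ≤ 1)
    (h : |(N : ℝ) / 2 ^ b - v| ≤ ε) :
    |((min L (L * N / 2 ^ b) : ℕ) : ℝ) / L - v| ≤ 1 / L + ε := by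
  have hL' : (0 : ℝ) < L := by exact_mod_cast hL
  have h2 : (0 : ℝ) < 2 ^ b := by positivity
  have hlo : ((L * N / 2 ^ b : ℕ) : ℝ) / L ≤ N / 2 ^ b := by
    have : ((L * N / 2 ^ b : ℕ) : ℝ) ≤ (L * N : ℕ) / (2 ^ b : ℕ) := Nat.cast_div_le
    push_cast at this
    rw [div_le_iff₀ hL']
    calc _ ≤ _ := this
      _ = _ := by ring
  have hhi : (N : ℝ) / 2 ^ b - 1 / L ≤ ((L * N / 2 ^ b : ℕ) : ℝ) / L := by
    have h3 : L * N < 2 ^ b * (L * N / 2 ^ b + 1) := Nat.lt_mul_div_succ _ (by positivity)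
    have h4 : (L : ℝ) * N < 2 ^ b * (((L * N / 2 ^ b : ℕ) : ℝ) + 1) := by exact_mod_cast h3
    rw [sub_le_iff_le_add, ← add_div, div_le_div_iff₀ h2 hL']
    linarith
  obtain ⟨h5, h6⟩ := abs_le.mp h
  rcases le_total L (L * N / 2 ^ b) with hle | hle
  · rw [min_eq_left hle, div_self hL'.ne', abs_of_nonneg (by linarith)]
    have : (1 : ℝ) ≤ ((L * N / 2 ^ b : ℕ) : ℝ) / L := by
      rw [le_div_iff₀ hL', one_mul]
      exact_mod_cast hle
    have h7 : 0 < 1 / (L : ℝ) := by positivity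
    linarith
  · rw [min_eq_right hle, abs_le]
    have h7 : 0 < 1 / (L : ℝ) := by positivity
    constructor <;> linarith

open Classical in
/-- The amplitudes prepared from a correct list: an amplitude is off because of the error and the
rounding of the listed value, and because of the amplitude taken by the preceding slots. -/
theorem sum_prepAmp_sub_sq_le (hη0 : 0 ≤ η) (hη1 : η ≤ 1) (hL : 0 < L) {r : Bits (Fin n) → ℝ}
    (hr0 : ∀ j, 0 ≤ r j) (hr1 : ∀ j, r j ≤ 1) {d : ℕ}
    (hrd : (Finset.univ.filter fun j => r j ≠ 0).card ≤ d) {ε : ℝ}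
    {y : Bits (ListBits D n w)} (hy : ListsRow b r ε y) :
    ∑ j, (prepAmp η L b y D j - η * √(r j)) ^ 2
      ≤ d * (η * (√(1 / L + ε) + η ^ 2 * d)) ^ 2 := by
  obtain ⟨hd, hlist, hval⟩ := hy
  have hused : (Finset.univ.filter fun s : Fin D => slotUsed y s).card ≤ d := by
    refine le_trans (Finset.card_le_card_of_injOn (slotIndex y) ?_ ?_) hrd
    · intro s hs
      simp only [Finset.coe_filter, Finset.mem_univ, true_and] at hs ⊢
      exact (hlist _).mpr ⟨s, hs, rfl⟩
    · intro s hs s' hs' h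
      simp only [Finset.coe_filter, Finset.mem_univ, true_and] at hs hs'
      exact hd _ _ hs hs' h
  have hterm : ∀ j, (prepAmp η L b y D j - η * √(r j)) ^ 2
      ≤ if r j ≠ 0 then (η * (√(1 / L + ε) + η ^ 2 * d)) ^ 2 else 0 := by
    intro j
    by_cases hj : r j ≠ 0
    · rw [if_pos hj]
      obtain ⟨s, hs, rfl⟩ := (hlist j).mp hj
      obtain ⟨hp0, hp1, hp2⟩ := prepRest_bounds (L := L) (b := b) hη0 hη1 y s
      rw [prepAmp_eq hd hs s.2, slotSine, levelSine]
      set a : ℝ := √(((min L (L * Nat.ofBits (fun k => y (s, .inr (.inr k))) / 2 ^ b) : ℕ) : ℝ) / L)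
      have ha0 : 0 ≤ a := Real.sqrt_nonneg _
      have ha1 : a ≤ 1 := by
        refine Real.sqrt_le_one.mpr ?_
        exact div_le_one_of_le₀ (by exact_mod_cast min_le_left _ _) (by positivity)
      have ha : |a - √(r (slotIndex y s))| ≤ √(1 / L + ε) :=
        (abs_sqrt_sub_sqrt_le (by positivity) (hr0 _)).trans
          (Real.sqrt_le_sqrt (abs_level_sub_le hL _ (hr1 _) (hval s hs)))
      have hcard : ((Finset.univ.filter fun t : Fin D => slotUsed y t ∧ t.val < s.val).card : ℝ)
          ≤ d := by
        refine le_trans ?_ (Nat.cast_le.mpr hused)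
        refine Nat.cast_le.mpr (Finset.card_le_card fun t ht => ?_)
        simp only [Finset.mem_filter, Finset.mem_univ, true_and] at ht ⊢
        exact ht.1
      have hp : 1 - η ^ 2 * d ≤ prepRest η L b y s := by nlinarith [sq_nonneg η]
      rw [← sq_abs]
      refine pow_le_pow_left₀ (abs_nonneg _) ?_ 2
      have : η * a * prepRest η L b y s - η * √(r (slotIndex y s))
          = η * ((a - √(r (slotIndex y s))) - a * (1 - prepRest η L b y s)) := by ring
      rw [this, abs_mul, abs_of_nonneg hη0]
      refine mul_le_mul_of_nonneg_left ?_ hη0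
      refine (abs_sub _ _).trans (add_le_add ha ?_)
      rw [abs_of_nonneg (mul_nonneg ha0 (by linarith))]
      nlinarith
    · rw [if_neg hj]
      have hj' : r j = 0 := not_not.mp hj
      rw [prepAmp_eq_zero, hj']
      · simp
      · intro s _ hs h
        exact hj ((hlist j).mpr ⟨s, hs, h⟩)
  refine (Finset.sum_le_sum fun j _ => hterm j).trans ?_
  rw [← Finset.sum_filter, Finset.sum_const, nsmul_eq_mul]
  exact mul_le_mul_of_nonneg_right (Nat.cast_le.mpr hrd) (sq_nonneg _)

end Prep

open scoped Matrix.Norms.L2Operator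


/-! ### Operator norm estimates -/

section Norms

variable {k l : Type*} [Fintype k] [DecidableEq k] [Fintype l] [DecidableEq l]

theorem norm_one_le : ‖(1 : Matrix k k ℂ)‖ ≤ 1 := by
  rw [← diagonal_one, l2_opNorm_diagonal]
  exact (pi_norm_le_iff_of_nonneg zero_le_one).mpr fun _ => by simp

theorem norm_le_one_of_isometry {U : Matrix k l ℂ} (hU : Uᴴ * U = 1) : ‖U‖ ≤ 1 := by
  have h := l2_opNorm_conjTranspose_mul_self U
  rw [hU] at h
  have h1 := norm_one_le (k := l)
  nlinarith [norm_nonneg U]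

theorem sum_norm_sq_eq (N : Matrix k l ℂ) (i : l) :
    ((∑ x, ‖N x i‖ ^ 2 : ℝ) : ℂ) = (Nᴴ * N) i i := by
  simp [Matrix.mul_apply, conjTranspose_apply, Complex.conj_mul']

theorem sum_norm_sq_mul {U : Matrix k k ℂ} (hU : Uᴴ * U = 1) (N : Matrix k l ℂ) (i : l) :
    ∑ x, ‖(U * N) x i‖ ^ 2 = ∑ x, ‖N x i‖ ^ 2 := by
  have h : (U * N)ᴴ * (U * N) = Nᴴ * N := by
    rw [conjTranspose_mul, Matrix.mul_assoc, ← Matrix.mul_assoc Uᴴ, hU, Matrix.one_mul]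
  have h1 := sum_norm_sq_eq (U * N) i
  rw [h, ← sum_norm_sq_eq] at h1
  exact_mod_cast h1

/-- A matrix whose columns have disjoint supports has as operator norm the largest norm of a
column. -/
theorem norm_le_of_disjoint_columns {N : Matrix k l ℂ} (κ : k → l)
    (hκ : ∀ x i, N x i ≠ 0 → κ x = i) {B : ℝ} (hB : 0 ≤ B)
    (h : ∀ i, ∑ x, ‖N x i‖ ^ 2 ≤ B ^ 2) : ‖N‖ ≤ B := by
  have hd : Nᴴ * N = diagonal fun i => ((∑ x, ‖N x i‖ ^ 2 : ℝ) : ℂ) := by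
    ext i j
    by_cases hij : i = j
    · subst hij
      rw [diagonal_apply_eq, sum_norm_sq_eq]
    · rw [diagonal_apply_ne _ hij, Matrix.mul_apply]
      refine Finset.sum_eq_zero fun x _ => ?_
      by_cases h1 : N x i = 0
      · simp [conjTranspose_apply, h1]
      · by_cases h2 : N x j = 0
        · simp [h2]
        · exact absurd ((hκ x i h1).symm.trans (hκ x j h2)) hij
  have h1 := l2_opNorm_conjTranspose_mul_self N
  have h2 : ‖Nᴴ * N‖ ≤ B ^ 2 := by
    rw [hd, l2_opNorm_diagonal]
    refine (pi_norm_le_iff_of_nonneg (sq_nonneg B)).mpr fun i => ?_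
    rw [Complex.norm_real, Real.norm_eq_abs,
      abs_of_nonneg (Finset.sum_nonneg fun _ _ => sq_nonneg _)]
    exact h i
  rw [h1] at h2
  exact abs_le_of_sq_le_sq' (by linarith [sq ‖N‖]) hB |>.2

end Norms

/-! ### The state prepared for a row -/

section Row

variable {n m D w : ℕ}

theorem diagonal_mul_permOp {V : Type} [Fintype V] [DecidableEq V] {d : Bits V → ℂ}
    {f : Bits V → Bits V} (h : ∀ x, d (f x) = d x) :
    diagonal d * permOp f = permOp f * diagonal d := by
  ext x y
  rw [permOp_mul_apply, diagonal_mul, permOp, diagonal_apply, h]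
  split_ifs <;> simp

theorem diagonal_mul_ucg {V : Type} [Fintype V] [DecidableEq V] {d : Bits V → ℂ} {t : V}
    (h : IndepOf t d) (F : Bits V → Matrix Bool Bool ℂ) :
    diagonal d * ucg t F = ucg t F * diagonal d := by
  ext x y
  rw [diagonal_mul, mul_diagonal, ucg]
  split_ifs with hxy
  · rw [(eq_update_iff t x y (y t)).mpr ⟨hxy, rfl⟩, h, mul_comm]
  · simp

theorem diagonal_mul_lift {V W : Type} [Fintype V] [DecidableEq V] {d : Bits V → ℂ} {e : W ↪ V}
    (h : ∀ x y, (∀ v, v ∉ Set.range e → x v = y v) → d x = d y) (M : Matrix (Bits W) (Bits W) ℂ) :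
    diagonal d * lift e M = lift e M * diagonal d := by
  ext x y
  rw [diagonal_mul, mul_diagonal, lift]
  split_ifs with hxy
  · rw [h x y hxy, mul_comm]
  · simp

/-- The projection onto the basis states with flag set. -/
def flagProj (n m : ℕ) : Matrix (Bits (Reg n m)) (Bits (Reg n m)) ℂ :=
  diagonal fun x => if x (.inr .flag) then 1 else 0

variable (out : ListBits D n w → Fin n ⊕ Fin m) (η : ℝ) (L b : ℕ)
  (Q : Matrix (Bits (Fin n ⊕ Fin m)) (Bits (Fin n ⊕ Fin m)) ℂ)
  (A : Matrix (Bits (Fin n)) (Bits (Fin n)) ℝ)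

/-- Writes into the column index a superposition of the entries of the row listed by the program
with unitary `Q`, which is run on a copy of the row index and then undone. -/
def rowPrep : Matrix (Bits (Reg n m)) (Bits (Reg n m)) ℂ :=
  copyOp n m * ((lift workEmb Q)ᴴ * (prepOp out η L b D * (lift workEmb Q * copyOp n m)))

variable (m) in
/-- The operator `|i⟩ ↦ η ∑ j, √(A i j) |i, j⟩` with flag set and all other ancillas zero. -/
def rowTarget : Matrix (Bits (Reg n m)) (Bits (Fin n)) ℂ := fun x i =>
  if (regEquiv.symm x).1 = i ∧ (regEquiv.symm x).2.2.1 = true ∧ (regEquiv.symm x).2.2.2.1 = false ∧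
    (regEquiv.symm x).2.2.2.2 = (fun _ => false) then
    ((η * √(A i (regEquiv.symm x).2.1) : ℝ) : ℂ) else 0

theorem rowTarget_apply (i' j : Bits (Fin n)) (f c : Bool) (z : Bits (Fin n ⊕ Fin m))
    (i : Bits (Fin n)) : rowTarget m η A (mkReg i' j f c z) i
      = if i' = i ∧ f = true ∧ c = false ∧ z = (fun _ => false) then
        ((η * √(A i j) : ℝ) : ℂ) else 0 := rfl

theorem sum_reg_ite {β : Type*} [AddCommMonoid β] {G : Bits (Reg n m) → β} {i : Bits (Fin n)}
    {f₀ c₀ : Bool} {g : Bits (Fin n) → Bits (Fin n ⊕ Fin m) → β}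
    (h : ∀ i' j f c z, G (mkReg i' j f c z) = if i' = i ∧ f = f₀ ∧ c = c₀ then g j z else 0) :
    ∑ x, G x = ∑ j, ∑ z, g j z := by
  rw [sum_reg, Finset.sum_eq_single i]
  · refine Finset.sum_congr rfl fun j _ => ?_
    simp only [h]
    cases f₀ <;> cases c₀ <;> simp
  · intro i' _ hi'
    simp [h, hi']
  · simp

theorem copyOp_mul_apply {κ : Type*} (N : Matrix (Bits (Reg n m)) κ ℂ) (i j : Bits (Fin n))
    (f c : Bool) (z : Bits (Fin n ⊕ Fin m)) (k : κ) : (copyOp n m * N) (mkReg i j f c z) k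
      = N (mkReg i j f c (bxor z (Sum.elim i fun _ => false))) k := by
  rw [copyOp, permOp_mul_apply, copy_mkReg]

theorem copyOp_mul_self : copyOp n m * copyOp n m = 1 := by
  ext x y
  obtain ⟨i, j, f, c, z, rfl⟩ := exists_eq_mkReg x
  rw [← Matrix.mul_one (copyOp n m * copyOp n m), Matrix.mul_assoc, copyOp_mul_apply,
    copyOp_mul_apply, bxor_bxor]

/-- The state of the register after the program with unitary `Q` has been run on the copy of the row
index. -/
def rowState : Matrix (Bits (Reg n m)) (Bits (Fin n)) ℂ :=
  lift workEmb Q * (copyOp n m * zeroExt (Fin n) (Anc n m))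

/-- The state of the register if then the entries of the row had been written exactly. -/
def rowIdeal : Matrix (Bits (Reg n m)) (Bits (Fin n)) ℂ :=
  lift workEmb Q * (copyOp n m * rowTarget m η A)

theorem rowState_apply (i' j : Bits (Fin n)) (f c : Bool)
    (z : Bits (Fin n ⊕ Fin m)) (i : Bits (Fin n)) :
    rowState Q (mkReg i' j f c z) i
      = if i' = i ∧ f = false ∧ c = false then
          if j = (fun _ => false) then Q z (Sum.elim i fun _ => false) else 0 else 0 := by
  rw [rowState, lift_workEmb_mul_apply]
  simp only [copyOp_mul_apply, zeroExt, elim_zero_eq_mkReg, mkReg_inj, bxor_eq_zero]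
  by_cases h : i' = i ∧ f = false ∧ c = false
  · obtain ⟨rfl, rfl, rfl⟩ := h
    by_cases hj : j = fun _ => false <;> simp [hj]
  · rw [if_neg h]
    refine Finset.sum_eq_zero fun y _ => ?_
    rw [if_neg, mul_zero]
    rintro ⟨h1, -, h2, h3, -⟩
    exact h ⟨h1, h2, h3⟩

theorem rowIdeal_apply (i' j : Bits (Fin n)) (f c : Bool)
    (z : Bits (Fin n ⊕ Fin m)) (i : Bits (Fin n)) :
    rowIdeal η Q A (mkReg i' j f c z) i
      = if i' = i ∧ f = true ∧ c = false then
          Q z (Sum.elim i fun _ => false) * ((η * √(A i j) : ℝ) : ℂ) else 0 := by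
  rw [rowIdeal, lift_workEmb_mul_apply]
  simp only [copyOp_mul_apply, rowTarget_apply, bxor_eq_zero]
  by_cases h : i' = i ∧ f = true ∧ c = false
  · obtain ⟨rfl, rfl, rfl⟩ := h
    simp
  · rw [if_neg h]
    refine Finset.sum_eq_zero fun y _ => ?_
    rw [if_neg, mul_zero]
    rintro ⟨h1, h2, h3, -⟩
    exact h ⟨h1, h2, h3⟩

theorem norm_rowTarget_le (hη : 0 ≤ η) (hA : A ∈ rowStochastic ℝ (Bits (Fin n))) :
    ‖rowTarget m η A‖ ≤ η := by
  refine norm_le_of_disjoint_columns (fun x => (regEquiv.symm x).1) ?_ hη ?_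
  · intro x i h
    by_contra hne
    exact h (by rw [rowTarget, if_neg fun h => hne h.1])
  · intro i
    rw [sum_reg_ite (i := i) (f₀ := true) (c₀ := false)
      (g := fun j z => if z = (fun _ => false) then η ^ 2 * A i j else 0)]
    · simp only [Finset.sum_ite_eq', Finset.mem_univ, if_true, ← Finset.mul_sum,
        sum_row_of_mem_rowStochastic hA i, mul_one, le_refl]
    · intro i' j f c z
      rw [rowTarget_apply]
      by_cases h : i' = i ∧ f = true ∧ c = false
      · obtain ⟨rfl, rfl, rfl⟩ := h
        by_cases hz : z = fun _ => false
        · simp only [hz, and_self, if_true, Complex.norm_real, Real.norm_eq_abs, sq_abs, mul_pow]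
          rw [Real.sq_sqrt (nonneg_of_mem_rowStochastic hA)]
        · simp [hz]
      · rw [if_neg h, if_neg fun h' => h ⟨h'.1, h'.2.1, h'.2.2.1⟩]
        simp

/-- The preparation changes neither the row index nor the workspace. -/
theorem diagonal_mul_prepOp (d : Bits (Fin n) → Bits (Fin n ⊕ Fin m) → ℂ) (k : ℕ) :
    diagonal (fun x : Bits (Reg n m) => d (fun v => x (.inl v)) fun v => x (.inr (.work v))) *
        prepOp out η L b k
      = prepOp out η L b k *
        diagonal fun x : Bits (Reg n m) => d (fun v => x (.inl v)) fun v => x (.inr (.work v)) := by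
  induction k with
  | zero => simp [prepOp]
  | succ k ih =>
    rw [prepOp]
    split_ifs with hk
    · have h1 : diagonal
          (fun x : Bits (Reg n m) => d (fun v => x (.inl v)) fun v => x (.inr (.work v))) *
          permOp (fun x v => x v ^^ slotMask out ⟨k, hk⟩ v x) =
          permOp (fun x v => x v ^^ slotMask out ⟨k, hk⟩ v x) * diagonal
          (fun x : Bits (Reg n m) => d (fun v => x (.inl v)) fun v => x (.inr (.work v))) :=
        diagonal_mul_permOp fun x => by simp [slotMask]
      have h2 : IndepOf (.inr .flag)
          (fun x : Bits (Reg n m) => d (fun v => x (.inl v)) fun v => x (.inr (.work v))) := by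
        intro x c
        simp
      rw [slotOp]
      simp only [Matrix.mul_assoc]
      rw [← Matrix.mul_assoc _ (permOp _), h1, Matrix.mul_assoc, ← Matrix.mul_assoc _ (ucg _ _),
        diagonal_mul_ucg h2, Matrix.mul_assoc, ← Matrix.mul_assoc _ (permOp _), h1,
        Matrix.mul_assoc, ih]
    · exact ih

variable {η L b Q A}

/-- Undoing the program is unitary and leaves the flag alone. -/
theorem rowPrep_sub_eq (hQ : Qᴴ * Q = 1) :
    flagProj n m * (rowPrep out η L b Q * zeroExt (Fin n) (Anc n m)) - rowTarget m η A
      = copyOp n m * ((lift workEmb Q)ᴴ * (flagProj n m * (prepOp out η L b D * rowState Q)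
          - rowIdeal η Q A)) := by
  have h1 : flagProj n m * copyOp n m = copyOp n m * flagProj n m :=
    diagonal_mul_permOp fun x => by simp [copyMask]
  have h2 : ∀ M, flagProj n m * lift workEmb M = lift workEmb M * flagProj n m := by
    refine diagonal_mul_lift fun x y h => ?_
    rw [h]
    rintro ⟨v, hv⟩
    simp at hv
  have h3 : (lift workEmb Q)ᴴ * lift workEmb Q = (1 : Matrix (Bits (Reg n m)) _ ℂ) := by
    rw [lift_conjTranspose, ← lift_mul, hQ, lift_one]
  rw [rowState, rowIdeal, Matrix.mul_sub, Matrix.mul_sub, ← Matrix.mul_assoc (lift workEmb Q)ᴴ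
    (lift workEmb Q), h3,
    Matrix.one_mul, ← Matrix.mul_assoc (copyOp n m) (copyOp n m), copyOp_mul_self, Matrix.one_mul,
    rowPrep]
  congr 1
  simp only [Matrix.mul_assoc]
  rw [← Matrix.mul_assoc (flagProj n m), h1, Matrix.mul_assoc, lift_conjTranspose,
    ← Matrix.mul_assoc (flagProj n m), h2, Matrix.mul_assoc]

theorem prepOp_mul_rowState_apply_of_ne {i' i : Bits (Fin n)} (hne : i' ≠ i) (j : Bits (Fin n))
    (f c : Bool) (z : Bits (Fin n ⊕ Fin m)) :
    (prepOp out η L b D * rowState Q) (mkReg i' j f c z) i = 0 := by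
  let d : Bits (Fin n) → Bits (Fin n ⊕ Fin m) → ℂ := fun i' _ => if i' = i then 0 else 1
  let dd : Bits (Reg n m) → ℂ := fun x => d (fun v => x (.inl v)) fun v => x (.inr (.work v))
  have hcomm : diagonal dd * (prepOp out η L b D * rowState Q)
      = prepOp out η L b D * (diagonal dd * rowState Q) := by
    rw [← Matrix.mul_assoc, ← Matrix.mul_assoc, diagonal_mul_prepOp out η L b d D]
  have h0 : ∀ x, (diagonal dd * rowState Q) x i = 0 := by
    intro x
    obtain ⟨i', j, f, c, z, rfl⟩ := exists_eq_mkReg x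
    have hz : dd (mkReg i' j f c z) = if i' = i then 0 else 1 := rfl
    rw [diagonal_mul, rowState_apply, hz]
    by_cases h : i' = i <;> simp [h]
  have h1 := congrFun (congrFun hcomm (mkReg i' j f c z)) i
  have hz : dd (mkReg i' j f c z) = if i' = i then 0 else 1 := rfl
  rw [diagonal_mul, hz, if_neg hne, one_mul] at h1
  rw [h1, Matrix.mul_apply]
  exact Finset.sum_eq_zero fun x _ => by rw [h0, mul_zero]

open Classical in
/-- The rotations preserve the norm of each set of branches of the computation. -/
theorem sum_prepOp_mul_rowState (hη0 : 0 ≤ η) (hη1 : η ≤ 1) (hL : 0 < L)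
    (bad : Bits (Fin n ⊕ Fin m) → Prop) (i : Bits (Fin n)) :
    ∑ x : Bits (Reg n m), (if bad fun v => x (.inr (.work v)) then
        ‖(prepOp out η L b D * rowState Q) x i‖ ^ 2 else 0)
      = ∑ z, if bad z then ‖Q z (Sum.elim i fun _ => false)‖ ^ 2 else 0 := by
  let d : Bits (Fin n) → Bits (Fin n ⊕ Fin m) → ℂ := fun _ z => if bad z then 1 else 0
  let dd : Bits (Reg n m) → ℂ := fun x => d (fun v => x (.inl v)) fun v => x (.inr (.work v))
  have hcomm : diagonal dd * (prepOp out η L b D * rowState Q)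
      = prepOp out η L b D * (diagonal dd * rowState Q) := by
    rw [← Matrix.mul_assoc, ← Matrix.mul_assoc, diagonal_mul_prepOp out η L b d D]
  have h1 : ∀ x : Bits (Reg n m), (if bad fun v => x (.inr (.work v)) then
      ‖(prepOp out η L b D * rowState Q) x i‖ ^ 2 else 0)
        = ‖(diagonal dd * (prepOp out η L b D * rowState Q)) x i‖ ^ 2 := by
    intro x
    rw [diagonal_mul]
    by_cases hx : bad fun v => x (.inr (.work v)) <;> simp [dd, d, hx]
  simp only [h1]
  rw [hcomm, sum_norm_sq_mul (implementable_prepOp out hη0 hη1 hL D le_rfl).conjTranspose_mul_self,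
    sum_reg_ite (i := i) (f₀ := false) (c₀ := false) (g := fun j z =>
      if j = (fun _ => false) then
        if bad z then ‖Q z (Sum.elim i fun _ => false)‖ ^ 2 else 0 else 0)]
  · rw [Finset.sum_eq_single fun _ => false]
    · simp
    · intro j _ hj
      simp [hj]
    · simp
  · intro i' j f c z
    have hz : dd (mkReg i' j f c z) = if bad z then 1 else 0 := rfl
    rw [diagonal_mul, rowState_apply, hz]
    by_cases h1 : i' = i ∧ f = false ∧ c = false
    · rw [if_pos h1, if_pos h1]
      by_cases h2 : j = fun _ => false <;> by_cases h3 : bad z <;> simp [h2, h3]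
    · rw [if_neg h1, if_neg h1]
      simp

theorem flagProj_mul_apply {κ : Type*} (N : Matrix (Bits (Reg n m)) κ ℂ) (i j : Bits (Fin n))
    (f c : Bool) (z : Bits (Fin n ⊕ Fin m)) (k : κ) :
    (flagProj n m * N) (mkReg i j f c z) k = if f then N (mkReg i j f c z) k else 0 := by
  rw [flagProj, diagonal_mul]
  cases f <;> simp [mkReg]

theorem prepOp_mul_rowState_apply {ε : ℝ} {i : Bits (Fin n)} {z : Bits (Fin n ⊕ Fin m)}
    (hz : ListsRow b (A i) ε (readout out z)) (i' j : Bits (Fin n)) (c : Bool) :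
    (prepOp out η L b D * rowState Q) (mkReg i' j true c z) i
      = if i' = i ∧ c = false then
        Q z (Sum.elim i fun _ => false) * (prepAmp η L b (readout out z) D j : ℂ) else 0 := by
  rw [prepOp_mul_apply out ?_ hz.1 D i' j true c, rowState_apply]
  · by_cases h1 : i' = i <;> by_cases h3 : c = false <;> simp [h1, h3]
  · intro i' j f c z
    simp only [rowState_apply]
    by_cases h1 : i' = i <;> by_cases h2 : f = false <;> by_cases h3 : c = false <;>
      by_cases h4 : j = fun _ => false <;> simp [h1, h2, h3, h4]

open Classical in
/-- The columns of `rowPrep`, after the program has been run. Branches with a correct list are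
controlled by `sum_prepAmp_sub_sq_le`, the other branches are rare. -/
theorem sum_flagProj_prepOp_sub_sq_le (hη0 : 0 ≤ η) (hη1 : η ≤ 1) (hL : 0 < L)
    (hQ : Qᴴ * Q = 1) (hA : A ∈ rowStochastic ℝ (Bits (Fin n))) {d : ℕ} {i : Bits (Fin n)}
    (hd : (Finset.univ.filter fun j => A i j ≠ 0).card ≤ d) {ε : ℝ}
    (hε : ∑ z, (if ListsRow b (A i) ε (readout out z) then 0 else
      ‖Q z (Sum.elim i fun _ => false)‖ ^ 2) ≤ ε) :
    ∑ x, ‖(flagProj n m * (prepOp out η L b D * rowState Q) - rowIdeal η Q A) x i‖ ^ 2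
      ≤ d * (η * (√(1 / L + ε) + η ^ 2 * d)) ^ 2 + 4 * ε := by
  have hη2 : η ^ 2 ≤ 1 := by nlinarith
  set e : Bits (Fin n ⊕ Fin m) := Sum.elim i fun _ => false with he
  set K : ℝ := d * (η * (√(1 / L + ε) + η ^ 2 * d)) ^ 2 with hK
  have hK0 : 0 ≤ K := by positivity
  have hQe : ∑ z, ‖Q z e‖ ^ 2 = 1 := by
    have := sum_norm_sq_eq Q e
    rw [hQ, Matrix.one_apply_eq] at this
    exact_mod_cast this
  have hA0 : ∀ j, 0 ≤ A i j := fun j => nonneg_of_mem_rowStochastic hA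
  have hA1 : ∀ j, A i j ≤ 1 := fun j => le_one_of_mem_rowStochastic hA
  let good : Bits (Fin n ⊕ Fin m) → Prop := fun z => ListsRow b (A i) ε (readout out z)
  have hε' : ∑ z, (if ¬ good z then ‖Q z e‖ ^ 2 else 0) ≤ ε := by
    simpa only [good, ite_not] using hε
  -- `gg` bounds the entries in column `i` with flag set, on the support of the target
  let gg : Bits (Fin n) → Bits (Fin n ⊕ Fin m) → ℝ := fun j z =>
    if good z then
      ‖Q z e‖ ^ 2 * (prepAmp η L b (readout out z) D j - η * √(A i j)) ^ 2
    else 2 * (‖Q z e‖ ^ 2 * (η ^ 2 * A i j))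
  let G : Bits (Reg n m) → ℝ := fun x =>
    if (regEquiv.symm x).1 = i ∧ (regEquiv.symm x).2.2.1 = true ∧
      (regEquiv.symm x).2.2.2.1 = false then
      gg (regEquiv.symm x).2.1 (regEquiv.symm x).2.2.2.2 else 0
  let H : Bits (Reg n m) → ℝ := fun x =>
    if ¬ good fun v => x (.inr (.work v)) then
      ‖(prepOp out η L b D * rowState Q) x i‖ ^ 2 else 0
  have hG : ∑ x, G x = ∑ j, ∑ z, gg j z := sum_reg_ite fun _ _ _ _ _ => rfl
  have hH : ∑ x, H x ≤ ε := by
    refine le_of_eq_of_le ?_ hε'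
    convert sum_prepOp_mul_rowState (Q := Q) (b := b) out hη0 hη1 hL (fun z => ¬ good z) i
  have hgg0 : ∀ j z, 0 ≤ gg j z := by
    intro j z
    have := hA0 j
    by_cases hz : good z
    · simp only [gg, if_pos hz]
      positivity
    · simp only [gg, if_neg hz]
      positivity
  -- A branch with a wrong list contributes at most twice its weight for each of the two states.
  have hpoint : ∀ x, ‖(flagProj n m * (prepOp out η L b D * rowState Q) - rowIdeal η Q A) x i‖ ^ 2
      ≤ G x + 2 * H x := by
    intro x
    obtain ⟨i', j, f, c, z, rfl⟩ := exists_eq_mkReg x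
    have hGx : G (mkReg i' j f c z) = if i' = i ∧ f = true ∧ c = false then gg j z else 0 := rfl
    have hHx : H (mkReg i' j f c z) = if ¬ good z then
      ‖(prepOp out η L b D * rowState Q) (mkReg i' j f c z) i‖ ^ 2 else 0 := rfl
    have hG0 : 0 ≤ G (mkReg i' j f c z) := by
      rw [hGx]
      by_cases h1 : i' = i ∧ f = true ∧ c = false
      · rw [if_pos h1]
        exact hgg0 _ _
      · rw [if_neg h1]
    have hH0 : 0 ≤ H (mkReg i' j f c z) := by
      rw [hHx]
      by_cases hz : ¬ good z
      · rw [if_pos hz]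
        positivity
      · rw [if_neg hz]
    rw [Matrix.sub_apply, flagProj_mul_apply]
    cases f
    · rw [rowIdeal_apply, if_neg (by simp), if_neg (by simp)]
      simp only [sub_zero, norm_zero, ne_eq, OfNat.ofNat_ne_zero, not_false_eq_true, zero_pow]
      linarith
    rw [if_pos rfl]
    by_cases hz : good z
    · refine le_add_of_le_of_nonneg ?_ (by linarith)
      rw [hGx, prepOp_mul_rowState_apply out hz, rowIdeal_apply, ← he]
      by_cases h1 : i' = i ∧ c = false
      · obtain ⟨rfl, rfl⟩ := h1
        simp only [and_self, if_true, gg, if_pos hz]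
        rw [← mul_sub, norm_mul, mul_pow, ← Complex.ofReal_sub, Complex.norm_real,
          Real.norm_eq_abs, sq_abs]
      · rw [if_neg h1, if_neg fun h => h1 ⟨h.1, h.2.2⟩, if_neg fun h => h1 ⟨h.1, h.2.2⟩]
        simp
    · rw [hHx, if_pos hz, hGx]
      have htri : ∀ u v : ℂ, ‖u - v‖ ^ 2 ≤ 2 * ‖v‖ ^ 2 + 2 * ‖u‖ ^ 2 := by
        intro u v
        have := norm_sub_le u v
        nlinarith [sq_nonneg (‖u‖ - ‖v‖), norm_nonneg (u - v)]
      refine (htri _ _).trans (add_le_add ?_ le_rfl)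
      rw [rowIdeal_apply]
      by_cases h1 : i' = i ∧ true = true ∧ c = false
      · rw [if_pos h1, if_pos h1]
        simp only [gg, if_neg hz]
        rw [norm_mul, mul_pow, Complex.norm_real, Real.norm_eq_abs, sq_abs, mul_pow η,
          Real.sq_sqrt (hA0 j)]
      · rw [if_neg h1, if_neg h1]
        simp
  have hGsum : ∑ j, ∑ z, gg j z ≤ K + 2 * ε := by
    rw [Finset.sum_comm]
    have hz : ∀ z, ∑ j, gg j z ≤ ‖Q z e‖ ^ 2 * K +
        2 * (if ¬ good z then ‖Q z e‖ ^ 2 else 0) := by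
      intro z
      by_cases hz : good z
      · simp only [gg, if_pos hz, not_true_eq_false, hz, if_false, mul_zero, add_zero,
          ← Finset.mul_sum]
        exact mul_le_mul_of_nonneg_left
          (sum_prepAmp_sub_sq_le hη0 hη1 hL hA0 hA1 hd hz) (sq_nonneg _)
      · simp only [gg, if_neg hz, hz, not_false_eq_true, if_true, ← Finset.mul_sum,
          sum_row_of_mem_rowStochastic hA i, mul_one]
        have h1 : 0 ≤ ‖Q z e‖ ^ 2 := sq_nonneg _
        nlinarith [mul_nonneg h1 hK0]
    refine (Finset.sum_le_sum fun z _ => hz z).trans ?_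
    rw [Finset.sum_add_distrib, ← Finset.sum_mul, hQe, ← Finset.mul_sum, one_mul]
    linarith
  calc _ ≤ ∑ x, (G x + 2 * H x) := Finset.sum_le_sum fun x _ => hpoint x
    _ = ∑ j, ∑ z, gg j z + 2 * ∑ x, H x := by
        rw [Finset.sum_add_distrib, hG, Finset.mul_sum]
    _ ≤ K + 4 * ε := by linarith

open Classical in
/-- The part of `rowPrep` with flag set approximates `rowTarget`, uniformly over superpositions of
rows, as different rows stay orthogonal. -/
theorem norm_flagProj_mul_rowPrep_sub_le (hη0 : 0 ≤ η) (hη1 : η ≤ 1) (hL : 0 < L)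
    (hQ : Qᴴ * Q = 1) (hA : A ∈ rowStochastic ℝ (Bits (Fin n))) {d : ℕ}
    (hd : ∀ i, (Finset.univ.filter fun j => A i j ≠ 0).card ≤ d) {ε : ℝ}
    (hε : ∀ i, ∑ z, (if ListsRow b (A i) ε (readout out z) then 0 else
      ‖Q z (Sum.elim i fun _ => false)‖ ^ 2) ≤ ε)
    {B : ℝ} (hB0 : 0 ≤ B) (hB : d * (η * (√(1 / L + ε) + η ^ 2 * d)) ^ 2 + 4 * ε ≤ B ^ 2) :
    ‖flagProj n m * (rowPrep out η L b Q * zeroExt (Fin n) (Anc n m)) - rowTarget m η A‖ ≤ B := by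
  have hQ' : (lift workEmb Q)ᴴ * lift workEmb Q = (1 : Matrix (Bits (Reg n m)) _ ℂ) := by
    rw [lift_conjTranspose, ← lift_mul, hQ, lift_one]
  have hQQ : lift workEmb Q * (lift workEmb Q)ᴴ = (1 : Matrix (Bits (Reg n m)) _ ℂ) :=
    mul_eq_one_comm.mp hQ'
  have hred : ‖flagProj n m * (prepOp out η L b D * rowState Q) - rowIdeal η Q A‖ ≤ B := by
    refine norm_le_of_disjoint_columns (fun x => (regEquiv.symm x).1) ?_ hB0 fun i =>
      (sum_flagProj_prepOp_sub_sq_le out hη0 hη1 hL hQ hA (hd i) (hε i)).trans hB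
    intro x i hx
    obtain ⟨i', j, f, c, z, rfl⟩ := exists_eq_mkReg x
    by_contra hne
    have hne : i' ≠ i := hne
    apply hx
    rw [Matrix.sub_apply, flagProj_mul_apply, prepOp_mul_rowState_apply_of_ne out hne,
      rowIdeal_apply, if_neg (c := i' = i ∧ f = true ∧ c = false) fun h => hne h.1]
    simp
  have hc : ‖copyOp n m‖ ≤ 1 := norm_le_one_of_isometry implementable_copyOp.conjTranspose_mul_self
  have hl : ‖(lift workEmb Q)ᴴ‖ ≤ (1 : ℝ) :=
    norm_le_one_of_isometry (k := Bits (Reg n m)) (by rw [conjTranspose_conjTranspose, hQQ])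
  rw [rowPrep_sub_eq out hQ]
  refine (l2_opNorm_mul _ _).trans ?_
  refine (mul_le_of_le_one_left (norm_nonneg _) hc).trans ?_
  refine (l2_opNorm_mul _ _).trans ?_
  exact (mul_le_of_le_one_left (norm_nonneg _) hl).trans hred

end Row

/-! ### From a reflection walk to the exponential -/

section Walk

theorem norm_exp_sub_one_sub_le {𝔸 : Type*} [NormedRing 𝔸] [NormedAlgebra ℂ 𝔸] [CompleteSpace 𝔸]
    {X : 𝔸} (hX : ‖X‖ ≤ 1) : ‖NormedSpace.exp X - 1 - X‖ ≤ ‖X‖ ^ 2 := by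
  have h1 := (hasSum_nat_add_iff' 2).mpr (NormedSpace.exp_series_hasSum_exp' (𝕂 := ℂ) X)
  have h2 := (hasSum_nat_add_iff' 2).mpr (NormedSpace.exp_series_hasSum_exp' (𝕂 := ℝ) ‖X‖)
  have h3 : ‖NormedSpace.exp X - ∑ i ∈ Finset.range 2, ((i.factorial : ℂ)⁻¹) • X ^ i‖
      ≤ NormedSpace.exp ‖X‖ - ∑ i ∈ Finset.range 2, ((i.factorial : ℝ)⁻¹) • ‖X‖ ^ i := by
    refine h1.norm_le_of_bounded h2 fun i => ?_
    rw [norm_smul, smul_eq_mul]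
    have : ‖((i + 2).factorial : ℂ)⁻¹‖ = ((i + 2).factorial : ℝ)⁻¹ := by simp
    rw [this]
    gcongr
    exact norm_pow_le' X (by omega)
  have h4 := (abs_le.mp (Real.abs_exp_sub_one_sub_id_le (x := ‖X‖) (by simpa using hX))).2
  rw [← Real.exp_eq_exp_ℝ] at h3
  simp only [Finset.sum_range_succ, Finset.sum_range_zero, Nat.factorial, Nat.cast_one, inv_one,
    pow_zero, one_smul, pow_one, zero_add, mul_one, one_mul, smul_eq_mul, ← sub_sub] at h3
  exact h3.trans h4

variable {k K : Type*} [Fintype k] [DecidableEq k] [Fintype K] [DecidableEq K]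

theorem norm_mul_le_of_le {k₁ k₂ k₃ : Type*} [Fintype k₁] [DecidableEq k₁] [Fintype k₂]
    [DecidableEq k₂] [Fintype k₃] [DecidableEq k₃] {M : Matrix k₁ k₂ ℂ} {N : Matrix k₂ k₃ ℂ}
    {a b : ℝ} (hM : ‖M‖ ≤ a) (hN : ‖N‖ ≤ b) : ‖M * N‖ ≤ a * b :=
  (l2_opNorm_mul M N).trans (mul_le_mul hM hN (norm_nonneg _) ((norm_nonneg _).trans hM))

theorem norm_pow_le_one {Y : Matrix K K ℂ} (hY : ‖Y‖ ≤ 1) (r : ℕ) : ‖Y ^ r‖ ≤ 1 := by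
  induction r with
  | zero => simpa using norm_one_le
  | succ r ih =>
    rw [pow_succ]
    simpa using norm_mul_le_of_le ih hY

/-- Errors of the steps of a walk add up. -/
theorem norm_pow_mul_sub_mul_pow_le {Y : Matrix K K ℂ} {U : Matrix k k ℂ} {J : Matrix K k ℂ}
    {e : ℝ} (hY : ‖Y‖ ≤ 1) (hU : ‖U‖ ≤ 1) (h : ‖Y * J - J * U‖ ≤ e) (r : ℕ) :
    ‖Y ^ r * J - J * U ^ r‖ ≤ r * e := by
  induction r with
  | zero => simp
  | succ r ih =>
    have : Y ^ (r + 1) * J - J * U ^ (r + 1)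
        = Y ^ r * (Y * J - J * U) + (Y ^ r * J - J * U ^ r) * U := by
      rw [pow_succ, pow_succ]
      simp only [Matrix.mul_sub, Matrix.sub_mul, Matrix.mul_assoc]
      abel
    rw [this]
    refine (norm_add_le _ _).trans ?_
    have h1 := norm_mul_le_of_le (norm_pow_le_one hY r) h
    have h2 := norm_mul_le_of_le ih hU
    push_cast
    linarith

/-- Two reflections alternating with two copies of an operator `g ≈ 1 + i τ κ` act on the reflected
subspace, up to second order, as `1 + 2 i τ Jᴴ κ J`: the part of `κ J` orthogonal to the subspace
cancels. -/
theorem norm_walk_step_sub_le {J : Matrix K k ℂ} (hJ : Jᴴ * J = 1) {g κ R : Matrix K K ℂ}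
    (hR : R = 1 - (2 : ℂ) • (J * Jᴴ)) (hR1 : ‖R‖ ≤ 1) {τ : ℝ} (hτ0 : 0 ≤ τ) (hτ1 : τ ≤ 1)
    (hκ : ‖κ‖ ≤ 1) (hg1 : ‖g‖ ≤ 1) (hg : ‖g - 1 - (Complex.I * τ) • κ‖ ≤ τ ^ 2) :
    ‖g * R * g * R * J - J * (1 + (2 * Complex.I * τ) • (Jᴴ * (κ * J)))‖ ≤ 4 * τ ^ 2 := by
  have hJ1 : ‖J‖ ≤ 1 := norm_le_one_of_isometry hJ
  set E := g - 1 - (Complex.I * τ) • κ with hE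
  have hgJ : g * J = J + (Complex.I * τ) • (κ * J) + E * J := by
    rw [hE]
    simp only [Matrix.sub_mul, Matrix.one_mul, Matrix.smul_mul]
    abel
  have hRJ : R * J = -J := by
    rw [hR, Matrix.sub_mul, Matrix.one_mul, Matrix.smul_mul, Matrix.mul_assoc, hJ, Matrix.mul_one]
    module
  have hRκ : R * (κ * J) = κ * J - (2 : ℂ) • (J * (Jᴴ * (κ * J))) := by
    rw [hR, Matrix.sub_mul, Matrix.one_mul, Matrix.smul_mul, Matrix.mul_assoc]
  have key : g * R * g * R * J - J * (1 + (2 * Complex.I * τ) • (Jᴴ * (κ * J)))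
      = E * J - (Complex.I * τ) • ((g - 1) * (R * (κ * J))) - g * (R * (E * J)) := by
    have e1 : g * R * g * R * J
        = g * J - (Complex.I * τ) • (g * (R * (κ * J))) - g * (R * (E * J)) := by
      simp only [Matrix.mul_assoc]
      rw [hRJ, Matrix.mul_neg, Matrix.mul_neg, Matrix.mul_neg]
      conv_lhs => rw [hgJ]
      simp only [Matrix.mul_add, Matrix.mul_smul, hRJ, Matrix.mul_neg]
      module
    rw [e1, hgJ, Matrix.sub_mul g 1 (R * (κ * J)), Matrix.one_mul, hRκ]
    simp only [Matrix.mul_add, Matrix.mul_smul, Matrix.mul_one]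
    module
  have hEJ : ‖E * J‖ ≤ τ ^ 2 * 1 := norm_mul_le_of_le hg hJ1
  have hRκ1 : ‖R * (κ * J)‖ ≤ 1 * (1 * 1) := norm_mul_le_of_le hR1 (norm_mul_le_of_le hκ hJ1)
  have hc : ‖Complex.I * (τ : ℂ)‖ = τ := by simp [abs_of_nonneg hτ0]
  have hg2 : ‖g - 1‖ ≤ τ ^ 2 + τ * 1 := by
    have : g - 1 = E + (Complex.I * τ) • κ := by rw [hE]; abel
    rw [this]
    refine (norm_add_le _ _).trans (add_le_add hg ?_)
    rw [norm_smul, hc]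
    gcongr
  have h1 := norm_mul_le_of_le hg2 hRκ1
  have h2 := norm_mul_le_of_le hg1 (norm_mul_le_of_le hR1 hEJ)
  have h3 : ‖(Complex.I * (τ : ℂ)) • ((g - 1) * (R * (κ * J)))‖
      ≤ τ * ((τ ^ 2 + τ * 1) * (1 * (1 * 1))) := by
    rw [norm_smul, hc]
    gcongr
  rw [key]
  refine (norm_sub_le _ _).trans
    ((add_le_add ((norm_sub_le _ _).trans (add_le_add hEJ h3)) h2).trans ?_)
  have : τ * τ ^ 2 ≤ 1 * τ ^ 2 := by gcongr
  nlinarith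

theorem exp_I_smul_norm_le_one {A : Matrix k k ℂ} (hA : A.IsHermitian) (s : ℝ) :
    ‖NormedSpace.exp ((Complex.I * s) • A)‖ ≤ 1 := by
  have h : (Complex.I * s) • A ∈ skewAdjoint (Matrix k k ℂ) := by
    rw [skewAdjoint.mem_iff, star_smul, star_eq_conjTranspose, hA.eq]
    simp
  let _ : NormedAlgebra ℚ (Matrix k k ℂ) := NormedAlgebra.restrictScalars ℚ ℂ _
  have := NormedSpace.exp_mem_unitary_of_mem_skewAdjoint h
  exact norm_le_one_of_isometry (Unitary.mem_iff.mp this).1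

/-- If the walk operator encodes `η ^ 2 A` with relative error `3 δ`, then `r` double steps of the
walk simulate the evolution under `A` for the time `2 r τ η ^ 2`. -/
theorem norm_walk_pow_sub_le {J : Matrix K k ℂ} (hJ : Jᴴ * J = 1) {g κ R : Matrix K K ℂ}
    (hR : R = 1 - (2 : ℂ) • (J * Jᴴ)) (hR1 : ‖R‖ ≤ 1) {τ : ℝ} (hτ0 : 0 ≤ τ) (hτ1 : 2 * τ ≤ 1)
    (hκ : ‖κ‖ ≤ 1) (hg1 : ‖g‖ ≤ 1) (hg : ‖g - 1 - (Complex.I * τ) • κ‖ ≤ τ ^ 2)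
    {A : Matrix k k ℂ} (hA : A.IsHermitian) {η δ : ℝ}
    (hAη : ‖((η ^ 2 : ℝ) : ℂ) • A‖ ≤ 1)
    (h : ‖Jᴴ * (κ * J) - ((η ^ 2 : ℝ) : ℂ) • A‖ ≤ 3 * η ^ 2 * δ) (r : ℕ) :
    ‖(g * R * g * R) ^ r * J - J * NormedSpace.exp ((Complex.I * (2 * r * τ * η ^ 2 : ℝ)) • A)‖
      ≤ r * (8 * τ ^ 2 + 6 * τ * η ^ 2 * δ) := by
  have hJ1 : ‖J‖ ≤ 1 := norm_le_one_of_isometry hJ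
  set U := NormedSpace.exp ((Complex.I * (2 * τ * η ^ 2 : ℝ)) • A) with hU
  have hUr : NormedSpace.exp ((Complex.I * (2 * r * τ * η ^ 2 : ℝ)) • A) = U ^ r := by
    rw [hU, ← Matrix.exp_nsmul]
    congr 1
    rw [← Nat.cast_smul_eq_nsmul ℂ, smul_smul]
    congr 1
    push_cast
    ring
  rw [hUr]
  have hY : ‖g * R * g * R‖ ≤ 1 := by
    simpa using norm_mul_le_of_le (norm_mul_le_of_le (norm_mul_le_of_le hg1 hR1) hg1) hR1
  refine norm_pow_mul_sub_mul_pow_le hY (exp_I_smul_norm_le_one hA _) ?_ r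
  have hstep := norm_walk_step_sub_le hJ hR hR1 hτ0 (by linarith) hκ hg1 hg
  set X : Matrix k k ℂ := (Complex.I * (2 * τ * η ^ 2 : ℝ)) • A with hX
  have hXn : ‖X‖ ≤ 2 * τ := by
    have : X = (2 * Complex.I * τ) • (((η ^ 2 : ℝ) : ℂ) • A) := by
      rw [hX, smul_smul]
      congr 1
      push_cast
      ring
    rw [this, norm_smul]
    have hc : ‖2 * Complex.I * (τ : ℂ)‖ = 2 * τ := by simp [abs_of_nonneg hτ0]
    rw [hc]
    nlinarith
  have hexp : ‖U - 1 - X‖ ≤ 4 * τ ^ 2 := by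
    refine (norm_exp_sub_one_sub_le (hXn.trans hτ1)).trans ?_
    nlinarith [norm_nonneg X]
  have hdiff : ‖(2 * Complex.I * τ) • (Jᴴ * (κ * J)) - X‖ ≤ 6 * τ * η ^ 2 * δ := by
    have : (2 * Complex.I * τ) • (Jᴴ * (κ * J)) - X
        = (2 * Complex.I * τ) • (Jᴴ * (κ * J) - ((η ^ 2 : ℝ) : ℂ) • A) := by
      rw [hX, smul_sub, smul_smul]
      congr 2
      push_cast
      ring
    rw [this, norm_smul]
    have hc : ‖2 * Complex.I * (τ : ℂ)‖ = 2 * τ := by simp [abs_of_nonneg hτ0]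
    rw [hc]
    nlinarith
  have hsplit : g * R * g * R * J - J * U
      = (g * R * g * R * J - J * (1 + (2 * Complex.I * τ) • (Jᴴ * (κ * J))))
        + J * ((2 * Complex.I * τ) • (Jᴴ * (κ * J)) - X) - J * (U - 1 - X) := by
    simp only [Matrix.mul_add, Matrix.mul_sub]
    abel
  rw [hsplit]
  have h1 := norm_mul_le_of_le hJ1 hdiff
  have h2 := norm_mul_le_of_le hJ1 hexp
  refine (norm_sub_le _ _).trans
    ((add_le_add ((norm_add_le _ _).trans (add_le_add hstep h1)) h2).trans ?_)
  linarith

end Walk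

/-! ### The walk of a Markov chain -/

section ChainWalk

variable {n m D w : ℕ}

theorem flagProj_conjTranspose : (flagProj n m)ᴴ = flagProj n m := by
  rw [flagProj, diagonal_conjTranspose]
  congr 1
  ext x
  by_cases h : x (.inr .flag) = true <;> simp [h]

theorem flagProj_mul_self : flagProj n m * flagProj n m = flagProj n m := by
  rw [flagProj, diagonal_mul_diagonal]
  congr 1
  ext x
  by_cases h : x (.inr .flag) = true <;> simp [h]

theorem norm_flagProj_le : ‖flagProj n m‖ ≤ 1 := by
  rw [flagProj, l2_opNorm_diagonal]
  refine (pi_norm_le_iff_of_nonneg zero_le_one).mpr fun x => ?_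
  by_cases h : x (.inr .flag) = true <;> simp [h]

/-- Flips the coin. -/
def coinFlip (n m : ℕ) : Matrix (Bits (Reg n m)) (Bits (Reg n m)) ℂ :=
  ucg (.inr .coin) fun _ => flipGate

/-- Maps the coin to an equal superposition. -/
def coinMix (n m : ℕ) : Matrix (Bits (Reg n m)) (Bits (Reg n m)) ℂ :=
  ucg (.inr .coin) fun _ => rot √(1 / 2)

theorem rot_sqrt_half_mem : rot √(1 / 2) ∈ unitaryGroup Bool ℂ :=
  rot_mem (by rw [Real.sq_sqrt] <;> norm_num)

theorem implementable_coinMix : Implementable 1 (coinMix n m) :=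
  implementable_one_qubit _ rot_sqrt_half_mem

theorem implementable_coinFlip : Implementable 1 (coinFlip n m) :=
  implementable_one_qubit _ flipGate_mem

theorem coinFlip_mul_apply {κ : Type*} (N : Matrix (Bits (Reg n m)) κ ℂ) (i j : Bits (Fin n))
    (f c : Bool) (z : Bits (Fin n ⊕ Fin m)) (k : κ) :
    (coinFlip n m * N) (mkReg i j f c z) k = N (mkReg i j f (!c) z) k := by
  rw [coinFlip, ucg_mul_apply]
  simp only [Fintype.sum_bool, update_coin]
  cases c <;> simp [flipGate, mkReg]

theorem flagProj_mul_coinFlip : flagProj n m * coinFlip n m = coinFlip n m * flagProj n m :=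
  diagonal_mul_ucg (fun x b => by simp) _

theorem flagProj_mul_coinMix : flagProj n m * coinMix n m = coinMix n m * flagProj n m :=
  diagonal_mul_ucg (fun x b => by simp) _

theorem flagProj_mul_swapOp : flagProj n m * swapOp n m = swapOp n m * flagProj n m := by
  have h1 : flagProj n m * permOp (fun x v => x v ^^ rowToColMask v x)
      = permOp (fun x v => x v ^^ rowToColMask v x) * flagProj n m :=
    diagonal_mul_permOp fun x => by simp [rowToColMask]
  have h2 : flagProj n m * permOp (fun x v => x v ^^ colToRowMask v x)
      = permOp (fun x v => x v ^^ colToRowMask v x) * flagProj n m :=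
    diagonal_mul_permOp fun x => by simp [colToRowMask]
  rw [swapOp, ← Matrix.mul_assoc, ← Matrix.mul_assoc, h1, Matrix.mul_assoc _ (flagProj n m), h2,
    ← Matrix.mul_assoc, Matrix.mul_assoc _ (flagProj n m), h1]
  simp only [Matrix.mul_assoc]

/-- Puts the coin into superposition and exchanges row and column index in one of the two
branches. -/
def mixSwap (n m : ℕ) : Matrix (Bits (Reg n m)) (Bits (Reg n m)) ℂ := swapOp n m * coinMix n m

theorem implementable_mixSwap : Implementable (7 * n + 1) (mixSwap n m) :=
  implementable_swapOp.mul implementable_coinMix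

theorem flagProj_mul_mixSwap : flagProj n m * mixSwap n m = mixSwap n m * flagProj n m := by
  rw [mixSwap, ← Matrix.mul_assoc, flagProj_mul_swapOp, Matrix.mul_assoc, flagProj_mul_coinMix,
    Matrix.mul_assoc]

theorem mixSwap_mul_rowTarget_apply (η : ℝ) (A : Matrix (Bits (Fin n)) (Bits (Fin n)) ℝ)
    (i j : Bits (Fin n)) (f c : Bool) (z : Bits (Fin n ⊕ Fin m)) (k : Bits (Fin n)) :
    (mixSwap n m * rowTarget m η A) (mkReg i j f c z) k
      = if c then (√(1 / 2) : ℝ) * rowTarget m η A (mkReg j i f false z) k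
        else (√(1 / 2) : ℝ) * rowTarget m η A (mkReg i j f false z) k := by
  have h : ∀ i j, (coinMix n m * rowTarget m η A) (mkReg i j f c z) k
      = (√(1 / 2) : ℝ) * rowTarget m η A (mkReg i j f false z) k := by
    intro i j
    have h2 : √(1 - √(1 / 2) ^ 2) = √(1 / 2) := by
      rw [Real.sq_sqrt (by norm_num)]
      norm_num
    rw [coinMix, ucg_mul_apply]
    simp only [Fintype.sum_bool, update_coin, rowTarget_apply, Bool.true_eq_false, and_false,
      false_and, if_false, mul_zero, zero_add]
    cases c <;> simp only [rot, mkReg, h2]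
  rw [mixSwap, Matrix.mul_assoc, swapOp_mul_apply, h, h]

/-- The symmetric matrix with entries `√(A i j A j i)`. For a reversible Markov chain it is similar
to `A`. -/
def symmetrized {Ω : Type*} (A : Matrix Ω Ω ℝ) : Matrix Ω Ω ℂ :=
  fun i j => ((√(A i j) * √(A j i) : ℝ) : ℂ)

theorem symmetrized_isHermitian {Ω : Type*} (M : Matrix Ω Ω ℝ) : (symmetrized M).IsHermitian := by
  ext i j
  simp [symmetrized, conjTranspose_apply, mul_comm]

/-- Flipping the coin exchanges row and column index, so that the target states encode the
symmetrized matrix. -/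
theorem rowTarget_conjTranspose_mul (η : ℝ) (A : Matrix (Bits (Fin n)) (Bits (Fin n)) ℝ) :
    (rowTarget m η A)ᴴ * ((mixSwap n m)ᴴ * (coinFlip n m * (mixSwap n m * rowTarget m η A)))
      = ((η ^ 2 : ℝ) : ℂ) • symmetrized A := by
  rw [← Matrix.mul_assoc, ← conjTranspose_mul]
  ext k l
  have hs : (√(1 / 2) : ℝ) * √(1 / 2) = 1 / 2 := Real.mul_self_sqrt (by norm_num)
  rw [Matrix.mul_apply, sum_reg]
  have hterm : ∀ (i j : Bits (Fin n)) (f c : Bool) (z : Bits (Fin n ⊕ Fin m)),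
      (mixSwap n m * rowTarget m η A)ᴴ k (mkReg i j f c z) *
        (coinFlip n m * (mixSwap n m * rowTarget m η A)) (mkReg i j f c z) l
      = if c then
          if j = k ∧ i = l ∧ f = true ∧ z = (fun _ => false) then
            ((1 / 2 * (η ^ 2 * (√(A k l) * √(A l k))) : ℝ) : ℂ) else 0
        else if i = k ∧ j = l ∧ f = true ∧ z = (fun _ => false) then
            ((1 / 2 * (η ^ 2 * (√(A k l) * √(A l k))) : ℝ) : ℂ) else 0 := by
    intro i j f c z
    rw [conjTranspose_apply, coinFlip_mul_apply, mixSwap_mul_rowTarget_apply,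
      mixSwap_mul_rowTarget_apply]
    have hprod : ∀ i j : Bits (Fin n),
        star (((√(1 / 2) : ℝ) : ℂ) * rowTarget m η A (mkReg i j f false z) k) *
          ((√(1 / 2) : ℝ) * rowTarget m η A (mkReg j i f false z) l)
        = if i = k ∧ j = l ∧ f = true ∧ z = (fun _ => false) then
            ((1 / 2 * (η ^ 2 * (√(A k l) * √(A l k))) : ℝ) : ℂ) else 0 := by
      intro i j
      rw [rowTarget_apply, rowTarget_apply]
      by_cases h : i = k ∧ j = l ∧ f = true ∧ z = (fun _ => false)
      · obtain ⟨rfl, rfl, rfl, rfl⟩ := h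
        simp only [and_self, if_true, ← Complex.ofReal_mul, Complex.star_def, Complex.conj_ofReal]
        congr 1
        linear_combination (η ^ 2 * √(A i j) * √(A j i)) * hs
      · rw [if_neg h]
        by_cases h1 : i = k ∧ f = true ∧ false = false ∧ z = fun _ => false
        · rw [if_neg (c := j = l ∧ f = true ∧ false = false ∧ z = fun _ => false), mul_zero,
            mul_zero]
          exact fun h2 => h ⟨h1.1, h2.1, h1.2.1, h1.2.2.2⟩
        · rw [if_neg h1, mul_zero, star_zero, zero_mul]
    cases c
    · exact hprod i j
    · exact hprod j i
  simp only [hterm]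
  simp only [Fintype.sum_bool, if_true, Bool.false_eq_true, if_false, false_and, and_false,
    true_and, Finset.sum_const_zero, add_zero, Finset.sum_add_distrib]
  have h1 : ∀ (c : ℂ), (∑ i : Bits (Fin n), ∑ j : Bits (Fin n), ∑ z : Bits (Fin n ⊕ Fin m),
      if i = k ∧ j = l ∧ z = (fun _ => false) then c else 0) = c := by
    intro c
    rw [Finset.sum_eq_single k (fun i _ hi => by simp [hi]) (by simp),
      Finset.sum_eq_single l (fun j _ hj => by simp [hj]) (by simp)]
    simp
  have h2 : ∀ (c : ℂ), (∑ i : Bits (Fin n), ∑ j : Bits (Fin n), ∑ z : Bits (Fin n ⊕ Fin m),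
      if j = k ∧ i = l ∧ z = (fun _ => false) then c else 0) = c := by
    intro c
    rw [Finset.sum_eq_single l (fun i _ hi => by simp [hi]) (by simp),
      Finset.sum_eq_single k (fun j _ hj => by simp [hj]) (by simp)]
    simp
  rw [h1, h2, Matrix.smul_apply, smul_eq_mul, symmetrized]
  push_cast
  ring

variable (out : ListBits D n w → Fin n ⊕ Fin m) (η : ℝ) (L b : ℕ)
  (Q : Matrix (Bits (Fin n ⊕ Fin m)) (Bits (Fin n ⊕ Fin m)) ℂ)
  (A : Matrix (Bits (Fin n)) (Bits (Fin n)) ℝ)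

/-- The preparation of the states whose overlaps are the entries of the symmetrized matrix. -/
def chainPrep : Matrix (Bits (Reg n m)) (Bits (Reg n m)) ℂ :=
  mixSwap n m * rowPrep out η L b Q

/-- The operator whose compression to zero ancillas approximates the symmetrized matrix. -/
def chainCoupling : Matrix (Bits (Reg n m)) (Bits (Reg n m)) ℂ :=
  (chainPrep out η L b Q)ᴴ * (flagProj n m * (coinFlip n m * chainPrep out η L b Q))

variable {out η L b Q A}

/-- Only the part of the preparation with flag set matters, as coin and exchange leave the flag
alone. -/
theorem compression_chainCoupling :
    (zeroExt (Fin n) (Anc n m))ᴴ * (chainCoupling out η L b Q * zeroExt (Fin n) (Anc n m))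
      = (flagProj n m * (rowPrep out η L b Q * zeroExt (Fin n) (Anc n m)))ᴴ *
        ((mixSwap n m)ᴴ * (coinFlip n m * (mixSwap n m *
          (flagProj n m * (rowPrep out η L b Q * zeroExt (Fin n) (Anc n m)))))) := by
  have h1 : flagProj n m * (mixSwap n m)ᴴ = (mixSwap n m)ᴴ * flagProj n m := by
    rw [← flagProj_conjTranspose, ← conjTranspose_mul, ← conjTranspose_mul, flagProj_mul_mixSwap]
  have h2 : ∀ N : Matrix (Bits (Reg n m)) (Bits (Fin n)) ℂ,
      flagProj n m * ((mixSwap n m)ᴴ * (coinFlip n m * (mixSwap n m * (flagProj n m * N))))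
      = (mixSwap n m)ᴴ * (flagProj n m * (coinFlip n m * (mixSwap n m * N))) := by
    intro N
    rw [← Matrix.mul_assoc (mixSwap n m) (flagProj n m), ← flagProj_mul_mixSwap,
      Matrix.mul_assoc (flagProj n m), ← Matrix.mul_assoc (coinFlip n m) (flagProj n m),
      ← flagProj_mul_coinFlip, Matrix.mul_assoc (flagProj n m), ← Matrix.mul_assoc (flagProj n m),
      h1, Matrix.mul_assoc, ← Matrix.mul_assoc (flagProj n m) (flagProj n m), flagProj_mul_self]
  rw [conjTranspose_mul (flagProj n m), flagProj_conjTranspose, Matrix.mul_assoc, h2, chainCoupling,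
    chainPrep]
  simp only [conjTranspose_mul, Matrix.mul_assoc]

theorem norm_coinFlip_le : ‖coinFlip n m‖ ≤ 1 :=
  norm_le_one_of_isometry implementable_coinFlip.conjTranspose_mul_self

theorem norm_mixSwap_le : ‖mixSwap n m‖ ≤ 1 :=
  norm_le_one_of_isometry implementable_mixSwap.conjTranspose_mul_self

theorem norm_mixSwap_conjTranspose_mul_le {s : ℝ} {N : Matrix (Bits (Reg n m)) (Bits (Fin n)) ℂ}
    (h : ‖N‖ ≤ s) : ‖(mixSwap n m)ᴴ * (coinFlip n m * (mixSwap n m * N))‖ ≤ s := by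
  have := norm_mul_le_of_le ((l2_opNorm_conjTranspose (mixSwap n m)).trans_le norm_mixSwap_le)
    (norm_mul_le_of_le norm_coinFlip_le (norm_mul_le_of_le norm_mixSwap_le h))
  simpa using this

/-- The compression of the coupling to zero ancillas is close to `η ^ 2` times the symmetrized
matrix. -/
theorem norm_compression_sub_le {δ : ℝ} (hη : 0 ≤ η) (hδ0 : 0 ≤ δ) (hδ1 : δ ≤ 1)
    (hA : A ∈ rowStochastic ℝ (Bits (Fin n)))
    (h : ‖flagProj n m * (rowPrep out η L b Q * zeroExt (Fin n) (Anc n m)) - rowTarget m η A‖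
      ≤ η * δ) :
    ‖(zeroExt (Fin n) (Anc n m))ᴴ * (chainCoupling out η L b Q * zeroExt (Fin n) (Anc n m))
      - ((η ^ 2 : ℝ) : ℂ) • symmetrized A‖ ≤ 3 * η ^ 2 * δ := by
  rw [compression_chainCoupling, ← rowTarget_conjTranspose_mul (m := m)]
  set X := flagProj n m * (rowPrep out η L b Q * zeroExt (Fin n) (Anc n m))
  set T := rowTarget m η A
  have hT : ‖T‖ ≤ η := norm_rowTarget_le η A hη hA
  have hX : ‖X‖ ≤ η + η * δ := by
    have : X = T + (X - T) := by abel
    rw [this]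
    exact (norm_add_le _ _).trans (add_le_add hT h)
  have hsplit : Xᴴ * ((mixSwap n m)ᴴ * (coinFlip n m * (mixSwap n m * X)))
      - Tᴴ * ((mixSwap n m)ᴴ * (coinFlip n m * (mixSwap n m * T)))
      = Xᴴ * ((mixSwap n m)ᴴ * (coinFlip n m * (mixSwap n m * (X - T))))
        + (X - T)ᴴ * ((mixSwap n m)ᴴ * (coinFlip n m * (mixSwap n m * T))) := by
    simp only [conjTranspose_sub, Matrix.mul_sub, Matrix.sub_mul]
    abel
  rw [hsplit]
  have h1 := norm_mul_le_of_le ((l2_opNorm_conjTranspose X).trans_le hX)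
    (norm_mixSwap_conjTranspose_mul_le h)
  have h2 := norm_mul_le_of_le ((l2_opNorm_conjTranspose (X - T)).trans_le h)
    (norm_mixSwap_conjTranspose_mul_le hT)
  refine (norm_add_le _ _).trans ((add_le_add h1 h2).trans ?_)
  nlinarith [mul_nonneg (sq_nonneg η) hδ0,
    mul_le_mul_of_nonneg_left hδ1 (mul_nonneg (sq_nonneg η) hδ0)]

theorem norm_symmetrized_le (hη : 0 ≤ η) (hA : A ∈ rowStochastic ℝ (Bits (Fin n))) :
    ‖((η ^ 2 : ℝ) : ℂ) • symmetrized A‖ ≤ η ^ 2 := by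
  rw [← rowTarget_conjTranspose_mul (m := 0)]
  have hT : ‖rowTarget 0 η A‖ ≤ η := norm_rowTarget_le η A hη hA
  have := norm_mul_le_of_le ((l2_opNorm_conjTranspose (rowTarget 0 η A)).trans_le hT)
    (norm_mixSwap_conjTranspose_mul_le hT)
  rwa [← sq] at this

/-! ### The gates of the walk -/

/-- The rotation `exp (i τ X)`. -/
def phaseGate (τ : ℝ) : Matrix Bool Bool ℂ := fun a b =>
  if a = b then (Real.cos τ : ℂ) else Complex.I * (Real.sin τ : ℂ)

theorem phaseGate_mem (τ : ℝ) : phaseGate τ ∈ unitaryGroup Bool ℂ := by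
  have h : (Real.cos τ : ℂ) * Real.cos τ + (Real.sin τ : ℂ) * Real.sin τ = 1 := by
    have := Real.cos_sq_add_sin_sq τ
    rw [sq, sq] at this
    exact_mod_cast this
  rw [mem_unitaryGroup_iff]
  ext a b
  cases a <;> cases b <;>
    simp [Matrix.mul_apply, phaseGate, Matrix.star_apply, -Complex.ofReal_cos, -Complex.ofReal_sin]
  all_goals first | linear_combination h - (Real.sin τ : ℂ) ^ 2 * Complex.I_mul_I | ring

theorem eq_iff_agree_off {V : Type} (t : V) (x y : Bits V) :
    x = y ↔ (∀ v, v ≠ t → x v = y v) ∧ x t = y t := by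
  constructor
  · rintro rfl
    simp
  · rintro ⟨h1, h2⟩
    ext v
    by_cases hv : v = t
    · rw [hv, h2]
    · rw [h1 v hv]

/-- The operator `exp (i τ F X)`, where `F` projects onto the states with flag set and `X` flips the
coin. -/
def couplingGate (n m : ℕ) (τ : ℝ) : Matrix (Bits (Reg n m)) (Bits (Reg n m)) ℂ :=
  ucg (.inr .coin) fun x => if x (.inr .flag) then phaseGate τ else 1

theorem implementable_couplingGate (τ : ℝ) : Implementable 1 (couplingGate n m τ) :=
  implementable_two_qubit (by simp) (fun c => if c then phaseGate τ else 1) fun c => by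
    split_ifs
    exacts [phaseGate_mem τ, one_mem _]

theorem couplingGate_eq (τ : ℝ) : couplingGate n m τ - 1 - (Complex.I * τ) •
    (flagProj n m * coinFlip n m)
      = ((Real.cos τ - 1 : ℝ) : ℂ) • flagProj n m
        + (Complex.I * (Real.sin τ - τ : ℝ)) • (flagProj n m * coinFlip n m) := by
  rw [sub_sub, sub_eq_iff_eq_add]
  ext x y
  simp only [Matrix.add_apply, Matrix.smul_apply, smul_eq_mul]
  rw [flagProj, diagonal_mul, ← flagProj, couplingGate, coinFlip, ucg, ucg, Matrix.one_apply,
    flagProj, diagonal_apply]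
  have hxy := eq_iff_agree_off (.inr .coin) x y
  by_cases h1 : ∀ v, v ≠ .inr .coin → x v = y v
  · have hxy' : x = y ↔ x (.inr .coin) = y (.inr .coin) := hxy.trans (and_iff_right h1)
    simp only [hxy', if_pos h1]
    by_cases h2 : x (.inr .coin) = y (.inr .coin) <;> by_cases h3 : x (.inr .flag) = true <;>
      simp [h2, h3, phaseGate, flipGate, Matrix.one_apply]
    ring
  · have hxy' : ¬ x = y := fun h => h1 (hxy.mp h).1
    simp only [hxy', if_neg h1, if_false, mul_zero, add_zero]

theorem norm_couplingGate_sub_le {τ : ℝ} (hτ0 : 0 ≤ τ) (hτ1 : τ ≤ 1) :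
    ‖couplingGate n m τ - 1 - (Complex.I * τ) • (flagProj n m * coinFlip n m)‖ ≤ τ ^ 2 := by
  rw [couplingGate_eq]
  have h1 : |Real.cos τ - 1| ≤ τ ^ 2 / 2 := by
    rw [abs_le]
    constructor <;>
      linarith [Real.cos_le_one τ, Real.one_sub_sq_div_two_le_cos (x := τ), sq_nonneg τ]
  have h2 : |Real.sin τ - τ| ≤ τ ^ 2 / 2 := by
    have h3 : τ - τ ^ 3 / 6 ≤ Real.sin τ := by
      rcases hτ0.eq_or_lt with rfl | h
      · simp
      · exact (Real.sin_gt_sub_cube h).le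
    rw [abs_le]
    constructor <;> nlinarith [Real.sin_le hτ0, sq_nonneg τ, pow_le_pow_left₀ hτ0 hτ1 2]
  refine (norm_add_le _ _).trans ?_
  rw [norm_smul, norm_smul, norm_mul, Complex.norm_I, one_mul, Complex.norm_real, Complex.norm_real,
    Real.norm_eq_abs, Real.norm_eq_abs]
  have h4 : ‖flagProj n m * coinFlip n m‖ ≤ 1 * 1 :=
    norm_mul_le_of_le norm_flagProj_le norm_coinFlip_le
  nlinarith [norm_flagProj_le (n := n) (m := m), abs_nonneg (Real.cos τ - 1),
    abs_nonneg (Real.sin τ - τ), norm_nonneg (flagProj n m),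
    norm_nonneg (flagProj n m * coinFlip n m)]

/-- The phase `-1` on `|0⟩`. -/
def signGate : Matrix Bool Bool ℂ := diagonal fun b => if b then 1 else -1

theorem signGate_mem : signGate ∈ unitaryGroup Bool ℂ := by
  rw [mem_unitaryGroup_iff]
  ext a b
  cases a <;> cases b <;> simp [signGate, Matrix.mul_apply, Matrix.star_apply]

/-- The ancillas other than the coin are zero. -/
def ancLiterals (n m : ℕ) : List (Reg n m × Bool) :=
  ((Finset.univ.erase Anc.coin).toList).map fun a => (.inr a, false)

/-- The reflection about the states with all ancillas zero. -/
theorem ctrl_ancLiterals : ctrl (.inr .coin) (literalsHold (ancLiterals n m)) signGate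
    = 1 - (2 : ℂ) • (zeroExt (Fin n) (Anc n m) * (zeroExt (Fin n) (Anc n m))ᴴ) := by
  ext x y
  have hlit : literalsHold (ancLiterals n m) x = true ↔
      ∀ a, a ≠ Anc.coin → x (.inr a) = false := by
    simp [literalsHold, ancLiterals]
  have hxy := eq_iff_agree_off (.inr .coin) x y
  have hz : (∀ a : Anc n m, x (.inr a) = false) ↔
      literalsHold (ancLiterals n m) x = true ∧ x (.inr .coin) = false := by
    rw [hlit]
    refine ⟨fun h => ⟨fun a _ => h a, h _⟩, fun h a => ?_⟩
    by_cases ha : a = .coin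
    · rw [ha, h.2]
    · exact h.1 a ha
  have hy : (∀ a : Anc n m, x (.inr a) = false) →
      (y = Sum.elim (x ∘ Sum.inl) (fun _ => false) ↔ x = y) := by
    intro h
    have : x = Sum.elim (x ∘ Sum.inl) (fun _ => false) := by
      ext (v | v)
      · rfl
      · exact h v
    rw [← this]
    exact eq_comm
  rw [Matrix.sub_apply, Matrix.smul_apply, zeroExt_mul_apply, conjTranspose_apply, zeroExt,
    Matrix.one_apply, ctrl, ucg, smul_eq_mul]
  by_cases h1 : ∀ v, v ≠ .inr .coin → x v = y v
  · have hxy' : x = y ↔ x (.inr .coin) = y (.inr .coin) := hxy.trans (and_iff_right h1)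
    rw [if_pos h1]
    by_cases h0 : ∀ a : Anc n m, x (.inr a) = false
    · simp only [if_pos h0, hy h0, (hz.mp h0).1, if_true, signGate, diagonal_apply, (hz.mp h0).2,
        hxy']
      by_cases h2 : false = y (.inr .coin)
      · simp only [← h2, if_true, Bool.false_eq_true, if_false, star_one]
        norm_num
      · simp [h2]
    · simp only [if_neg h0, mul_zero, sub_zero, hxy']
      by_cases h2 : literalsHold (ancLiterals n m) x = true
      · have h3 : x (.inr .coin) = true := by
          by_contra h
          exact h0 (hz.mpr ⟨h2, by simpa using h⟩)
        simp only [h2, if_true, signGate, h3, diagonal_apply]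
      · simp only [h2, Bool.false_eq_true, if_false, Matrix.one_apply]
  · have hxy' : ¬ x = y := fun h => h1 (hxy.mp h).1
    rw [if_neg h1]
    by_cases h0 : ∀ a : Anc n m, x (.inr a) = false
    · simp [hy h0, hxy']
    · simp [if_neg h0, hxy']

theorem implementable_reflection : Implementable (11 * (2 * n + m + 2) + 1)
    (1 - (2 : ℂ) • (zeroExt (Fin n) (Anc n m) * (zeroExt (Fin n) (Anc n m))ᴴ)) := by
  rw [← ctrl_ancLiterals]
  refine (implementable_ctrl_literals _ (ancLiterals n m) rfl _ ?_ _ signGate_mem).mono ?_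
  · simp [ancLiterals]
  · have h : (ancLiterals n m).length ≤ 2 * n + m + 2 := by
      rw [ancLiterals, List.length_map, Finset.length_toList, ← card_anc]
      exact Finset.card_le_univ _
    omega

end ChainWalk

/-! ### Simulation of one chain -/

section Simulation

variable {n D w : ℕ}

open Classical in
theorem Program.sum_bad_le {I O : Type} [Fintype I] [DecidableEq I] (P : Program I O) (i : Bits I)
    {good : Bits O → Prop} {ε : ℝ} (h : 1 - ε ≤ P.prob i good) :
    ∑ z : Bits (I ⊕ Fin P.ancillas), (if good (fun o => z (P.out o)) then 0 else
      ‖P.circuit.toMatrix z (Sum.elim i fun _ => false)‖ ^ 2) ≤ ε := by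
  have h1 : ∑ z, ‖P.circuit.toMatrix z (Sum.elim i fun _ => false)‖ ^ 2 = 1 := by
    have := sum_norm_sq_eq P.circuit.toMatrix (Sum.elim i fun _ => false)
    rw [P.circuit.conjTranspose_mul_self, Matrix.one_apply_eq] at this
    exact_mod_cast this
  have h2 : ∑ z : Bits (I ⊕ Fin P.ancillas), (if good (fun o => z (P.out o)) then 0 else
      ‖P.circuit.toMatrix z (Sum.elim i fun _ => false)‖ ^ 2) + P.prob i good = 1 := by
    rw [← h1, Program.prob, ← Finset.sum_add_distrib]
    refine Finset.sum_congr rfl fun z _ => ?_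
    split_ifs <;> simp
  linarith

/-- A program that lists a row with positive probability bounds the number of its nonzero
entries. -/
theorem card_support_le_of_prob_pos {b : ℕ} {P : Program (Fin n) (ListBits D n w)} {ε : ℝ}
    {r : Bits (Fin n) → ℝ} {i : Bits (Fin n)} (h : 0 < P.prob i (ListsRow b r ε)) :
    (Finset.univ.filter fun j => r j ≠ 0).card ≤ D := by
  obtain ⟨y, hy⟩ : ∃ y, ListsRow b r ε (D := D) (w := w) y := by
    by_contra hne
    push Not at hne
    simp [Program.prob, hne] at h
  have hsub : (Finset.univ.filter fun j => r j ≠ 0) ⊆ Finset.univ.image (slotIndex y) := by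
    intro j hj
    obtain ⟨s, -, hs⟩ := (hy.2.1 j).mp (by simpa using hj)
    exact Finset.mem_image.mpr ⟨s, Finset.mem_univ s, hs⟩
  exact (Finset.card_le_card hsub).trans (Finset.card_image_le.trans (by simp))

/-- The output of a program fits into its qubits. -/
theorem Program.card_out_le (P : Program (Fin n) (ListBits D n w)) :
    D * (1 + n + w) ≤ n + P.ancillas := by
  have := Fintype.card_le_of_embedding P.out
  simp only [Fintype.card_prod, Fintype.card_sum, Fintype.card_fin, Fintype.card_unit] at this
  rwa [← add_assoc] at this

variable {m : ℕ} {out : ListBits D n w → Fin n ⊕ Fin m} {η : ℝ} {L b : ℕ}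
  {Q : Matrix (Bits (Fin n ⊕ Fin m)) (Bits (Fin n ⊕ Fin m)) ℂ} {s : ℕ}

theorem implementable_chainPrep (hη0 : 0 ≤ η) (hη1 : η ≤ 1) (hL : 0 < L) (hQ : Implementable s Q) :
    Implementable (9 * n + 2 * s + 1 + D * (10 * n + L * ((w + 1) * (11 * (n + 1 + w) + 1))))
      (chainPrep out η L b Q) := by
  have hQ' := hQ.lift (workEmb (n := n) (m := m))
  exact (implementable_mixSwap.mul (implementable_copyOp.mul (hQ'.conjTranspose.mul
    ((implementable_prepOp out hη0 hη1 hL D le_rfl).mul (hQ'.mul implementable_copyOp))))).mono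
    (by omega)

/-- The walk simulates the evolution under the symmetrized matrix. -/
theorem exists_implementable_walk (hη0 : 0 ≤ η) (hη1 : η ≤ 1) (hL : 0 < L)
    (hQ : Implementable s Q) {A : Matrix (Bits (Fin n)) (Bits (Fin n)) ℝ}
    (hA : A ∈ rowStochastic ℝ (Bits (Fin n))) {δ : ℝ} (hδ0 : 0 ≤ δ) (hδ1 : δ ≤ 1)
    (h : ‖flagProj n m * (rowPrep out η L b Q * zeroExt (Fin n) (Anc n m)) - rowTarget m η A‖
      ≤ η * δ) {τ : ℝ} (hτ0 : 0 ≤ τ) (hτ1 : 2 * τ ≤ 1) (r : ℕ) :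
    ∃ Y : Matrix (Bits (Reg n m)) (Bits (Reg n m)) ℂ,
      Implementable (r * (2 * (2 * (9 * n + 2 * s + 1 +
        D * (10 * n + L * ((w + 1) * (11 * (n + 1 + w) + 1)))) + 1 +
        (11 * (2 * n + m + 2) + 1)))) Y ∧
      ‖Y * zeroExt (Fin n) (Anc n m) - zeroExt (Fin n) (Anc n m) *
        NormedSpace.exp ((Complex.I * (2 * r * τ * η ^ 2 : ℝ)) • symmetrized A)‖
        ≤ r * (8 * τ ^ 2 + 6 * τ * η ^ 2 * δ) := by
  have hV := implementable_chainPrep (out := out) (b := b) hη0 hη1 hL hQ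
  have hg := hV.conjTranspose.mul ((implementable_couplingGate (n := n) (m := m) τ).mul hV)
  have hR := implementable_reflection (n := n) (m := m)
  have hVV := hV.conjTranspose_mul_self
  have hV1 := norm_le_one_of_isometry hVV
  have hV1' := (l2_opNorm_conjTranspose (chainPrep out η L b Q)).trans_le hV1
  refine ⟨_, ((((hg.mul hR).mul hg).mul hR).pow r).mono (Nat.mul_le_mul_left r (by omega)), ?_⟩
  refine norm_walk_pow_sub_le (κ := chainCoupling out η L b Q) zeroExt_conjTranspose_mul_self rfl
    (norm_le_one_of_isometry hR.conjTranspose_mul_self) hτ0 hτ1 ?_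
    (norm_le_one_of_isometry hg.conjTranspose_mul_self) ?_ ?_ ?_
    (norm_compression_sub_le hη0 hδ0 hδ1 hA h) r
  · simpa [chainCoupling] using norm_mul_le_of_le hV1' (norm_mul_le_of_le norm_flagProj_le
      (norm_mul_le_of_le norm_coinFlip_le hV1))
  · have : (chainPrep out η L b Q)ᴴ * (couplingGate n m τ * chainPrep out η L b Q) - 1
        - (Complex.I * τ) • chainCoupling out η L b Q
        = (chainPrep out η L b Q)ᴴ * ((couplingGate n m τ - 1 - (Complex.I * τ) •
          (flagProj n m * coinFlip n m)) * chainPrep out η L b Q) := by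
      simp only [Matrix.sub_mul, Matrix.mul_sub, Matrix.one_mul, hVV, Matrix.smul_mul,
        Matrix.mul_smul, chainCoupling, Matrix.mul_assoc]
    rw [this]
    simpa using norm_mul_le_of_le hV1' (norm_mul_le_of_le
      (norm_couplingGate_sub_le hτ0 (by linarith : τ ≤ 1)) hV1)
  · exact symmetrized_isHermitian A
  · exact (norm_symmetrized_le hη0 hA).trans (by nlinarith)

end Simulation

/-! ### Circuits approximating an evolution -/

section Approximation

theorem norm_toLp_comp_equiv {k l : Type*} [Fintype k] [Fintype l] (e : k ≃ l) (v : l → ℂ) :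
    ‖WithLp.toLp 2 (v ∘ e)‖ = ‖WithLp.toLp 2 v‖ := by
  rw [EuclideanSpace.norm_eq, EuclideanSpace.norm_eq]
  congr 1
  exact e.sum_comp fun x => ‖v x‖ ^ 2

theorem withAncillas_eq_mulVec {W : Type} [Fintype W] [DecidableEq W] (a : ℕ) (ψ : Bits W → ℂ) :
    withAncillas a ψ = zeroExt W (Fin a) *ᵥ ψ := by
  ext z
  have h : (zeroExt W (Fin a) *ᵥ ψ) z = _ :=
    zeroExt_mul_apply (A := Fin a) (Matrix.of fun x (_ : Unit) => ψ x) z ()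
  rw [h, withAncillas]
  by_cases hz : ∀ k, z (.inr k) = false
  · rw [if_pos hz, if_pos hz]
    rfl
  · rw [if_neg hz, if_neg hz]

/-- An implementation on a register with further ancillas yields a circuit. -/
theorem exists_circuit_of_implementable {n s : ℕ} {A : Type} [Fintype A] [DecidableEq A]
    {Y : Matrix (Bits (Fin n ⊕ A)) (Bits (Fin n ⊕ A)) ℂ}
    {E : Matrix (Bits (Fin n)) (Bits (Fin n)) ℂ}
    {α : ℝ} (hY : Implementable s Y)
    (h : ‖Y * zeroExt (Fin n) A - zeroExt (Fin n) A * E‖ ≤ α) :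
    ∃ (a : ℕ) (C : Circuit (Fin n ⊕ Fin a)), C.size ≤ n + Fintype.card A + s ∧
      Approximates C E α := by
  obtain ⟨b, C, hC, hb⟩ := hY
  let σ : (Fin n ⊕ A) ⊕ Fin b ≃ Fin n ⊕ Fin (Fintype.card (A ⊕ Fin b)) :=
    (Equiv.sumAssoc (Fin n) A (Fin b)).trans
      (Equiv.sumCongr (Equiv.refl _) (Fintype.equivFin (A ⊕ Fin b)))
  refine ⟨_, C.lift σ.toEmbedding, ?_, fun ψ => ?_⟩
  · simp only [Circuit.size, Circuit.lift, List.length_map, Fintype.card_sum, Fintype.card_fin]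
    omega
  have key : (C.lift σ.toEmbedding).toMatrix * zeroExt (Fin n) (Fin (Fintype.card (A ⊕ Fin b)))
      - zeroExt (Fin n) (Fin (Fintype.card (A ⊕ Fin b))) * E
      = (zeroExt (Fin n ⊕ A) (Fin b) * (Y * zeroExt (Fin n) A - zeroExt (Fin n) A * E)).submatrix
          (Equiv.arrowCongr σ.symm (Equiv.refl Bool)) id := by
    have h1 : (C.lift σ.toEmbedding).toMatrix * zeroExt (Fin n) (Fin (Fintype.card (A ⊕ Fin b)))
        = (C.toMatrix * (zeroExt (Fin n ⊕ A) (Fin b) * zeroExt (Fin n) A)).submatrix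
          (Equiv.arrowCongr σ.symm (Equiv.refl Bool)) id := by
      ext z x
      rw [submatrix_apply, Circuit.lift_toMatrix, ← Matrix.mul_assoc, mul_zeroExt_apply,
        mul_zeroExt_apply, mul_zeroExt_apply, lift, if_pos]
      · congr 1
        ext v
        rcases v with (v | v) | v <;> simp [σ]
      · intro v hv
        exact absurd ⟨σ.symm v, by simp⟩ hv
    have h2 : zeroExt (Fin n) (Fin (Fintype.card (A ⊕ Fin b))) * E
        = (zeroExt (Fin n ⊕ A) (Fin b) * (zeroExt (Fin n) A * E)).submatrix
          (Equiv.arrowCongr σ.symm (Equiv.refl Bool)) id := by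
      ext z x
      have e0 := ((Fintype.equivFin (A ⊕ Fin b)).forall_congr_right
        (q := fun a => z (.inr a) = false)).symm.trans Sum.forall
      rw [submatrix_apply, zeroExt_mul_apply, zeroExt_mul_apply, zeroExt_mul_apply]
      have e1 : ∀ v, Equiv.arrowCongr σ.symm (Equiv.refl Bool) z v = z (σ v) := fun _ => rfl
      have e2 : ∀ v, σ (.inl (.inr v)) = .inr (Fintype.equivFin (A ⊕ Fin b) (.inl v)) :=
        fun _ => rfl
      have e3 : ∀ v, σ (.inr v) = .inr (Fintype.equivFin (A ⊕ Fin b) (.inr v)) := fun _ => rfl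
      simp only [e1, e3, Function.comp_apply, e2]
      by_cases h1 : ∀ v, z (.inr (Fintype.equivFin (A ⊕ Fin b) (.inl v))) = false <;>
        by_cases h2 : ∀ v, z (.inr (Fintype.equivFin (A ⊕ Fin b) (.inr v))) = false
      · rw [if_pos (e0.mpr ⟨h1, h2⟩), if_pos h2, if_pos h1]
        rfl
      · rw [if_neg fun h => h2 (e0.mp h).2, if_neg h2]
      · rw [if_neg fun h => h1 (e0.mp h).1, if_pos h2, if_neg h1]
      · rw [if_neg fun h => h1 (e0.mp h).1, if_neg h2]
    rw [h1, h2, ← Matrix.mul_assoc, hb, Matrix.mul_assoc, Matrix.mul_sub]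
    rfl
  rw [withAncillas_eq_mulVec, withAncillas_eq_mulVec, mulVec_mulVec, mulVec_mulVec, ← sub_mulVec,
    key]
  have h3 := norm_toLp_comp_equiv (Equiv.arrowCongr σ.symm (Equiv.refl Bool))
    ((zeroExt (Fin n ⊕ A) (Fin b) * (Y * zeroExt (Fin n) A - zeroExt (Fin n) A * E)) *ᵥ ψ)
  refine (le_of_eq h3).trans ?_
  have h4 : ‖zeroExt (Fin n ⊕ A) (Fin b) *
      (Y * zeroExt (Fin n) A - zeroExt (Fin n) A * E)‖ ≤ α := by
    simpa using norm_mul_le_of_le (norm_le_one_of_isometry zeroExt_conjTranspose_mul_self) h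
  exact (l2_opNorm_mulVec _ (WithLp.toLp 2 ψ)).trans
    (mul_le_mul_of_nonneg_right h4 (norm_nonneg _))

end Approximation

/-! ### The Hamiltonian of a reversible chain -/

section Hamiltonian

variable {Ω : Type*} [Fintype Ω] [DecidableEq Ω]

/-- Detailed balance: `√(π i) M i j / √(π j)` is the geometric mean of `M i j` and `M j i`. -/
theorem chainHamiltonian_eq {M : Matrix Ω Ω ℝ} {π : Ω → ℝ} (h : IsReversible M π) :
    chainHamiltonian M π = 1 - symmetrized M := by
  ext i j
  rw [chainHamiltonian, map_apply, Matrix.sub_apply, mul_diagonal, diagonal_mul, Matrix.sub_apply,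
    symmetrized, Complex.ofReal_sub]
  congr 1
  · by_cases hij : i = j <;> simp [Matrix.one_apply, hij]
  · congr 1
    have h0 : ∀ i j, 0 ≤ M i j := fun i j => nonneg_of_mem_rowStochastic h.stochastic
    have hj := Real.sqrt_pos.mpr (h.pos j)
    rw [mul_one_div, div_eq_iff hj.ne', mul_assoc, ← Real.sqrt_mul (h0 j i),
      ← h.detailed_balance i j,
      Real.sqrt_mul (h0 i j)]
    have := Real.mul_self_sqrt (h0 i j)
    linear_combination -√(π i) * this

theorem exp_smul_one_sub (S : Matrix Ω Ω ℂ) (t : ℝ) :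
    NormedSpace.exp ((-Complex.I * (t : ℂ)) • (1 - S))
      = Complex.exp (-Complex.I * t) • NormedSpace.exp ((Complex.I * t) • S) := by
  have h1 : (-Complex.I * (t : ℂ)) • (1 - S)
      = algebraMap ℂ (Matrix Ω Ω ℂ) (-Complex.I * t) + (Complex.I * t) • S := by
    rw [Algebra.algebraMap_eq_smul_one]
    module
  rw [h1, Matrix.exp_add_of_commute _ _ (Algebra.commute_algebraMap_left _ _),
    ← NormedSpace.algebraMap_exp_comm,
    ← Algebra.smul_def, Complex.exp_eq_exp_ℂ]

end Hamiltonian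

/-! ### Choice of the parameters -/

section Parameters

/-- The accuracy of the state preparation: with `η = 1 / (3 d k)`, precision `1 / (18 d² k²)` of the
rotations and error `1 / (72 d² k⁴)` of the program, its relative error is at most `1 / k`. -/
theorem prep_error_le {d k : ℝ} (hd : 1 ≤ d) (hk : 1 ≤ k) :
    d * (1 / (3 * d * k) * (√(1 / (18 * d ^ 2 * k ^ 2) + 1 / (72 * d ^ 2 * k ^ 4))
      + (1 / (3 * d * k)) ^ 2 * d)) ^ 2 + 4 * (1 / (72 * d ^ 2 * k ^ 4))
      ≤ (1 / (3 * d * k) * (1 / k)) ^ 2 := by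
  have hd0 : 0 < d := by linarith
  have hk0 : 0 < k := by linarith
  have h1 : √(1 / (18 * d ^ 2 * k ^ 2) + 1 / (72 * d ^ 2 * k ^ 4)) ≤ 1 / (3 * d * k) := by
    apply Real.sqrt_le_iff.mpr
    refine ⟨by positivity, ?_⟩
    have : (1 / (3 * d * k)) ^ 2 - (1 / (18 * d ^ 2 * k ^ 2) + 1 / (72 * d ^ 2 * k ^ 4))
        = (4 * k ^ 2 - 1) / (72 * d ^ 2 * k ^ 4) := by
      field_simp
      ring
    have h2 : 0 ≤ (4 * k ^ 2 - 1) / (72 * d ^ 2 * k ^ 4) := by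
      apply div_nonneg _ (by positivity)
      nlinarith
    linarith
  have h2 : (1 / (3 * d * k)) ^ 2 * d ≤ 1 / (9 * d * k) := by
    have : (1 / (3 * d * k)) ^ 2 * d = 1 / (9 * d * k) * (1 / k) := by
      field_simp
      norm_num
    rw [this]
    exact mul_le_of_le_one_right (by positivity) (div_le_one_of_le₀ hk hk0.le)
  calc _ ≤ d * (1 / (3 * d * k) * (1 / (3 * d * k) + 1 / (9 * d * k))) ^ 2
        + 4 * (1 / (72 * d ^ 2 * k ^ 4)) := by gcongr
    _ = (16 / (81 * d) + 1 / 2) * (1 / (3 * d * k) * (1 / k)) ^ 2 := by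
        field_simp
        ring
    _ ≤ 1 * (1 / (3 * d * k) * (1 / k)) ^ 2 := by
        gcongr
        have : 16 / (81 * d) ≤ 16 / 81 := by
          apply div_le_div_of_nonneg_left <;> nlinarith
        linarith
    _ = _ := one_mul _

/-- The total error of the walk, for `N ≥ max t (1 / α)`. -/
theorem walk_error_le {t α N G : ℝ} (ht : 0 < t) (hα : 0 < α) (hN1 : 1 ≤ N) (htN : t ≤ N)
    (hαN : 1 / α ≤ N) (hG : 1 ≤ G) :
    2 * (4 * N ^ 3 * G ^ 4) * (t / (8 * N ^ 3 * G ^ 2)) * (1 / G) ^ 2 = t ∧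
    2 * (t / (8 * N ^ 3 * G ^ 2)) ≤ 1 ∧
    4 * N ^ 3 * G ^ 4 * (8 * (t / (8 * N ^ 3 * G ^ 2)) ^ 2 +
      6 * (t / (8 * N ^ 3 * G ^ 2)) * (1 / G) ^ 2 * (1 / (6 * N ^ 2))) ≤ α := by
  have hN0 : 0 < N := by linarith
  have hG0 : 0 < G := by linarith
  refine ⟨by field_simp; norm_num, ?_, ?_⟩
  · rw [← mul_div_assoc, div_le_one (by positivity)]
    have h1 : 1 ≤ N ^ 2 := one_le_pow₀ hN1
    have h2 : 1 ≤ G ^ 2 := one_le_pow₀ hG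
    have h3 : N * 1 * 1 ≤ N * N ^ 2 * G ^ 2 := by gcongr
    have h4 : 0 < N ^ 3 * G ^ 2 := by positivity
    nlinarith
  · have e : 4 * N ^ 3 * G ^ 4 * (8 * (t / (8 * N ^ 3 * G ^ 2)) ^ 2 +
        6 * (t / (8 * N ^ 3 * G ^ 2)) * (1 / G) ^ 2 * (1 / (6 * N ^ 2)))
        = (t / N) ^ 2 * (1 / (2 * N)) + t / N * (1 / (2 * N)) := by
      field_simp
      ring
    have h1 : t / N ≤ 1 := div_le_one_of_le₀ htN hN0.le
    have h2 : 0 ≤ t / N := by positivity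
    have h3 : 1 / N ≤ α := by
      rw [div_le_iff₀ hN0]
      rw [div_le_iff₀ hα] at hαN
      linarith
    have h4 : 1 / (2 * N) = 1 / N / 2 := by field_simp
    have h5 : 0 < 1 / N := by positivity
    rw [e, h4]
    nlinarith [mul_nonneg h2 h5.le, mul_le_mul_of_nonneg_right h1 h5.le,
      mul_le_mul_of_nonneg_right (pow_le_one₀ (n := 2) h2 h1) h5.le]

/-- A bound for the size of the simulating circuit, in terms of the size `S` of the program, of the
precision `L` of the rotations and of the number `r` of steps. -/
def simulationCost (S L r : ℕ) : ℕ := 4 * S + 4 + r * (150 * S + 4 * (L * (S * (11 * S + 1))) + 52)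

theorem simulationCost_mono {S S' : ℕ} (h : S ≤ S') (L r : ℕ) :
    simulationCost S L r ≤ simulationCost S' L r := by
  unfold simulationCost
  gcongr

theorem prep_cost_le {D n w S : ℕ} (h : D * (1 + n + w) ≤ S) (L : ℕ) :
    D * (10 * n + L * ((w + 1) * (11 * (n + 1 + w) + 1))) ≤ 10 * S + L * (S * (11 * S + 1)) := by
  rcases Nat.eq_zero_or_pos D with rfl | hD
  · simp
  have h1 : D * n ≤ S := (Nat.mul_le_mul_left D (by omega)).trans h
  have h2 : D * (w + 1) ≤ S := (Nat.mul_le_mul_left D (by omega)).trans h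
  have h3 : n + 1 + w ≤ S := by
    have := Nat.le_mul_of_pos_left (1 + n + w) hD
    omega
  calc D * (10 * n + L * ((w + 1) * (11 * (n + 1 + w) + 1)))
      = 10 * (D * n) + L * (D * (w + 1) * (11 * (n + 1 + w) + 1)) := by ring
    _ ≤ _ := by gcongr

/-- The simulation of a reversible chain whose rows have at most `d` nonzero entries, given a
program for its rows with error `1 / (72 d² k⁴)`, where `k = 6 N²`. -/
theorem exists_circuit_chainHamiltonian {n d N : ℕ} {M : Matrix (Bits (Fin n)) (Bits (Fin n)) ℝ}
    {π : Bits (Fin n) → ℝ} (hM : IsReversible M π) (hd1 : 1 ≤ d)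
    (hd : ∀ i, (Finset.univ.filter fun j => M i j ≠ 0).card ≤ d) {t α : ℝ} (ht : 0 < t)
    (hα : 0 < α) (hN1 : 1 ≤ N) (htN : t ≤ N) (hαN : 1 / α ≤ N) {D w b : ℕ}
    (P : Program (Fin n) (ListBits D n w))
    (hP : ∀ i, 1 - 1 / ((72 * d ^ 2 * (6 * N ^ 2) ^ 4 : ℕ) : ℝ) ≤
      P.prob i (ListsRow b (M i) (1 / ((72 * d ^ 2 * (6 * N ^ 2) ^ 4 : ℕ) : ℝ)))) :
    ∃ (a : ℕ) (C : Circuit (Fin n ⊕ Fin a)),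
      C.size ≤ simulationCost P.size (18 * d ^ 2 * (6 * N ^ 2) ^ 2)
        (4 * N ^ 3 * (3 * d * (6 * N ^ 2)) ^ 4) ∧
      Approximates C (NormedSpace.exp ((-Complex.I * (t : ℂ)) • chainHamiltonian M π)) α := by
  classical
  set k : ℕ := 6 * N ^ 2 with hk
  have hNpos : 0 < N := hN1
  have hk1 : 1 ≤ k := by
    have : 0 < N ^ 2 := by positivity
    omega
  have hd1' : (1 : ℝ) ≤ d := by exact_mod_cast hd1
  have hk1' : (1 : ℝ) ≤ k := by exact_mod_cast hk1
  have hN1' : (1 : ℝ) ≤ N := by exact_mod_cast hN1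
  have hG : (1 : ℝ) ≤ 3 * d * k := by nlinarith
  set η : ℝ := 1 / (3 * d * k) with hη
  have hη0 : 0 ≤ η := by positivity
  have hη1 : η ≤ 1 := div_le_one_of_le₀ hG (by linarith)
  set L : ℕ := 18 * d ^ 2 * k ^ 2 with hL
  have hLpos : 0 < L := by positivity
  set r : ℕ := 4 * N ^ 3 * (3 * d * k) ^ 4 with hr
  obtain ⟨h1, h2, h3⟩ := walk_error_le ht hα hN1' htN hαN hG
  set τ : ℝ := t / (8 * N ^ 3 * (3 * d * k) ^ 2) with hτ
  have hτ0 : 0 ≤ τ := by positivity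
  have hprep := prep_error_le hd1' hk1'
  have hnorm : ‖flagProj n P.ancillas * (rowPrep P.out η L b P.circuit.toMatrix *
      zeroExt (Fin n) (Anc n P.ancillas)) - rowTarget P.ancillas η M‖ ≤ η * (1 / k) := by
    refine norm_flagProj_mul_rowPrep_sub_le P.out hη0 hη1 hLpos P.circuit.conjTranspose_mul_self
      hM.stochastic (d := d) ?_ (ε := 1 / ((72 * d ^ 2 * k ^ 4 : ℕ) : ℝ)) ?_ (by positivity) ?_
    · intro i
      convert hd i
    · intro i
      convert P.sum_bad_le i (hP i)
      rfl
    · rw [hL]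
      push_cast
      exact hprep
  obtain ⟨Y, hY, hYn⟩ := exists_implementable_walk hη0 hη1 hLpos
    (Implementable.of_circuit_self P.circuit) hM.stochastic (by positivity)
    (div_le_one_of_le₀ hk1' (by positivity)) hnorm hτ0 h2 r
  have hc : ‖Complex.exp (-Complex.I * t)‖ = 1 := by
    have : -Complex.I * (t : ℂ) = ((-t : ℝ) : ℂ) * Complex.I := by
      push_cast
      ring
    rw [this, Complex.norm_exp_ofReal_mul_I]
  have hrτ : 2 * (r : ℝ) * τ * η ^ 2 = t := by
    rw [hr]
    push_cast
    exact h1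
  have herr : ‖Complex.exp (-Complex.I * t) • (1 : Matrix (Bits (Reg n P.ancillas)) _ ℂ) * Y *
      zeroExt (Fin n) (Anc n P.ancillas) - zeroExt (Fin n) (Anc n P.ancillas) *
      NormedSpace.exp ((-Complex.I * (t : ℂ)) • chainHamiltonian M π)‖ ≤ α := by
    rw [chainHamiltonian_eq hM, exp_smul_one_sub, Matrix.smul_mul, Matrix.one_mul, Matrix.smul_mul,
      Matrix.mul_smul, ← smul_sub, norm_smul, hc, one_mul]
    rw [hrτ] at hYn
    refine hYn.trans ?_
    rw [hr, hη, hk]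
    rw [hk] at h3
    push_cast at h3 ⊢
    exact h3
  obtain ⟨a, C, hC, hC'⟩ := exists_circuit_of_implementable
    ((implementable_phase hc).mul hY) herr
  refine ⟨a, C, hC.trans ?_, hC'⟩
  have hS : P.size = n + P.ancillas + P.circuit.length := by
    simp [Program.size, Circuit.size]
  have hout : D * (1 + n + w) ≤ P.size := by
    have := P.card_out_le
    omega
  have hcost := prep_cost_le hout L
  rw [card_anc, simulationCost]
  have hstep : 2 * (2 * (9 * n + 2 * P.circuit.length + 1 +
        D * (10 * n + L * ((w + 1) * (11 * (n + 1 + w) + 1)))) + 1 +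
        (11 * (2 * n + P.ancillas + 2) + 1))
      ≤ 150 * P.size + 4 * (L * (P.size * (11 * P.size + 1))) + 52 := by
    omega
  have := Nat.mul_le_mul_left r hstep
  omega

/-- Bounded by a power, for arguments at least two. -/
def PolyBound (f : ℕ → ℕ) : Prop := ∃ c, ∀ N, 2 ≤ N → f N ≤ N ^ c

theorem PolyBound.const (K : ℕ) : PolyBound fun _ => K :=
  ⟨K, fun _ hN => Nat.lt_two_pow_self.le.trans (Nat.pow_le_pow_left hN K)⟩

theorem PolyBound.id : PolyBound fun N => N := ⟨1, fun N _ => by simp⟩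

theorem PolyBound.mul {f g : ℕ → ℕ} (hf : PolyBound f) (hg : PolyBound g) :
    PolyBound fun N => f N * g N := by
  obtain ⟨a, ha⟩ := hf
  obtain ⟨b, hb⟩ := hg
  exact ⟨a + b, fun N hN => by
    rw [pow_add]
    exact Nat.mul_le_mul (ha N hN) (hb N hN)⟩

theorem PolyBound.add {f g : ℕ → ℕ} (hf : PolyBound f) (hg : PolyBound g) :
    PolyBound fun N => f N + g N := by
  obtain ⟨a, ha⟩ := hf
  obtain ⟨b, hb⟩ := hg
  refine ⟨a + b + 1, fun N hN => ?_⟩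
  have h1 : N ^ a ≤ N ^ (a + b) := Nat.pow_le_pow_right (by omega) (by omega)
  have h2 : N ^ b ≤ N ^ (a + b) := Nat.pow_le_pow_right (by omega) (by omega)
  have h3 : N ^ (a + b) * 2 ≤ N ^ (a + b) * N := Nat.mul_le_mul_left _ hN
  refine (Nat.add_le_add (ha N hN) (hb N hN)).trans ?_
  rw [pow_succ]
  omega

theorem PolyBound.pow {f : ℕ → ℕ} (hf : PolyBound f) (e : ℕ) : PolyBound fun N => f N ^ e := by
  obtain ⟨a, ha⟩ := hf
  exact ⟨a * e, fun N hN => by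
    rw [pow_mul]
    exact Nat.pow_le_pow_left (ha N hN) e⟩

theorem polyBound_simulationCost {S L r : ℕ → ℕ} (hS : PolyBound S) (hL : PolyBound L)
    (hr : PolyBound r) : PolyBound fun N => simulationCost (S N) (L N) (r N) :=
  (((PolyBound.const 4).mul hS).add (.const 4)).add (hr.mul ((((PolyBound.const 150).mul hS).add
    ((PolyBound.const 4).mul (hL.mul (hS.mul (((PolyBound.const 11).mul hS).add (.const 1)))))).add
      (.const 52)))

end Parameters

end QMarkov

end

theorem corollary1 {ι : Type*} (n : ι → ℕ)
    (M : ∀ x, Matrix (QMarkov.Bits (Fin (n x))) (QMarkov.Bits (Fin (n x))) ℝ)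
    (π : ∀ x, QMarkov.Bits (Fin (n x)) → ℝ)
    (hM : QMarkov.StronglySamplable n M π) :
    QMarkov.Simulatable n (fun x => QMarkov.chainHamiltonian (M x) (π x)) := by
  open QMarkov in
  refine ⟨fun x => ?_, ?_⟩
  · change (chainHamiltonian (M x) (π x)).IsHermitian
    rw [chainHamiltonian_eq (hM.reversible x)]
    exact Matrix.isHermitian_one.sub (symmetrized_isHermitian _)
  obtain ⟨c, hc⟩ := hM.rowComputable
  have hd : PolyBound fun N => c * (N + 2) ^ c + 1 :=
    ((PolyBound.const c).mul ((PolyBound.id.add (.const 2)).pow c)).add (.const 1)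
  have hk : PolyBound fun N => 6 * N ^ 2 := (PolyBound.const 6).mul (PolyBound.id.pow 2)
  have hE : PolyBound fun N => 72 * (c * (N + 2) ^ c + 1) ^ 2 * (6 * N ^ 2) ^ 4 :=
    ((PolyBound.const 72).mul (hd.pow 2)).mul (hk.pow 4)
  obtain ⟨e, he⟩ := polyBound_simulationCost ((PolyBound.const c).mul ((PolyBound.id.add hE).pow c))
    (((PolyBound.const 18).mul (hd.pow 2)).mul (hk.pow 2))
    (((PolyBound.const 4).mul (PolyBound.id.pow 3)).mul
      ((((PolyBound.const 3).mul hd).mul hk).pow 4))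
  refine ⟨2 ^ e, fun x t ht α hα hα1 => ?_⟩
  set X : ℝ := (n x : ℝ) + t + 1 / α with hX
  have hα2 : 1 < 1 / α := by rwa [lt_div_iff₀ hα, one_mul]
  have hn0 : (0 : ℝ) ≤ n x := Nat.cast_nonneg _
  have hX1 : 1 < X := by linarith
  set N : ℕ := ⌈X⌉₊ with hN
  have hXN : X ≤ N := Nat.le_ceil X
  have hNX : (N : ℝ) ≤ 2 * X := by
    have := Nat.ceil_lt_add_one (by linarith : 0 ≤ X)
    linarith
  have hN2 : 2 ≤ N := by
    have : (1 : ℝ) < N := by linarith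
    exact_mod_cast this
  have hnN : n x ≤ N := by
    have : (n x : ℝ) ≤ N := by linarith
    exact_mod_cast this
  set d : ℕ := c * (N + 2) ^ c + 1 with hd'
  -- A program with error `1 / 2` already bounds the number of nonzero entries of a row.
  have hsupp : ∀ i, (Finset.univ.filter fun j => M x i j ≠ 0).card ≤ d := by
    obtain ⟨D, w, b, P, hP, hP'⟩ := hc x (1 / 2) (by norm_num) (by norm_num)
    have h1 : D ≤ P.size := by
      have h2 : D * 1 ≤ D * (1 + n x + w) := Nat.mul_le_mul_left D (by omega)
      have h3 : P.size = n x + P.ancillas + P.circuit.length := by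
        simp [Program.size, Circuit.size]
      have := P.card_out_le
      omega
    have h2 : P.size ≤ c * (n x + 2) ^ c := by
      rw [one_div_one_div] at hP
      exact_mod_cast hP
    have h3 : c * (n x + 2) ^ c ≤ c * (N + 2) ^ c := by gcongr
    intro i
    have := card_support_le_of_prob_pos (lt_of_lt_of_le (by norm_num) (hP' i))
    omega
  have hEN1 : 1 < 72 * d ^ 2 * (6 * N ^ 2) ^ 4 := by
    have h1 : 0 < d ^ 2 * (6 * N ^ 2) ^ 4 := by
      have : 0 < N := by omega
      positivity
    rw [mul_assoc]
    omega
  have hEN1' : (1 : ℝ) < (72 * d ^ 2 * (6 * N ^ 2) ^ 4 : ℕ) := by exact_mod_cast hEN1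
  obtain ⟨D, w, b, P, hP, hP'⟩ := hc x (1 / (72 * d ^ 2 * (6 * N ^ 2) ^ 4 : ℕ))
    (by positivity) (by rwa [div_lt_one (by linarith)])
  obtain ⟨a, C, hC, hC'⟩ := exists_circuit_chainHamiltonian (hM.reversible x) (Nat.le_add_left 1 _)
    hsupp ht hα (by omega : 1 ≤ N) (by linarith) (by linarith) P hP'
  refine ⟨a, C, ?_, hC'⟩
  have hS : P.size ≤ c * (N + 72 * d ^ 2 * (6 * N ^ 2) ^ 4) ^ c := by
    rw [one_div_one_div] at hP
    have h1 : P.size ≤ c * (n x + 72 * d ^ 2 * (6 * N ^ 2) ^ 4) ^ c := by exact_mod_cast hP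
    exact h1.trans (by gcongr)
  have hsize : C.size ≤ N ^ e := (hC.trans (simulationCost_mono hS _ _)).trans (he N hN2)
  have he2 : e ≤ 2 ^ e := Nat.lt_two_pow_self.le
  calc (C.size : ℝ) ≤ (N : ℝ) ^ e := by exact_mod_cast hsize
    _ ≤ (2 * X) ^ e := by gcongr
    _ = 2 ^ e * X ^ e := mul_pow _ _ _
    _ ≤ 2 ^ e * X ^ (2 ^ e) := by gcongr; exact hX1.le
    _ = ((2 ^ e : ℕ) : ℝ) * X ^ (2 ^ e) := by push_cast; ring
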